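/- **Setting.** Let $E$ and $\mathcal U$ be compact metric spaces, $E_0\subseteq E$ open, and $A\subseteq C(E)\times C(E)$ with $(1,0)\in A$. Let $\Xi$ be a closed subset of $(E\setminus E_0)\times\mathcal U$ such that for every $x\in E\setminus E_0$ there is $u\in\mathcal U$ with $(x,u)\in\Xi$. Let $B\subseteq C(E)\times C(\Xi)$ with $(1,0)\in B$, and assume that $\mathcal D:=\mathcal D(A)\cap\mathcal D(B)$ is dense in $C(E)$ (sup norm). Let $U\subseteq E$ be open. $D_E[0,\infty)$ denotes the càdlàg paths in $E$, and $\mathcal L_{\mathcal U}$ the Borel measures $\mu$ on $[0,\infty)\times\mathcal U$ with $\mu([0,t]\times\mathcal U)<\infty$ for all $t$. These spaces carry the Borel $\sigma$-algebras of the Skorokhod and vague topologies respectively, which are generated by the maps $y\mapsto y(t)$ and $\mu\mapsto\mu(C)$ respectively. For $L\in\mathcal L_{\mathcal U}$ write $L(t):=L([0,t]\times\cdot)$, and let $L(\cdot\wedge\theta)$ be the measure with $[0,t]\times C\mapsto L([0,t\wedge\theta]\times C)$. **Definition.** Let $Y^U$ be a process in $D_E[0,\infty)$, $\lambda_0^U$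 a nonnegative nondecreasing càdlàg process and $\Lambda_1^U$ an $\mathcal L_{\mathcal U}$-valued random variable, defined on one probability space. Put $\lambda_1^U(t):=\Lambda_1^U([0,t]\times\mathcal U)$ and $$\theta^U:=\inf\{t\ge 0:\ Y^U(t)\notin U\ \text{or}\ Y^U(t-)\notin U\}\in[0,\infty],$$ with $\inf\emptyset=\infty$ and $Y^U(0-)=Y^U(0)$. The triple $(Y^U,\lambda_0^U,\Lambda_1^U)$ is a solution of the *stopped controlled martingale problem* for $(A,E_0,B,\Xi;U)$ if, almost surely, for all $t\ge 0$, $$\lambda_0^U(t)=\int_{[0,t]}\mathbf 1_{\overline{E_0}}(Y^U(s))\,d\lambda_0^U(s),\qquad \lambda_1^U(t)=\int_{[0,t]\times\mathcal U}\mathbf 1_{\Xi}(Y^U(s),u)\,\Lambda_1^U(ds\times du),$$ $$(Y^U,\lambda_0^U,\Lambda_1^U)(t)=(Y^U,\lambda_0^U,\Lambda_1^U)(t\wedge\theta^U),\qquad \lambda_0^U(t)+\lambda_1^U(t)=t\wedge\theta^U,$$ and if, for every $f\in\mathcal D$, $$f(Y^U(t))-f(Y^U(0))-\int_0^t Af(Y^U(s))\,d\lambda_0^U(s)-\int_{[0,t]\times\mathcal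 U}Bf(Y^U(s),u)\,\Lambda_1^U(ds\times du)$$ is a martingale with respect to the filtration $\mathcal F_t=\sigma(Y^U(s),\lambda_0^U(s),\Lambda_1^U(s):s\le t)$. (If $A$ or $B$ is multivalued, this is required for every $g$ with $(f,g)\in A$ in place of $Af$ and every $h$ with $(f,h)\in B$ in place of $Bf$.) For $U=E$, so that $\theta^U=\infty$, the triple is called a solution $(Y,\lambda_0,\Lambda_1)$ of the *controlled martingale problem* for $(A,E_0,B,\Xi)$. **Theorem.** Suppose that for every Borel probability measure $\nu$ on $E$ there exists a solution of the controlled martingale problem for $(A,E_0,B,\Xi)$ such that $Y(0)$ has distribution $\nu$. Then for every solution $(Y^U,\lambda_0^U,\Lambda_1^U)$ of the stopped controlled martingale problem for $(A,E_0,B,\Xi;U)$ there exists a solution $(Y,\lambda_0,\Lambda_1)$ of the controlled martingale problem for $(A,E_0,B,\Xi)$, possibly on another probability space, such that, with $\theta:=\inf\{t\ge 0:\ Y(t)\notin U\ \text{or}\ Y(t-)\notin U\}$, $$\big(Y^U,\lambda_0^U,\Lambda_1^U,\theta^U\big)\quad\text{and}\quad\big(Y(\cdot\wedge\theta),\lambda_0(\cdot\wedge\theta),\Lambda_1(\cdot\wedge\theta),\theta\big)$$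 have the same distribution. -/

import Mathlib

open MeasureTheory ProbabilityTheory Topology Set
open scoped NNReal ENNReal

noncomputable section

/-- A path `y : [0,∞) → E` is càdlàg: right continuous with left limits. At `t = 0` the condition on
the left limit is void. -/
def IsCadlagPath {E : Type*} [TopologicalSpace E] (y : ℝ≥0 → E) : Prop :=
  ∀ t : ℝ≥0, ContinuousWithinAt y (Ici t) t ∧ ∃ l : E, Filter.Tendsto y (𝓝[<] t) (𝓝 l)

/-- The path space `D_E[0,∞)`. -/
def CadlagPath (E : Type*) [TopologicalSpace E] : Type _ := {y : ℝ≥0 → E // IsCadlagPath y}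

instance {E : Type*} [TopologicalSpace E] : CoeFun (CadlagPath E) (fun _ => ℝ≥0 → E) :=
  ⟨fun y => y.1⟩

/-- The σ-algebra on `D_E[0,∞)` generated by the coordinate maps `y ↦ y t`; for a separable metric
space `E` it is the Borel σ-algebra of the Skorokhod topology. -/
instance {E : Type*} [TopologicalSpace E] [MeasurableSpace E] : MeasurableSpace (CadlagPath E) :=
  inferInstanceAs (MeasurableSpace {y : ℝ≥0 → E // IsCadlagPath y})

/-- The nondecreasing paths in `D_{[0,∞)}[0,∞)`. -/
def IncPath : Type := {l : CadlagPath ℝ≥0 // Monotone l}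

instance : CoeFun IncPath (fun _ => ℝ≥0 → ℝ≥0) := ⟨fun l => l.1⟩

instance : MeasurableSpace IncPath :=
  inferInstanceAs (MeasurableSpace {l : CadlagPath ℝ≥0 // Monotone l})

/-- The Lebesgue-Stieltjes measure `dl` on `[0,∞)` of a nondecreasing right continuous path `l`,
with `dl (s,t] = l t - l s` and without mass at `0` (the paths used below start at `0`). -/
def IncPath.measure (l : IncPath) : Measure ℝ≥0 :=
  StieltjesFunction.measure
    { toFun := fun t => (l t : ℝ)
      mono' := fun _ _ h => NNReal.coe_le_coe.2 (l.2 h)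
      right_continuous' := fun t =>
        NNReal.continuous_coe.continuousAt.comp_continuousWithinAt (l.1.2 t).1 }

/-- The space of Borel measures `μ` on `[0,∞) × 𝒰` with `μ ([0,t] × 𝒰) < ∞` for all `t`. -/
def ControlMeasure (𝒰 : Type*) [MeasurableSpace 𝒰] : Type _ :=
  {μ : Measure (ℝ≥0 × 𝒰) // ∀ t : ℝ≥0, μ (Icc 0 t ×ˢ univ) < ∞}

/-- The σ-algebra generated by the evaluations `μ ↦ μ C` for Borel `C ⊆ [0,∞) × 𝒰`; for compact
metric `𝒰` it is the Borel σ-algebra of the topology of vague convergence. -/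
instance {𝒰 : Type*} [MeasurableSpace 𝒰] : MeasurableSpace (ControlMeasure 𝒰) :=
  inferInstanceAs
    (MeasurableSpace {μ : Measure (ℝ≥0 × 𝒰) // ∀ t : ℝ≥0, μ (Icc 0 t ×ˢ univ) < ∞})

/-- `L(t) = L([0,t] × ·)`, a measure on `𝒰`. -/
def ControlMeasure.at {𝒰 : Type*} [MeasurableSpace 𝒰] (L : ControlMeasure 𝒰) (t : ℝ≥0) :
    Measure 𝒰 :=
  (L.1.restrict (Icc 0 t ×ˢ univ)).map Prod.snd

/-- The time `t ∧ θ`, for `t ∈ [0,∞)` and `θ ∈ [0,∞]`. -/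
def minTime (t : ℝ≥0) (θ : ℝ≥0∞) : ℝ≥0 := (min (t : ℝ≥0∞) θ).toNNReal

theorem minTime_top (t : ℝ≥0) : minTime t ∞ = t := by simp [minTime]

theorem minTime_coe (t θ : ℝ≥0) : minTime t θ = min t θ := by
  rw [minTime, ← ENNReal.coe_min, ENNReal.toNNReal_coe]

theorem minTime_mono (θ : ℝ≥0∞) : Monotone fun t => minTime t θ := by
  intro s t h
  refine ENNReal.toNNReal_mono (ne_top_of_le_ne_top ENNReal.coe_ne_top (min_le_left _ _)) ?_
  exact min_le_min_right _ (ENNReal.coe_le_coe.2 h)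

theorem IsCadlagPath.stopAt {E : Type*} [TopologicalSpace E] {y : ℝ≥0 → E} (hy : IsCadlagPath y)
    (θ : ℝ≥0∞) : IsCadlagPath fun t => y (minTime t θ) := by
  induction θ using ENNReal.recTopCoe with
  | top => simpa only [minTime_top] using hy
  | coe θ =>
    simp only [minTime_coe]
    intro t
    constructor
    · have h1 : ContinuousWithinAt (fun s : ℝ≥0 => min s θ) (Ici t) t :=
        (continuous_id.min continuous_const).continuousWithinAt
      exact ContinuousWithinAt.comp (t := Ici (min t θ)) (hy (min t θ)).1 h1
        (fun s (hs : t ≤ s) => show min t θ ≤ min s θ from min_le_min_right θ hs)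
    · rcases le_or_gt t θ with h | h
      · obtain ⟨l, hl⟩ := (hy t).2
        refine ⟨l, hl.congr' ?_⟩
        filter_upwards [self_mem_nhdsWithin] with s hs
        rw [min_eq_left ((le_of_lt hs).trans h)]
      · refine ⟨y θ, tendsto_const_nhds.congr' ?_⟩
        filter_upwards [nhdsWithin_le_nhds (lt_mem_nhds h)] with s hs
        rw [min_eq_right (le_of_lt hs)]

/-- The stopped path `y(· ∧ θ)`. -/
def CadlagPath.stopAt {E : Type*} [TopologicalSpace E] (y : CadlagPath E) (θ : ℝ≥0∞) :
    CadlagPath E :=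
  ⟨fun t => y (minTime t θ), y.2.stopAt θ⟩

/-- The stopped nondecreasing path `l(· ∧ θ)`. -/
def IncPath.stopAt (l : IncPath) (θ : ℝ≥0∞) : IncPath :=
  ⟨l.1.stopAt θ, l.2.comp (minTime_mono θ)⟩

/-- The stopped measure `L(· ∧ θ)`, given by `[0,t] × C ↦ L([0, t ∧ θ] × C)`; that is, `L`
restricted to the times `s ≤ θ`. -/
def ControlMeasure.stopAt {𝒰 : Type*} [MeasurableSpace 𝒰] (L : ControlMeasure 𝒰) (θ : ℝ≥0∞) :
    ControlMeasure 𝒰 :=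
  ⟨L.1.restrict ({s : ℝ≥0 | (s : ℝ≥0∞) ≤ θ} ×ˢ univ),
    fun t => (Measure.restrict_apply_le _ _).trans_lt (L.2 t)⟩

/-- The exit time `inf {t ≥ 0 : y(t) ∉ U or y(t-) ∉ U} ∈ [0,∞]`, with `inf ∅ = ∞` and
`y(0-) = y(0)`. -/
def exitTime {E : Type*} [TopologicalSpace E] (U : Set E) (y : CadlagPath E) : ℝ≥0∞ :=
  sInf ((fun t : ℝ≥0 => (t : ℝ≥0∞)) '' {t : ℝ≥0 | y t ∉ U ∨ Function.leftLim y t ∉ U})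

section Processes

variable {E 𝒰 Ω : Type*} [MeasurableSpace Ω] [TopologicalSpace E] [MeasurableSpace E]
  [MeasurableSpace 𝒰]

theorem measurable_eval_path {Y : Ω → CadlagPath E} (hY : Measurable Y) (t : ℝ≥0) :
    Measurable fun ω => Y ω t :=
  (measurable_pi_apply t).comp (measurable_subtype_coe.comp hY)

theorem measurable_eval_inc {l : Ω → IncPath} (hl : Measurable l) (t : ℝ≥0) :
    Measurable fun ω => l ω t :=
  measurable_eval_path (measurable_subtype_coe.comp hl) t

theorem measurable_control_at {L : Ω → ControlMeasure 𝒰} (hL : Measurable L) (t : ℝ≥0) :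
    Measurable fun ω => (L ω).at t := by
  have h : Measurable fun ω => (L ω).1 := measurable_subtype_coe.comp hL
  have hs : MeasurableSet (Icc (0 : ℝ≥0) t ×ˢ (univ : Set 𝒰)) :=
    measurableSet_Icc.prod MeasurableSet.univ
  refine (Measure.measurable_map _ measurable_snd).comp ?_
  refine Measure.measurable_of_measurable_coe _ fun C hC => ?_
  simp only [Measure.restrict_apply hC]
  exact (Measure.measurable_coe (hC.inter hs)).comp h

/-- The filtration `ℱ_t = σ(Y(s), λ₀(s), Λ₁(s) : s ≤ t)` generated by the three processes. -/
def controlFiltration {Y : Ω → CadlagPath E} {lam : Ω → IncPath} {Lam : Ω → ControlMeasure 𝒰}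
    (hY : Measurable Y) (hl : Measurable lam) (hL : Measurable Lam) :
    Filtration ℝ≥0 (inferInstance : MeasurableSpace Ω) where
  seq t := ⨆ s ∈ Icc (0 : ℝ≥0) t,
    MeasurableSpace.comap (fun ω => (Y ω s, lam ω s, (Lam ω).at s)) inferInstance
  mono' _ _ h := biSup_mono fun _ hs => ⟨hs.1, hs.2.trans h⟩
  le' _ := iSup₂_le fun s _ => Measurable.comap_le
    ((measurable_eval_path hY s).prodMk
      ((measurable_eval_inc hl s).prodMk (measurable_control_at hL s)))

end Processes

/-- The process
`f(Y(t)) - f(Y(0)) - ∫_{[0,t]} g(Y(s)) dλ₀(s) - ∫_{[0,t]×𝒰} h(Y(s),u) Λ₁(ds×du)` along one path,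
where `h`, given on `Ξ` only, is extended by `0` (the measure `Λ₁` of a solution is carried by
the `(s,u)` with `(Y(s),u) ∈ Ξ`). -/
def controlMart {E 𝒰 : Type*} [TopologicalSpace E] [TopologicalSpace 𝒰] [MeasurableSpace 𝒰]
    {Ξ : Set (E × 𝒰)} (f g : C(E, ℝ)) (h : C(Ξ, ℝ))
    (y : CadlagPath E) (l : IncPath) (L : ControlMeasure 𝒰) (t : ℝ≥0) : ℝ :=
  f (y t) - f (y 0) - (∫ s in Icc 0 t, g (y s) ∂l.measure)
    - ∫ p in Icc 0 t ×ˢ univ, Function.extend Subtype.val h 0 (y p.1, p.2) ∂L.1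

/-- `(Y, λ₀, Λ₁)`, defined on a probability space `(Ω, P)`, is a solution of the stopped controlled
martingale problem for `(A, E₀, B, Ξ; U)`. The operators `A`, `B` are given by their graphs. -/
structure IsStoppedControlledSolution {E 𝒰 Ω : Type*}
    [MetricSpace E] [MeasurableSpace E] [MetricSpace 𝒰] [MeasurableSpace 𝒰]
    (A : Set (C(E, ℝ) × C(E, ℝ))) (E₀ : Set E) {Ξ : Set (E × 𝒰)} (B : Set (C(E, ℝ) × C(Ξ, ℝ)))
    (U : Set E) [MeasurableSpace Ω] (P : Measure Ω)
    (Y : Ω → CadlagPath E) (lam : Ω → IncPath) (Lam : Ω → ControlMeasure 𝒰) : Prop where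
  measurable_Y : Measurable Y
  measurable_lam : Measurable lam
  measurable_Lam : Measurable Lam
  /-- `λ₀(t) = ∫_{[0,t]} 1_{closure E₀}(Y(s)) dλ₀(s)` -/
  lam_support : ∀ᵐ ω ∂P, ∀ t : ℝ≥0,
    (lam ω t : ℝ≥0∞) = ∫⁻ s in Icc 0 t, (closure E₀).indicator 1 (Y ω s) ∂(lam ω).measure
  /-- `Λ₁([0,t]×𝒰) = ∫_{[0,t]×𝒰} 1_Ξ(Y(s),u) Λ₁(ds×du)` -/
  Lam_support : ∀ᵐ ω ∂P, ∀ t : ℝ≥0,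
    (Lam ω).1 (Icc 0 t ×ˢ univ)
      = ∫⁻ p in Icc 0 t ×ˢ univ, Ξ.indicator 1 (Y ω p.1, p.2) ∂(Lam ω).1
  /-- `(Y, λ₀, Λ₁) = (Y, λ₀, Λ₁)(· ∧ θ)`, where `θ` is the exit time of `Y` from `U` -/
  stopped : ∀ᵐ ω ∂P, Y ω = (Y ω).stopAt (exitTime U (Y ω)) ∧
    lam ω = (lam ω).stopAt (exitTime U (Y ω)) ∧ Lam ω = (Lam ω).stopAt (exitTime U (Y ω))
  /-- `λ₀(t) + Λ₁([0,t]×𝒰) = t ∧ θ` -/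
  sum_eq : ∀ᵐ ω ∂P, ∀ t : ℝ≥0,
    (lam ω t : ℝ≥0∞) + (Lam ω).1 (Icc 0 t ×ˢ univ) = min (t : ℝ≥0∞) (exitTime U (Y ω))
  martingale : ∀ (f g : C(E, ℝ)) (h : C(Ξ, ℝ)), (f, g) ∈ A → (f, h) ∈ B →
    Martingale (fun t ω => controlMart f g h (Y ω) (lam ω) (Lam ω) t)
      (controlFiltration measurable_Y measurable_lam measurable_Lam) P

/-- A solution of the controlled martingale problem for `(A, E₀, B, Ξ)`: the case `U = E`, where
the exit time is `∞`. -/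
def IsControlledSolution {E 𝒰 Ω : Type*}
    [MetricSpace E] [MeasurableSpace E] [MetricSpace 𝒰] [MeasurableSpace 𝒰]
    (A : Set (C(E, ℝ) × C(E, ℝ))) (E₀ : Set E) {Ξ : Set (E × 𝒰)} (B : Set (C(E, ℝ) × C(Ξ, ℝ)))
    [MeasurableSpace Ω] (P : Measure Ω)
    (Y : Ω → CadlagPath E) (lam : Ω → IncPath) (Lam : Ω → ControlMeasure 𝒰) : Prop :=
  IsStoppedControlledSolution A E₀ B univ P Y lam Lam

end

universe uE uU u₁ u₂

/-! The solution is obtained by running the stopped solution up to its exit time θ and, where θ is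
finite, continuing with a fresh solution that starts at Y^U(θ). For the continuation, take a
solution whose initial law is that of Y^U(θ) and disintegrate its law over the starting point. This
gives a kernel κ on path space such that, for almost every e, κ(e) is carried by paths from e and
solves the martingale problem (`exists_solution_kernel`). On a product space, each ω receives a path
with law κ(Y^U(θ)(ω)), attached by `ControlPath.pasteAt`.

The pathwise conditions survive pasting because clocks add: (t ∧ θ) + (t - θ)⁺ = t
(`IsRegularPath.paste`). The process of the martingale problem is additive as well
(`pathMart_paste`), so its increment from a to b is that of the stopped solution plus that of the
continuation from (a - θ)⁺ to (b - θ)⁺. Both are tested against an event known at time a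
(`isPathMartingale_pasteAt`). The first contributes nothing: it vanishes if θ ≤ a, and if a < θ the
event involves the stopped solution alone. The second has mean zero conditionally on the entire
stopped solution: once that is frozen, θ is a constant and the event concerns the continuation up to
(a - θ)⁺. No optional stopping is required.

Since U is open, the exit time is attained and is determined by the path up to and including θ
(`exitTime_congr`). The pasted path therefore has the same exit time, and stopping it there returns
the given stopped solution almost surely, which is more than equality in law.

The remaining work is measure theoretic. Regular conditional laws exist because path space is
standard Borel, being a measurable retract of a space of countable codes
(`standardBorelSpace_of_retract`). The filtration at time t is generated by the path stopped at t
(`controlFiltration_eq_comap_stop`), so being a martingale is a property of the law; right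
continuity and a countable π-system transfer it to almost every conditional law
(`ae_isPathMartingale_kernel`). The null set may depend on (f, g, h), which is harmless because the
pasted process is tested for one such triple at a time. -/

/-! ### Approximation of times by rationals from the right -/

/-- A rational number slightly above `t`. -/
noncomputable def ratAbove (n : ℕ) (t : ℝ≥0) : ℚ≥0 := ((⌊(n + 1) * t⌋₊ + 1 : ℕ) : ℚ≥0) / (n + 1)

theorem coe_ratAbove (n : ℕ) (t : ℝ≥0) :
    (ratAbove n t : ℝ≥0) = ((⌊(n + 1) * t⌋₊ + 1 : ℕ) : ℝ≥0) / (n + 1) := by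
  simp [ratAbove]

theorem lt_ratAbove (n : ℕ) (t : ℝ≥0) : t < ratAbove n t := by
  rw [coe_ratAbove, lt_div_iff₀ (by positivity), mul_comm]
  push_cast
  exact Nat.lt_floor_add_one _

theorem ratAbove_le (n : ℕ) (t : ℝ≥0) : (ratAbove n t : ℝ≥0) ≤ t + 1 / (n + 1) := by
  have h : (0 : ℝ≥0) < n + 1 := by positivity
  rw [coe_ratAbove, div_le_iff₀ h, add_mul t, div_mul_cancel₀ _ h.ne', mul_comm t]
  push_cast
  gcongr
  exact Nat.floor_le (by positivity)

theorem ratAbove_mono (n : ℕ) {s t : ℝ≥0} (h : s ≤ t) :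
    (ratAbove n s : ℝ≥0) ≤ ratAbove n t := by
  rw [coe_ratAbove, coe_ratAbove]
  gcongr

theorem tendsto_ratAbove (t : ℝ≥0) :
    Filter.Tendsto (fun n => (ratAbove n t : ℝ≥0)) Filter.atTop (𝓝[>] t) := by
  refine tendsto_nhdsWithin_iff.2 ⟨?_, Filter.Eventually.of_forall fun n => lt_ratAbove n t⟩
  refine tendsto_of_tendsto_of_tendsto_of_le_of_le tendsto_const_nhds ?_
    (fun n => (lt_ratAbove n t).le) (fun n => ratAbove_le n t)
  have h : Filter.Tendsto (fun n : ℕ => 1 / ((n : ℝ≥0) + 1)) Filter.atTop (𝓝 0) :=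
    tendsto_one_div_add_atTop_nhds_zero_nat
  simpa using h.const_add t

theorem tendsto_ratAbove_comap (t : ℝ≥0) :
    Filter.Tendsto (fun n => ratAbove n t) Filter.atTop
      (Filter.comap (fun q : ℚ≥0 => (q : ℝ≥0)) (𝓝[>] t)) :=
  Filter.tendsto_comap_iff.2 (tendsto_ratAbove t)

instance neBot_comap_nhdsGT (t : ℝ≥0) :
    (Filter.comap (fun q : ℚ≥0 => (q : ℝ≥0)) (𝓝[>] t)).NeBot :=
  (tendsto_ratAbove_comap t).neBot

/-! ### Càdlàg paths and their values at rational times -/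

/-- For every `N` and `ε = 1/(k+1)`, the number of disjoint rational intervals in `[0,N]` over which
`s` moves by more than `ε` is bounded. -/
def FewJumps {E : Type*} [MetricSpace E] (s : ℚ≥0 → E) : Prop :=
  ∀ N k : ℕ, ∃ m : ℕ, ∀ F : Finset (ℚ≥0 × ℚ≥0),
    (∀ p ∈ F, p.1 < p.2 ∧ p.2 ≤ N ∧ 1 / ((k : ℝ) + 1) < dist (s p.1) (s p.2)) →
    (∀ p ∈ F, ∀ q ∈ F, p ≠ q → p.2 ≤ q.1 ∨ q.2 ≤ p.1) → F.card ≤ m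

/-- All quantifiers in `FewJumps` range over countable sets, finite families of rational intervals
included, so only countably many set operations occur. -/
theorem measurableSet_fewJumps {E : Type*} [MetricSpace E] [SecondCountableTopology E]
    [MeasurableSpace E] [BorelSpace E] : MeasurableSet {s : ℚ≥0 → E | FewJumps s} := by
  have hp : ∀ (N k : ℕ) (p : ℚ≥0 × ℚ≥0), MeasurableSet {s : ℚ≥0 → E |
      p.1 < p.2 ∧ p.2 ≤ N ∧ 1 / ((k : ℝ) + 1) < dist (s p.1) (s p.2)} := fun N k p =>
    (MeasurableSet.const _).inter ((MeasurableSet.const _).inter (measurableSet_lt measurable_const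
      ((measurable_pi_apply p.1).dist (measurable_pi_apply p.2))))
  have h : {s : ℚ≥0 → E | FewJumps s} = ⋂ (N : ℕ) (k : ℕ), ⋃ (m : ℕ), ⋂ F : Finset (ℚ≥0 × ℚ≥0),
      (⋂ p ∈ F, {s : ℚ≥0 → E | p.1 < p.2 ∧ p.2 ≤ N ∧
        1 / ((k : ℝ) + 1) < dist (s p.1) (s p.2)})ᶜ ∪
      {_s | (∀ p ∈ F, ∀ q ∈ F, p ≠ q → p.2 ≤ q.1 ∨ q.2 ≤ p.1) → F.card ≤ m} := by
    ext s
    simp only [FewJumps, mem_ofPred_eq, mem_iInter, mem_iUnion, mem_union, mem_compl_iff,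
      ← imp_iff_not_or]
  rw [h]
  exact MeasurableSet.iInter fun N => MeasurableSet.iInter fun k => MeasurableSet.iUnion fun m =>
    MeasurableSet.iInter fun F => (Finset.measurableSet_biInter F fun p _ => hp N k p).compl.union
      (MeasurableSet.const _)

/-- Close to t the path stays within ε/2 of its left limit on the left and of its value on the
right. An oscillation larger than ε must therefore straddle t. -/
theorem IsCadlagPath.exists_nhds_dist_le {E : Type*} [MetricSpace E] {y : ℝ≥0 → E}
    (hy : IsCadlagPath y) {ε : ℝ} (hε : 0 < ε) (t : ℝ≥0) :
    ∃ δ : ℝ≥0, 0 < δ ∧ ∀ a ∈ Metric.ball t δ, ∀ b ∈ Metric.ball t δ, a < b →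
      ε < dist (y a) (y b) → a < t ∧ t ≤ b := by
  have h2 : 0 < ε / 2 := by linarith
  obtain ⟨hr, l, hl⟩ := hy t
  have e1 := hr (Metric.ball_mem_nhds (y t) h2)
  have e2 := hl (Metric.ball_mem_nhds l h2)
  obtain ⟨δ1, p1, s1⟩ := Metric.mem_nhdsWithin_iff.1 e1
  obtain ⟨δ2, p2, s2⟩ := Metric.mem_nhdsWithin_iff.1 e2
  refine ⟨⟨min δ1 δ2, (lt_min p1 p2).le⟩, lt_min p1 p2, fun a ha b hb hab hd => ?_⟩
  have key : ∀ c x x' : E, x ∈ Metric.ball c (ε / 2) → x' ∈ Metric.ball c (ε / 2) →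
      dist x x' ≤ ε := fun c x x' hx hx' => by
    have := dist_triangle_right x x' c
    rw [Metric.mem_ball] at hx hx'
    linarith
  by_contra hcon
  rw [not_and_or, not_lt, not_le] at hcon
  refine hd.not_ge ?_
  rcases hcon with h | h
  · refine key (y t) _ _ (s1 ⟨?_, h⟩) (s1 ⟨?_, h.trans hab.le⟩)
    · exact Metric.ball_subset_ball (min_le_left δ1 δ2) ha
    · exact Metric.ball_subset_ball (min_le_left δ1 δ2) hb
  · refine key l _ _ (s2 ⟨?_, hab.trans h⟩) (s2 ⟨?_, h⟩)
    · exact Metric.ball_subset_ball (min_le_right δ1 δ2) ha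
    · exact Metric.ball_subset_ball (min_le_right δ1 δ2) hb

theorem IsCadlagPath.exists_finset_separating {E : Type*} [MetricSpace E] {y : ℝ≥0 → E}
    (hy : IsCadlagPath y) {ε : ℝ} (hε : 0 < ε) (N : ℝ≥0) :
    ∃ T : Finset ℝ≥0, ∀ a b, a < b → b ≤ N → ε < dist (y a) (y b) → ∃ t ∈ T, a < t ∧ t ≤ b := by
  classical
  choose δ hδ hδ' using hy.exists_nhds_dist_le hε
  obtain ⟨T, -, hT⟩ := (isCompact_Icc (a := (0 : ℝ≥0)) (b := N)).elim_nhds_subcover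
    (fun t => Metric.ball t (δ t)) fun t _ => Metric.ball_mem_nhds t (hδ t)
  -- If a lies in the ball about t but b does not, then b is beyond the right end t + δ t, and this
  -- end point separates a from b.
  refine ⟨T ∪ T.image fun t => t + δ t, fun a b hab hb hd => ?_⟩
  obtain ⟨t, ht, hat⟩ := mem_iUnion₂.1 (hT ⟨zero_le, hab.le.trans hb⟩)
  by_cases hbt : b ∈ Metric.ball t (δ t)
  · exact ⟨t, Finset.mem_union_left _ ht, hδ' t a hat b hbt hab hd⟩
  · refine ⟨t + δ t, Finset.mem_union_right _ (Finset.mem_image_of_mem _ ht), ?_⟩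
    rw [Metric.mem_ball, NNReal.dist_eq, abs_lt] at hat
    rw [Metric.mem_ball, NNReal.dist_eq, abs_lt, not_and_or] at hbt
    have hab' : (a : ℝ) < b := hab
    rw [← NNReal.coe_lt_coe, ← NNReal.coe_le_coe]
    push_cast
    constructor
    · linarith
    · rcases hbt with h | h <;> linarith

/-- Each interval (a, b] with a large oscillation contains a point of the finite separating set, and
disjoint intervals contain different points. -/
theorem IsCadlagPath.fewJumps {E : Type*} [MetricSpace E] {y : ℝ≥0 → E}
    (hy : IsCadlagPath y) : FewJumps fun q : ℚ≥0 => y q := by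
  intro N k
  obtain ⟨T, hT⟩ := hy.exists_finset_separating (ε := 1 / ((k : ℝ) + 1)) (by positivity) N
  refine ⟨T.card, fun F hF hsep => ?_⟩
  have hF' : ∀ p ∈ F, ∃ t ∈ T, (p.1 : ℝ≥0) < t ∧ t ≤ (p.2 : ℝ≥0) := fun p hp =>
    hT p.1 p.2 (by exact_mod_cast (hF p hp).1) (by exact_mod_cast (hF p hp).2.1) (hF p hp).2.2
  choose! τ h1 h2 h3 using hF'
  refine Finset.card_le_card_of_injOn τ (fun p hp => h1 p hp) fun p hp q hq hpq => ?_
  by_contra hne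
  rcases hsep p hp q hq hne with h | h
  · have h' : (p.2 : ℝ≥0) ≤ q.1 := by exact_mod_cast h
    exact absurd hpq (((h3 p hp).trans h').trans_lt (h2 q hq)).ne
  · have h' : (q.2 : ℝ≥0) ≤ p.1 := by exact_mod_cast h
    exact absurd hpq (((h3 q hq).trans h').trans_lt (h2 p hp)).ne'

/-- Without the Cauchy property, every set of the filter contains two points whose values are more
than a fixed ε apart. By `hsep` the next pair can be sought entirely on one side of the previous
one, which yields arbitrarily many disjoint intervals. The set S is a parameter so that left and
right limits are treated together. -/
theorem FewJumps.exists_tendsto {E : Type*} [MetricSpace E] [CompleteSpace E] {s : ℚ≥0 → E}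
    (hs : FewJumps s) {t : ℝ≥0} {S : Set ℝ≥0}
    [(Filter.comap (fun q : ℚ≥0 => (q : ℝ≥0)) (𝓝[S] t)).NeBot]
    (hsep : ∀ a b : ℚ≥0, (a : ℝ≥0) ∈ S → (b : ℝ≥0) ∈ S → a < b →
      ∃ V ∈ Filter.comap (fun q : ℚ≥0 => (q : ℝ≥0)) (𝓝[S] t),
        (∀ x ∈ V, x < a) ∨ (∀ x ∈ V, b < x)) :
    ∃ l, Filter.Tendsto s (Filter.comap (fun q : ℚ≥0 => (q : ℝ≥0)) (𝓝[S] t)) (𝓝 l) := by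
  classical
  set L := Filter.comap (fun q : ℚ≥0 => (q : ℝ≥0)) (𝓝[S] t) with hL
  suffices h : Cauchy (Filter.map s L) from CompleteSpace.complete h
  refine Metric.cauchy_iff.2 ⟨inferInstance, ?_⟩
  by_contra! hcon
  obtain ⟨ε, hε, hcon⟩ := hcon
  obtain ⟨k, hk⟩ := exists_nat_one_div_lt hε
  obtain ⟨N, hN⟩ := exists_nat_gt t
  have hS : {q : ℚ≥0 | (q : ℝ≥0) ∈ S} ∈ L := Filter.preimage_mem_comap self_mem_nhdsWithin
  have hN' : {q : ℚ≥0 | (q : ℝ≥0) < N} ∈ L :=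
    Filter.preimage_mem_comap (mem_nhdsWithin_of_mem_nhds (Iio_mem_nhds hN))
  have hpair : ∀ V ∈ L, ∃ a ∈ V, ∃ b ∈ V, a < b ∧ 1 / ((k : ℝ) + 1) < dist (s a) (s b) := by
    intro V hV
    obtain ⟨x, ⟨a, ha, rfl⟩, y, ⟨b, hb, rfl⟩, hab⟩ := hcon (s '' V) (Filter.image_mem_map hV)
    rcases lt_trichotomy a b with h | h | h
    · exact ⟨a, ha, b, hb, h, hk.trans_le hab⟩
    · subst h
      rw [dist_self] at hab
      exact absurd hab hε.not_ge
    · exact ⟨b, hb, a, ha, h, by rw [dist_comm]; exact hk.trans_le hab⟩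
  have hfam : ∀ n : ℕ, ∀ V ∈ L, ∃ F : Finset (ℚ≥0 × ℚ≥0), F.card = n ∧
      (∀ p ∈ F, p.1 ∈ V ∧ p.2 ∈ V ∧ p.1 < p.2 ∧ 1 / ((k : ℝ) + 1) < dist (s p.1) (s p.2)) ∧
      ∀ p ∈ F, ∀ q ∈ F, p ≠ q → p.2 ≤ q.1 ∨ q.2 ≤ p.1 := by
    intro n
    induction n with
    | zero => exact fun V _ => ⟨∅, by simp⟩
    | succ n ih =>
      intro V hV
      obtain ⟨a, ha, b, hb, hab, hd⟩ := hpair _ (Filter.inter_mem hV hS)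
      obtain ⟨W, hW, hWs⟩ := hsep a b ha.2 hb.2 hab
      obtain ⟨F, hc, hF, hFs⟩ := ih _ (Filter.inter_mem hV hW)
      have hnew : ∀ p ∈ F, p.2 ≤ a ∨ b ≤ p.1 := fun p hp =>
        hWs.imp (fun h => (h _ (hF p hp).2.1.2).le) (fun h => (h _ (hF p hp).1.2).le)
      have hnot : (a, b) ∉ F := fun h => by
        rcases hnew _ h with h' | h'
        · exact hab.not_ge h'
        · exact hab.not_ge h'
      refine ⟨insert (a, b) F, by rw [Finset.card_insert_of_notMem hnot, hc], ?_, ?_⟩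
      · intro p hp
        rcases Finset.mem_insert.1 hp with rfl | hp
        · exact ⟨ha.1, hb.1, hab, hd⟩
        · exact ⟨(hF p hp).1.1, (hF p hp).2.1.1, (hF p hp).2.2⟩
      · intro p hp q hq hne
        rcases Finset.mem_insert.1 hp with rfl | hp <;> rcases Finset.mem_insert.1 hq with rfl | hq
        · exact absurd rfl hne
        · exact (hnew q hq).symm
        · exact hnew p hp
        · exact hFs p hp q hq hne
  obtain ⟨m, hm⟩ := hs N k
  obtain ⟨F, hc, hF, hFs⟩ := hfam (m + 1) _ hN'
  have := hm F (fun p hp => ⟨(hF p hp).2.2.1, ?_, (hF p hp).2.2.2⟩) hFs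
  · omega
  · have h : (p.2 : ℝ≥0) < N := (hF p hp).2.1
    exact_mod_cast h.le

theorem FewJumps.exists_tendsto_right {E : Type*} [MetricSpace E] [CompleteSpace E] {s : ℚ≥0 → E}
    (hs : FewJumps s) (t : ℝ≥0) :
    ∃ l, Filter.Tendsto s (Filter.comap (fun q : ℚ≥0 => (q : ℝ≥0)) (𝓝[>] t)) (𝓝 l) :=
  hs.exists_tendsto fun a _ ha _ _ => ⟨_, Filter.preimage_mem_comap
    (mem_nhdsWithin_of_mem_nhds (Iio_mem_nhds ha)), Or.inl fun x hx => by
      have h : (x : ℝ≥0) < a := hx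
      exact_mod_cast h⟩

theorem FewJumps.exists_tendsto_left {E : Type*} [MetricSpace E] [CompleteSpace E] {s : ℚ≥0 → E}
    (hs : FewJumps s) (t : ℝ≥0) :
    ∃ l, Filter.Tendsto s (Filter.comap (fun q : ℚ≥0 => (q : ℝ≥0)) (𝓝[<] t)) (𝓝 l) := by
  -- The filter is trivial only at t = 0, where nothing has to be shown.
  by_cases h : (Filter.comap (fun q : ℚ≥0 => (q : ℝ≥0)) (𝓝[<] t)).NeBot
  · exact hs.exists_tendsto fun a b _ hb _ => ⟨_, Filter.preimage_mem_comap
      (mem_nhdsWithin_of_mem_nhds (Ioi_mem_nhds hb)), Or.inr fun x hx => by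
        have h : (b : ℝ≥0) < x := hx
        exact_mod_cast h⟩
  · rw [Filter.not_neBot] at h
    rw [h]
    exact ⟨s 0, Filter.tendsto_bot⟩

/-- Near t within the open set S, the value y u is a limit of values of s lying in a closed
neighbourhood of l, hence lies there too. Regularity of E supplies a basis of such neighbourhoods.
-/
theorem tendsto_of_tendsto_rat {E : Type*} [TopologicalSpace E] [RegularSpace E] {s : ℚ≥0 → E}
    {y : ℝ≥0 → E}
    (hy : ∀ u, Filter.Tendsto s (Filter.comap (fun q : ℚ≥0 => (q : ℝ≥0)) (𝓝[>] u)) (𝓝 (y u)))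
    {S : Set ℝ≥0} (hS : IsOpen S) {t : ℝ≥0} {l : E}
    (hl : Filter.Tendsto s (Filter.comap (fun q : ℚ≥0 => (q : ℝ≥0)) (𝓝[S] t)) (𝓝 l)) :
    Filter.Tendsto y (𝓝[S] t) (𝓝 l) := by
  refine (closed_nhds_basis l).tendsto_right_iff.2 fun C hC => ?_
  obtain ⟨W, hW, hWC⟩ := Filter.mem_comap.1 (hl hC.1)
  filter_upwards [eventually_eventually_nhdsWithin.2 hW, self_mem_nhdsWithin] with u hu huS
  rw [hS.nhdsWithin_eq huS] at hu
  refine hC.2.mem_of_tendsto (hy u) ?_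
  exact Filter.mem_of_superset (Filter.preimage_mem_comap (mem_nhdsWithin_of_mem_nhds hu)) hWC

theorem FewJumps.exists_cadlag {E : Type*} [MetricSpace E] [CompleteSpace E] {s : ℚ≥0 → E}
    (hs : FewJumps s) : ∃ y : CadlagPath E, ∀ u,
      Filter.Tendsto s (Filter.comap (fun q : ℚ≥0 => (q : ℝ≥0)) (𝓝[>] u)) (𝓝 (y u)) := by
  choose y hy using hs.exists_tendsto_right
  refine ⟨⟨y, fun t => ⟨?_, ?_⟩⟩, hy⟩
  · exact continuousWithinAt_Ioi_iff_Ici.1 (tendsto_of_tendsto_rat hy isOpen_Ioi (hy t))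
  · obtain ⟨l, hl⟩ := hs.exists_tendsto_left t
    exact ⟨l, tendsto_of_tendsto_rat hy isOpen_Iio hl⟩

theorem CadlagPath.tendsto_right {E : Type*} [TopologicalSpace E] (y : CadlagPath E) (t : ℝ≥0) :
    Filter.Tendsto y (𝓝[>] t) (𝓝 (y t)) :=
  (y.2 t).1.mono_left (nhdsWithin_mono _ Ioi_subset_Ici_self)

theorem CadlagPath.tendsto_ratAbove {E : Type*} [TopologicalSpace E] (y : CadlagPath E)
    (t : ℝ≥0) : Filter.Tendsto (fun n => y (ratAbove n t)) Filter.atTop (𝓝 (y t)) :=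
  (y.tendsto_right t).comp (_root_.tendsto_ratAbove t)

theorem measurable_cadlagPath_iff {E α : Type*} [TopologicalSpace E] [MeasurableSpace E]
    [MeasurableSpace α] {f : α → CadlagPath E} : Measurable f ↔ ∀ t, Measurable fun a => f a t := by
  refine ⟨fun h t => measurable_eval_path h t, fun h => ?_⟩
  exact (measurable_pi_iff.2 h).subtype_mk (h := fun a => (f a).2)

/-- The constant path. -/
def CadlagPath.const {E : Type*} [TopologicalSpace E] (e : E) : CadlagPath E :=
  ⟨fun _ => e, fun _ => ⟨continuousWithinAt_const, e, tendsto_const_nhds⟩⟩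

open Classical in
/-- The càdlàg path with given values at the rationals, if there is one. -/
noncomputable def decodePath {E : Type*} [MetricSpace E] [CompleteSpace E] (e : E)
    (s : ℚ≥0 → E) : CadlagPath E :=
  if hs : FewJumps s then hs.exists_cadlag.choose else CadlagPath.const e

theorem tendsto_decodePath {E : Type*} [MetricSpace E] [CompleteSpace E] (e : E)
    {s : ℚ≥0 → E} (hs : FewJumps s) (u : ℝ≥0) :
    Filter.Tendsto s (Filter.comap (fun q : ℚ≥0 => (q : ℝ≥0)) (𝓝[>] u))
      (𝓝 (decodePath e s u)) := by
  have h : decodePath e s = hs.exists_cadlag.choose := dif_pos hs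
  exact h ▸ hs.exists_cadlag.choose_spec u

theorem decodePath_eq {E : Type*} [MetricSpace E] [CompleteSpace E] (e : E) (y : CadlagPath E) :
    decodePath e (fun q : ℚ≥0 => y q) = y :=
  Subtype.ext (funext fun t => tendsto_nhds_unique (tendsto_decodePath e y.2.fewJumps t)
    ((y.tendsto_right t).comp Filter.tendsto_comap))

theorem measurable_decodePath {E : Type*} [MetricSpace E] [CompleteSpace E]
    [SecondCountableTopology E] [MeasurableSpace E] [BorelSpace E] (e : E) :
    Measurable (decodePath e) := by
  classical
  refine measurable_cadlagPath_iff.2 fun t => ?_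
  refine measurable_of_tendsto_metrizable
    (f := fun n s => if FewJumps s then s (ratAbove n t) else e)
    (fun n => Measurable.ite measurableSet_fewJumps (measurable_pi_apply _) measurable_const)
    (tendsto_pi_nhds.2 fun s => ?_)
  by_cases hs : FewJumps s
  · simp only [if_pos hs]
    exact (tendsto_decodePath e hs t).comp (tendsto_ratAbove_comap t)
  · have h : decodePath e s = CadlagPath.const e := dif_neg hs
    simp only [if_neg hs]
    exact h ▸ tendsto_const_nhds

/-- The range of c is the fixed-point set of c ∘ d, which is measurable in β. So c identifies α with
a measurable subset of a standard Borel space. -/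
theorem standardBorelSpace_of_retract {α β : Type*} [MeasurableSpace α] [MeasurableSpace β]
    [StandardBorelSpace β] {c : α → β} {d : β → α} (hc : Measurable c) (hd : Measurable d)
    (h : Function.LeftInverse d c) : StandardBorelSpace α := by
  have hr : range c = {b | c (d b) = b} := by
    ext b
    exact ⟨fun ⟨a, ha⟩ => by simp [← ha, h a], fun hb => ⟨d b, hb⟩⟩
  have hm : MeasurableEmbedding c := MeasurableEmbedding.of_measurable_inverse hc
    (hr ▸ measurableSet_eq_fun (hc.comp hd) measurable_id) hd h
  have := hm.measurableSet_range.standardBorel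
  let _ := upgradeStandardBorel (range c)
  let _ : TopologicalSpace α := TopologicalSpace.induced hm.equivRange inferInstance
  have : PolishSpace α := hm.equivRange.toEquiv.polishSpace_induced
  have : BorelSpace α := ⟨by
    rw [borel_comap, ← BorelSpace.measurable_eq (α := range c)]
    exact hm.equivRange.measurableEmbedding.comap_eq.symm⟩
  infer_instance

theorem standardBorelSpace_cadlagPath {E : Type*} [MetricSpace E] [CompleteSpace E]
    [SecondCountableTopology E] [MeasurableSpace E] [BorelSpace E] :
    StandardBorelSpace (CadlagPath E) := by
  rcases isEmpty_or_nonempty E with hE | ⟨⟨e⟩⟩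
  · have : IsEmpty (CadlagPath E) := ⟨fun y => hE.elim (y 0)⟩
    infer_instance
  · exact standardBorelSpace_of_retract (c := fun y (q : ℚ≥0) => y q) (d := decodePath e)
      (measurable_pi_iff.2 fun q => measurable_eval_path measurable_id _)
      (measurable_decodePath e) (decodePath_eq e)

theorem standardBorelSpace_incPath : StandardBorelSpace IncPath := by
  have := standardBorelSpace_cadlagPath (E := ℝ≥0)
  have h : {l : CadlagPath ℝ≥0 | Monotone l}
      = ⋂ (a : ℚ≥0) (b : ℚ≥0) (_ : a ≤ b), {l | l a ≤ l b} := by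
    ext l
    simp only [mem_ofPred_eq, mem_iInter]
    refine ⟨fun h a b hab => h (by exact_mod_cast hab), fun h a b hab => ?_⟩
    refine le_of_tendsto_of_tendsto' (l.tendsto_ratAbove a) (l.tendsto_ratAbove b) fun n => ?_
    exact h _ _ (by exact_mod_cast ratAbove_mono n hab)
  have hm : MeasurableSet {l : CadlagPath ℝ≥0 | Monotone l} := by
    rw [h]
    exact MeasurableSet.iInter fun a => MeasurableSet.iInter fun b => MeasurableSet.iInter fun _ =>
      measurableSet_le (measurable_eval_path measurable_id _) (measurable_eval_path measurable_id _)
  exact hm.standardBorel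

/-- Rounding the time up to a grid leaves countably many evaluation times, for which joint
measurability is clear; right continuity then gives the limit. Evaluation at random times rests on
this. -/
theorem measurable_eval_path_prod {E : Type*} [TopologicalSpace E]
    [TopologicalSpace.PseudoMetrizableSpace E]
    [MeasurableSpace E] [BorelSpace E] :
    Measurable fun p : CadlagPath E × ℝ≥0 => p.1 p.2 := by
  refine measurable_of_tendsto_metrizable (f := fun n p => p.1 (ratAbove n p.2)) (fun n => ?_)
    (tendsto_pi_nhds.2 fun p => p.1.tendsto_ratAbove p.2)
  have h1 : Measurable fun p : CadlagPath E × ℕ => p.1 (((p.2 + 1 : ℕ) : ℝ≥0) / (n + 1)) :=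
    measurable_from_prod_countable_left fun k =>
      measurable_eval_path measurable_id (((k + 1 : ℕ) : ℝ≥0) / (n + 1))
  have h2 : Measurable fun p : CadlagPath E × ℝ≥0 => (p.1, ⌊((n : ℝ≥0) + 1) * p.2⌋₊) :=
    measurable_fst.prodMk (Nat.measurable_floor.comp (measurable_snd.const_mul _))
  simp only [coe_ratAbove]
  exact h1.comp h2

/-! ### Exit times: measurability and dependence on the past -/

theorem CadlagPath.tendsto_leftLim {E : Type*} [MetricSpace E] (y : CadlagPath E) (t : ℝ≥0) :
    Filter.Tendsto y (𝓝[<] t) (𝓝 (Function.leftLim y t)) :=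
  tendsto_leftLim_of_tendsto (y.2 t).2

theorem CadlagPath.leftLim_congr {E : Type*} [MetricSpace E] {y y' : CadlagPath E} {t : ℝ≥0}
    (h : ∀ u ≤ t, y u = y' u) : Function.leftLim y t = Function.leftLim y' t := by
  by_cases hb : 𝓝[<] t = ⊥
  · rw [leftLim_eq_of_eq_bot _ hb, leftLim_eq_of_eq_bot _ hb, h t le_rfl]
  · have := Filter.neBot_iff.2 hb
    refine tendsto_nhds_unique (y.tendsto_leftLim t) ((y'.tendsto_leftLim t).congr' ?_)
    filter_upwards [self_mem_nhdsWithin] with u hu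
    exact (h u (le_of_lt hu)).symm

theorem notMem_compl_of_le_infEDist {E : Type*} [MetricSpace E] {U : Set E} {ε : ℝ≥0∞}
    (hε : 0 < ε) {x : E} (h : ε ≤ Metric.infEDist x Uᶜ) : x ∈ U := by
  by_contra hx
  rw [Metric.infEDist_zero_of_mem (s := Uᶜ) hx] at h
  exact hε.not_ge h

theorem exists_eventually_le_infEDist {E α : Type*} [MetricSpace E] {U : Set E} (hU : IsOpen U)
    {x : E} (hx : x ∈ U) {f : α → E} {l : Filter α} (hf : Filter.Tendsto f l (𝓝 x)) :
    ∃ ε : ℝ≥0∞, 0 < ε ∧ ∀ᶠ a in l, ε ≤ Metric.infEDist (f a) Uᶜ := by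
  have h : 0 < Metric.infEDist x Uᶜ := by
    rw [Metric.infEDist_pos_iff_notMem_closure, hU.isClosed_compl.closure_eq]
    exact fun h => h hx
  obtain ⟨ε, h0, h1⟩ := exists_between h
  refine ⟨ε, h0, ?_⟩
  exact ((Metric.continuous_infEDist.tendsto x).comp hf).eventually (le_mem_nhds h1)

/-- Compactness of [0, r]: around each t, the value bounds the distance to `Uᶜ` from below on the
right and the left limit does so on the left. -/
theorem CadlagPath.exists_le_infEDist {E : Type*} [MetricSpace E] {U : Set E} (hU : IsOpen U)
    (y : CadlagPath E) {r : ℝ≥0} (h : ∀ s ≤ r, y s ∈ U ∧ Function.leftLim y s ∈ U) :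
    ∃ ε : ℝ≥0∞, 0 < ε ∧ ∀ s ≤ r, ε ≤ Metric.infEDist (y s) Uᶜ := by
  suffices H : ∃ ε : ℝ≥0∞, 0 < ε ∧ ∀ s ∈ Icc 0 r, ε ≤ Metric.infEDist (y s) Uᶜ by
    obtain ⟨ε, h0, h1⟩ := H
    exact ⟨ε, h0, fun s hs => h1 s ⟨zero_le, hs⟩⟩
  refine (isCompact_Icc (a := (0 : ℝ≥0)) (b := r)).induction_on
    (p := fun S => ∃ ε : ℝ≥0∞, 0 < ε ∧ ∀ s ∈ S, ε ≤ Metric.infEDist (y s) Uᶜ)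
    ⟨1, one_pos, by simp⟩ ?_ ?_ ?_
  · rintro S T hST ⟨ε, h0, h1⟩
    exact ⟨ε, h0, fun s hs => h1 s (hST hs)⟩
  · rintro S T ⟨ε, h0, h1⟩ ⟨ε', h0', h1'⟩
    exact ⟨min ε ε', lt_min h0 h0',
      fun s hs => hs.elim (fun hs => (min_le_left _ _).trans (h1 s hs))
      fun hs => (min_le_right _ _).trans (h1' s hs)⟩
  · intro t ht
    obtain ⟨ε, h0, h1⟩ := exists_eventually_le_infEDist hU (h t ht.2).1 (y.2 t).1
    obtain ⟨ε', h0', h1'⟩ := exists_eventually_le_infEDist hU (h t ht.2).2 (y.tendsto_leftLim t)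
    refine ⟨{s | min ε ε' ≤ Metric.infEDist (y s) Uᶜ}, mem_nhdsWithin_of_mem_nhds ?_,
      min ε ε', lt_min h0 h0', fun s hs => hs⟩
    rw [← nhdsLT_sup_nhdsGE]
    refine ⟨?_, ?_⟩
    · filter_upwards [h1'] with s hs using (min_le_right _ _).trans hs
    · filter_upwards [h1] with s hs using (min_le_left _ _).trans hs

theorem exitTime_le {E : Type*} [TopologicalSpace E] {U : Set E} {y : CadlagPath E} {t : ℝ≥0}
    (h : y t ∉ U ∨ Function.leftLim y t ∉ U) : exitTime U y ≤ t :=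
  sInf_le ⟨t, h, rfl⟩

theorem mem_of_lt_exitTime {E : Type*} [MetricSpace E] {U : Set E} {y : CadlagPath E} {t : ℝ≥0}
    (h : (t : ℝ≥0∞) < exitTime U y) : y t ∈ U ∧ Function.leftLim y t ∈ U := by
  by_contra hcon
  rw [not_and_or] at hcon
  exact (exitTime_le hcon).not_gt h

/-- Before the exit time the distance to `Uᶜ` is bounded away from zero on compact intervals.
Conversely, such a bound at rational times extends to all values and left limits by continuity of
the distance. Only countably many evaluations appear, as measurability of the exit time demands. -/
theorem le_exitTime_iff {E : Type*} [MetricSpace E] {U : Set E} (hU : IsOpen U)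
    (y : CadlagPath E) (c : ℝ≥0∞) :
    c ≤ exitTime U y ↔ ∀ q : ℚ≥0, ((q : ℝ≥0) : ℝ≥0∞) < c →
      ∃ n : ℕ, ∀ p : ℚ≥0, p ≤ q → (n : ℝ≥0∞)⁻¹ ≤ Metric.infEDist (y p) Uᶜ := by
  constructor
  · intro h q hq
    obtain ⟨ε, h0, h1⟩ := y.exists_le_infEDist hU (r := q) fun s hs =>
      mem_of_lt_exitTime (((ENNReal.coe_le_coe.2 hs).trans_lt hq).trans_le h)
    obtain ⟨n, hn⟩ := ENNReal.exists_inv_nat_lt h0.ne'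
    exact ⟨n, fun p hp => hn.le.trans (h1 p (by exact_mod_cast hp))⟩
  · intro h
    refine le_sInf ?_
    rintro _ ⟨s, hs, rfl⟩
    by_contra! hsc
    obtain ⟨r, hsr, hrc⟩ := ENNReal.lt_iff_exists_nnreal_btwn.1 hsc
    rw [ENNReal.coe_lt_coe] at hsr
    obtain ⟨q, hsq, hqr⟩ : ∃ q : ℚ≥0, s < (q : ℝ≥0) ∧ (q : ℝ≥0) < r := by
      have h1 := ((tendsto_ratAbove s).mono_right nhdsWithin_le_nhds).eventually (gt_mem_nhds hsr)
      obtain ⟨n, hn⟩ := h1.exists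
      exact ⟨_, lt_ratAbove n s, hn⟩
    obtain ⟨n, hn⟩ := h q ((ENNReal.coe_lt_coe.2 hqr).trans hrc)
    have hpos : (0 : ℝ≥0∞) < (n : ℝ≥0∞)⁻¹ := by simp
    have hall : ∀ u < (q : ℝ≥0), (n : ℝ≥0∞)⁻¹ ≤ Metric.infEDist (y u) Uᶜ := by
      intro u hu
      have h1 := ((tendsto_ratAbove u).mono_right nhdsWithin_le_nhds).eventually (gt_mem_nhds hu)
      refine ge_of_tendsto ((Metric.continuous_infEDist.tendsto _).comp (y.tendsto_ratAbove u)) ?_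
      filter_upwards [h1] with k hk
      exact hn _ (by exact_mod_cast hk.le)
    rcases hs with hs | hs
    · exact hs (notMem_compl_of_le_infEDist hpos (hall s hsq))
    · by_cases hb : 𝓝[<] s = ⊥
      · rw [leftLim_eq_of_eq_bot _ hb] at hs
        exact hs (notMem_compl_of_le_infEDist hpos (hall s hsq))
      · have := Filter.neBot_iff.2 hb
        refine hs (notMem_compl_of_le_infEDist hpos (ge_of_tendsto
          ((Metric.continuous_infEDist.tendsto _).comp (y.tendsto_leftLim s)) ?_))
        filter_upwards [self_mem_nhdsWithin] with u hu
        exact hall u (lt_trans hu hsq)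

theorem measurable_exitTime {E : Type*} [MetricSpace E] [MeasurableSpace E] [BorelSpace E]
    {U : Set E} (hU : IsOpen U) : Measurable (exitTime U : CadlagPath E → ℝ≥0∞) := by
  refine measurable_of_Ici fun c => ?_
  have h : (exitTime U : CadlagPath E → ℝ≥0∞) ⁻¹' Ici c
      = ⋂ (q : ℚ≥0) (_ : ((q : ℝ≥0) : ℝ≥0∞) < c), ⋃ n : ℕ, ⋂ (p : ℚ≥0) (_ : p ≤ q),
        {y | (n : ℝ≥0∞)⁻¹ ≤ Metric.infEDist (y p) Uᶜ} := by
    ext y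
    simp only [mem_preimage, mem_Ici, le_exitTime_iff hU, mem_iInter, mem_iUnion, mem_ofPred_eq]
  rw [h]
  exact MeasurableSet.iInter fun q => MeasurableSet.iInter fun _ => MeasurableSet.iUnion fun n =>
    MeasurableSet.iInter fun p => MeasurableSet.iInter fun _ => measurableSet_le measurable_const
      (measurable_infEDist.comp (measurable_eval_path measurable_id _))

/-- If the value and the left limit at θ were both in U, right continuity would keep the path in a
closed neighbourhood contained in U for a while after θ, together with its left limits, and the
infimum would exceed θ. -/
theorem exitTime_attained {E : Type*} [MetricSpace E] {U : Set E} (hU : IsOpen U)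
    {y : CadlagPath E} {θ : ℝ≥0} (h : exitTime U y = θ) :
    y θ ∉ U ∨ Function.leftLim y θ ∉ U := by
  by_contra! hcon
  obtain ⟨C, ⟨hC, hCc⟩, hCU⟩ := (closed_nhds_basis (y θ)).mem_iff.1 (hU.mem_nhds hcon.1)
  obtain ⟨u, hu, hsub⟩ := mem_nhdsGT_iff_exists_Ioo_subset.1 (y.tendsto_right θ hC)
  have hle : (u : ℝ≥0∞) ≤ exitTime U y := by
    refine le_sInf ?_
    rintro _ ⟨s, hs, rfl⟩
    rw [ENNReal.coe_le_coe]
    by_contra! hsu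
    have hθs : θ ≤ s := by
      rw [← ENNReal.coe_le_coe, ← h]
      exact exitTime_le hs
    rcases hθs.eq_or_lt with rfl | hθs
    · exact hs.elim (fun h => h hcon.1) fun h => h hcon.2
    · rcases hs with hs | hs
      · exact hs (hCU (hsub ⟨hθs, hsu⟩))
      · have : (𝓝[<] s).NeBot := nhdsLT_neBot_of_exists_lt ⟨θ, hθs⟩
        refine hs (hCU (hCc.mem_of_tendsto (y.tendsto_leftLim s) ?_))
        filter_upwards [Ioo_mem_nhdsLT hθs] with v hv
        exact hsub ⟨hv.1, hv.2.trans hsu⟩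
  rw [h, ENNReal.coe_le_coe] at hle
  exact hle.not_gt hu

theorem exitTime_congr {E : Type*} [MetricSpace E] {U : Set E} (hU : IsOpen U)
    {y y' : CadlagPath E} {θ : ℝ≥0} (h : exitTime U y = θ) (hyy' : ∀ s ≤ θ, y s = y' s) :
    exitTime U y' = θ := by
  have hl : ∀ s ≤ θ, Function.leftLim y s = Function.leftLim y' s := fun s hs =>
    CadlagPath.leftLim_congr fun u hu => hyy' u (hu.trans hs)
  refine le_antisymm (exitTime_le ?_) (le_sInf ?_)
  · rw [← hyy' θ le_rfl, ← hl θ le_rfl]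
    exact exitTime_attained hU h
  · rintro _ ⟨s, hs, rfl⟩
    by_contra! hsθ
    have hsθ' := (ENNReal.coe_lt_coe.1 hsθ).le
    have hs' := mem_of_lt_exitTime (h ▸ hsθ)
    rw [hyy' s hsθ', hl s hsθ'] at hs'
    exact hs.elim (fun h => h hs'.1) fun h => h hs'.2

theorem exitTime_univ {E : Type*} [MetricSpace E] (y : CadlagPath E) : exitTime univ y = ∞ := by
  simp [exitTime]

/-! ### Locally finite measures and s-finite kernels -/

theorem measure_eq_of_Iic {μ ν : Measure ℝ≥0} (hfin : ∀ t, μ (Iic t) ≠ ∞)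
    (h : ∀ t, μ (Iic t) = ν (Iic t)) : μ = ν := by
  refine Measure.ext_of_generateFrom_of_iUnion (range Iic) (fun n : ℕ => Iic (n : ℝ≥0))
    (BorelSpace.measurable_eq.trans (borel_eq_generateFrom_Iic ℝ≥0)) isPiSystem_Iic ?_
    (fun n => mem_range_self _) (fun n => hfin n) ?_
  · exact iUnion_eq_univ_iff.2 fun t => (exists_nat_ge t)
  · rintro _ ⟨t, rfl⟩
    exact h t

/-- This reduces to restrictions that can be finite, as the π-λ argument for measurability of
measure-valued maps needs. -/
theorem measurable_measure_of_exhaustion {α β : Type*} [MeasurableSpace α] [MeasurableSpace β]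
    {μ : α → Measure β} {S : ℕ → Set β} (hmono : Monotone S)
    (hU : ⋃ n, S n = univ) (h : ∀ n, Measurable fun a => (μ a).restrict (S n)) :
    Measurable μ := by
  refine Measure.measurable_of_measurable_coe _ fun C hC => ?_
  have hsup : (fun a => μ a C) = fun a => ⨆ n, (μ a).restrict (S n) C := by
    funext a
    simp only [Measure.restrict_apply hC]
    rw [← Monotone.measure_iUnion, ← inter_iUnion, hU, inter_univ]
    exact fun m n hmn => inter_subset_inter_right _ (hmono hmn)
  rw [hsup]
  exact Measurable.iSup fun n => (Measure.measurable_coe hC).comp (h n)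

theorem iUnion_Iic_nat : ⋃ n : ℕ, Iic (n : ℝ≥0) = univ :=
  iUnion_eq_univ_iff.2 fun t => exists_nat_ge t

theorem monotone_Iic_nat : Monotone fun n : ℕ => Iic (n : ℝ≥0) :=
  fun _ _ h => Iic_subset_Iic.2 (Nat.cast_le.2 h)

theorem measurable_measure_of_Iic {α : Type*} [MeasurableSpace α] {μ : α → Measure ℝ≥0}
    (hfin : ∀ a t, μ a (Iic t) < ∞) (h : ∀ t, Measurable fun a => μ a (Iic t)) :
    Measurable μ := by
  refine measurable_measure_of_exhaustion (S := fun n : ℕ => Iic (n : ℝ≥0))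
    monotone_Iic_nat iUnion_Iic_nat fun n => ?_
  have : ∀ a, IsFiniteMeasure ((μ a).restrict (Iic (n : ℝ≥0))) := fun a =>
    ⟨by rw [Measure.restrict_apply_univ]; exact hfin a n⟩
  refine Measurable.measure_of_isPiSystem
    (BorelSpace.measurable_eq.trans (borel_eq_generateFrom_Iic ℝ≥0)) isPiSystem_Iic ?_ ?_
  · rintro _ ⟨t, rfl⟩
    simp only [Measure.restrict_apply measurableSet_Iic, Iic_inter_Iic]
    exact h _
  · simp only [Measure.restrict_apply_univ]
    exact h n

/-- The masses κ a (S n) are finite but not bounded in a. Splitting the parameter space by the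
integer part m of the mass bounds each piece by m + 1. -/
theorem isSFiniteKernel_of_cover {α β : Type*} [MeasurableSpace α] [MeasurableSpace β]
    (κ : Kernel α β) {S : ℕ → Set β} (hS : ∀ n, MeasurableSet (S n))
    (hd : Pairwise (Function.onFun Disjoint S)) (hU : ⋃ n, S n = univ)
    (hfin : ∀ a n, κ a (S n) < ∞) : IsSFiniteKernel κ := by
  classical
  have hT : ∀ p : ℕ × ℕ, MeasurableSet {a | ⌊(κ a (S p.1)).toNNReal⌋₊ = p.2} := fun p =>
    (Nat.measurable_floor.comp (κ.measurable_coe (hS p.1)).ennreal_toNNReal)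
      (measurableSet_singleton p.2)
  let η : ℕ × ℕ → Kernel α β := fun p => Kernel.piecewise (hT p) (κ.restrict (hS p.1)) 0
  have hη : ∀ p, IsFiniteKernel (η p) := fun p => by
    refine ⟨⟨(p.2 + 1 : ℕ), ENNReal.natCast_lt_top _, fun a => ?_⟩⟩
    by_cases ha : ⌊(κ a (S p.1)).toNNReal⌋₊ = p.2
    · simp only [η, Kernel.piecewise_apply, mem_ofPred_eq, if_pos ha, Kernel.restrict_apply,
        Measure.restrict_apply_univ]
      rw [← ENNReal.coe_toNNReal (hfin a p.1).ne, ← ha]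
      exact_mod_cast (Nat.lt_floor_add_one _).le
    · simp [η, Kernel.piecewise_apply, ha]
  have hsum : κ = Kernel.sum η := by
    ext a s hs
    rw [Kernel.sum_apply' _ _ hs, ENNReal.tsum_prod (f := fun n m => η (n, m) a s)]
    have : ∀ n, ∑' m, η (n, m) a s = κ a (s ∩ S n) := fun n => by
      rw [tsum_eq_single ⌊(κ a (S n)).toNNReal⌋₊]
      · simp [η, Kernel.piecewise_apply, Kernel.restrict_apply, Measure.restrict_apply hs]
      · intro m hm
        simp [η, Kernel.piecewise_apply, hm.symm]
    simp only [this]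
    rw [← measure_iUnion (fun i j hij => (hd hij).mono inter_subset_right inter_subset_right)
      fun n => hs.inter (hS n), ← inter_iUnion, hU, inter_univ]
  rw [hsum]
  exact Kernel.isSFiniteKernel_sum

theorem isSFiniteKernel_of_floor {α β : Type*} [MeasurableSpace α] [MeasurableSpace β]
    (κ : Kernel α β) {τ : β → ℝ≥0} (hτ : Measurable τ) (hfin : ∀ a t, κ a {b | τ b ≤ t} < ∞) :
    IsSFiniteKernel κ := by
  refine isSFiniteKernel_of_cover κ (S := fun n => {b | ⌊τ b⌋₊ = n})
    (fun n => (Nat.measurable_floor.comp hτ) (measurableSet_singleton n)) ?_ ?_ ?_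
  · exact fun m n hmn => disjoint_left.2 fun b hb hb' => hmn (hb.symm.trans hb')
  · exact iUnion_eq_univ_iff.2 fun b => ⟨_, rfl⟩
  · refine fun a n => (measure_mono fun b hb => ?_).trans_lt (hfin a (n + 1 : ℕ))
    rw [mem_ofPred_eq] at hb ⊢
    subst hb
    exact_mod_cast (Nat.lt_floor_add_one (τ b)).le

/-- At the bottom element 0 the left limit is by convention the value itself, so there is no atom at
0. -/
theorem StieltjesFunction.measure_Icc_zero (F : StieltjesFunction ℝ≥0) (t : ℝ≥0) :
    F.measure (Icc 0 t) = ENNReal.ofReal (F t - F 0) := by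
  rw [F.measure_Icc, leftLim_eq_of_isBot (a := (0 : ℝ≥0)) fun _ => zero_le]

theorem IncPath.measure_Icc_zero (l : IncPath) (t : ℝ≥0) :
    l.measure (Icc 0 t) = (l t : ℝ≥0∞) - l 0 := by
  refine (StieltjesFunction.measure_Icc_zero _ t).trans ?_
  show ENNReal.ofReal ((l t : ℝ) - (l 0 : ℝ)) = _
  rw [ENNReal.ofReal_sub _ (NNReal.coe_nonneg _), ENNReal.ofReal_coe_nnreal,
    ENNReal.ofReal_coe_nnreal]

theorem Icc_zero_eq_Iic (t : ℝ≥0) : Icc 0 t = Iic t := by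
  ext s
  simp

theorem IncPath.measure_Iic (l : IncPath) (t : ℝ≥0) :
    l.measure (Iic t) = (l t : ℝ≥0∞) - l 0 := by
  rw [← Icc_zero_eq_Iic, l.measure_Icc_zero]

theorem IncPath.measure_Iic_lt_top (l : IncPath) (t : ℝ≥0) : l.measure (Iic t) < ∞ := by
  rw [l.measure_Iic]
  exact tsub_le_self.trans_lt ENNReal.coe_lt_top

theorem measurable_incPath_measure : Measurable IncPath.measure := by
  refine measurable_measure_of_Iic IncPath.measure_Iic_lt_top fun t => ?_
  simp only [IncPath.measure_Iic]
  exact (measurable_eval_inc measurable_id t).coe_nnreal_ennreal.sub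
    (measurable_eval_inc measurable_id 0).coe_nnreal_ennreal

/-! ### Coding of finite measures and of control measures -/

section Decode

variable {Z : Type*} [MeasurableSpace Z] [StandardBorelSpace Z]

/-- Total mass and distribution function at the rationals. -/
noncomputable def measureCode (μ : Measure Z) : ℝ≥0∞ × (ℚ → ℝ) :=
  (μ univ, fun q => ((μ univ)⁻¹ * μ (embeddingReal Z ⁻¹' Iic (q : ℝ))).toReal)

/-- The finite measure with given total mass and distribution function at the rationals. -/
noncomputable def measureDecode (p : ℝ≥0∞ × (ℚ → ℝ)) : Measure Z :=
  (p.1.toNNReal : ℝ≥0∞) •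
    (stieltjesOfMeasurableRat (id : (ℚ → ℝ) → ℚ → ℝ) measurable_id p.2).measure.comap
      (embeddingReal Z)

theorem measurable_measureCode : Measurable (measureCode : Measure Z → _) := by
  refine (Measure.measurable_coe MeasurableSet.univ).prodMk (measurable_pi_iff.2 fun q => ?_)
  exact ((Measure.measurable_coe MeasurableSet.univ).inv.mul
    (Measure.measurable_coe (measurable_embeddingReal Z measurableSet_Iic))).ennreal_toReal

theorem measureDecode_apply (p : ℝ≥0∞ × (ℚ → ℝ)) (C : Set Z) :
    measureDecode p C = (p.1.toNNReal : ℝ≥0∞) *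
      (stieltjesOfMeasurableRat (id : (ℚ → ℝ) → ℚ → ℝ) measurable_id p.2).measure
        (embeddingReal Z '' C) := by
  rw [measureDecode, Measure.smul_apply, smul_eq_mul,
    (measurableEmbedding_embeddingReal Z).comap_apply]

theorem measurable_measureDecode : Measurable (measureDecode : _ → Measure Z) := by
  refine Measure.measurable_of_measurable_coe _ fun C hC => ?_
  simp only [measureDecode_apply]
  exact measurable_fst.ennreal_toNNReal.coe_nnreal_ennreal.mul
    ((Measure.measurable_coe ((measurableEmbedding_embeddingReal Z).measurableSet_image.2 hC)).comp
      ((measurable_measure_stieltjesOfMeasurableRat measurable_id).comp measurable_snd))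

/-- The conversion `toNNReal` turns an infinite mass into 0, so every code, meaningful or not,
decodes to a finite measure. -/
instance (p : ℝ≥0∞ × (ℚ → ℝ)) : IsFiniteMeasure (measureDecode p : Measure Z) :=
  ⟨by
    rw [measureDecode_apply]
    exact ENNReal.mul_lt_top ENNReal.coe_lt_top (measure_lt_top _ _)⟩

/-- The rational values of a genuine distribution function already form a rational Stieltjes point,
so the default value for bad codes is not used. -/
theorem stieltjesOfMeasurableRat_measure_eq (ν : Measure ℝ) [IsProbabilityMeasure ν] :
    (stieltjesOfMeasurableRat (id : (ℚ → ℝ) → ℚ → ℝ) measurable_id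
      (fun q => ν.real (Iic (q : ℝ)))).measure = ν := by
  have hq : (fun q : ℚ => ν.real (Iic (q : ℝ))) = fun q : ℚ => cdf ν q := by
    funext q
    rw [cdf_eq_real]
  have hpt : IsRatStieltjesPoint (id : (ℚ → ℝ) → ℚ → ℝ) (fun q => ν.real (Iic (q : ℝ))) := by
    rw [hq]
    refine ⟨fun a b hab => monotone_cdf ν (by exact_mod_cast hab),
      (tendsto_cdf_atTop ν).comp (tendsto_ratCast_atTop_iff.2 Filter.tendsto_id),
      (tendsto_cdf_atBot ν).comp (tendsto_ratCast_atBot_iff.2 Filter.tendsto_id), fun t => ?_⟩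
    rw [id, ← StieltjesFunction.iInf_rat_gt_eq]
    exact (Equiv.subtypeEquivRight fun r : ℚ => by simp).iInf_congr fun r => rfl
  refine ext_of_generate_finite _
    (BorelSpace.measurable_eq.trans Real.borel_eq_generateFrom_Iic_rat)
    Real.isPiSystem_Iic_rat ?_ (by simp)
  simp only [mem_iUnion, mem_singleton_iff]
  rintro _ ⟨q, rfl⟩
  rw [measure_stieltjesOfMeasurableRat_Iic, stieltjesOfMeasurableRat_eq,
    toRatCDF_of_isRatStieltjesPoint hpt, id, ofReal_measureReal]

/-- After normalisation and transport to the line, a nonzero finite measure becomes a probability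
measure determined by its distribution function at the rationals. The zero measure cannot be
normalised and is treated apart. -/
theorem measureDecode_measureCode (μ : Measure Z) [IsFiniteMeasure μ] :
    measureDecode (measureCode μ) = μ := by
  by_cases h0 : μ = 0
  · subst h0
    simp [measureDecode, measureCode]
  have hu : μ univ ≠ 0 := fun h => h0 (Measure.measure_univ_eq_zero.1 h)
  have he := measurableEmbedding_embeddingReal Z
  let ν : Measure ℝ := (μ univ)⁻¹ • μ.map (embeddingReal Z)
  have : IsProbabilityMeasure ν := ⟨by
    simp only [ν, Measure.smul_apply, Measure.map_apply he.measurable MeasurableSet.univ,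
      preimage_univ, smul_eq_mul]
    exact ENNReal.inv_mul_cancel hu (measure_ne_top _ _)⟩
  have hcode : (measureCode μ).2 = fun q : ℚ => ν.real (Iic (q : ℝ)) := by
    funext q
    simp [measureCode, ν, Measure.real, Measure.map_apply he.measurable measurableSet_Iic]
  ext C hC
  rw [measureDecode_apply, hcode, stieltjesOfMeasurableRat_measure_eq]
  have h1 : (measureCode μ).1 = μ univ := rfl
  rw [h1, ENNReal.coe_toNNReal (measure_ne_top _ _), Measure.smul_apply, he.map_apply,
    he.injective.preimage_image, smul_eq_mul, ← mul_assoc,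
    ENNReal.mul_inv_cancel hu (measure_ne_top _ _), one_mul]

end Decode

theorem measurable_controlMeasure_iff {α 𝒰 : Type*} [MeasurableSpace α] [MeasurableSpace 𝒰]
    {f : α → ControlMeasure 𝒰} : Measurable f ↔ Measurable fun a => (f a).1 :=
  ⟨fun h => measurable_subtype_coe.comp h, fun h => h.subtype_mk⟩

theorem ControlMeasure.measure_fst_le_lt_top {𝒰 : Type*} [MeasurableSpace 𝒰]
    (L : ControlMeasure 𝒰) (t : ℝ≥0) : L.1 {p | p.1 ≤ t} < ∞ := by
  convert L.2 t using 2
  ext p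
  simp

theorem measurableSet_floor_fst {𝒰 : Type*} [MeasurableSpace 𝒰] (n : ℕ) :
    MeasurableSet {p : ℝ≥0 × 𝒰 | ⌊p.1⌋₊ = n} :=
  (Nat.measurable_floor.comp measurable_fst) (measurableSet_singleton n)

/-- The restrictions to the time slices [n, n+1) are finite and are coded one by one. The decoder
restricts again to the slices, which makes the sum finite on bounded time intervals for every
sequence of codes. -/
theorem standardBorelSpace_controlMeasure {𝒰 : Type*} [MeasurableSpace 𝒰]
    [StandardBorelSpace 𝒰] : StandardBorelSpace (ControlMeasure 𝒰) := by
  have hfin : ∀ (s : ℕ → ℝ≥0∞ × (ℚ → ℝ)) (t : ℝ≥0), (Measure.sum fun n =>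
      (measureDecode (s n) : Measure (ℝ≥0 × 𝒰)).restrict {p | ⌊p.1⌋₊ = n})
        (Icc 0 t ×ˢ univ) < ∞ := by
    intro s t
    have hm : MeasurableSet (Icc 0 t ×ˢ (univ : Set 𝒰)) :=
      measurableSet_Icc.prod MeasurableSet.univ
    rw [Measure.sum_apply _ hm, tsum_eq_sum (s := Finset.range (⌊t⌋₊ + 1))]
    · exact ENNReal.sum_lt_top.2 fun n _ => measure_lt_top _ _
    · intro n hn
      rw [Measure.restrict_apply hm]
      convert measure_empty (μ := (measureDecode (s n) : Measure (ℝ≥0 × 𝒰)))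
      ext p
      simp only [mem_inter_iff, mem_prod, mem_Icc, mem_univ, and_true, mem_ofPred_eq,
        mem_empty_iff_false, iff_false, not_and]
      rintro ⟨-, h⟩ rfl
      exact hn (Finset.mem_range.2 (Nat.lt_succ_of_le (Nat.floor_mono h)))
  refine standardBorelSpace_of_retract
    (c := fun (L : ControlMeasure 𝒰) (n : ℕ) =>
      measureCode (L.1.restrict {p : ℝ≥0 × 𝒰 | ⌊p.1⌋₊ = n}))
    (d := fun s => ⟨_, hfin s⟩) ?_ ?_ ?_
  · refine measurable_pi_iff.2 fun n => measurable_measureCode.comp ?_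
    refine Measure.measurable_of_measurable_coe _ fun C hC => ?_
    simp only [Measure.restrict_apply hC]
    exact (Measure.measurable_coe (hC.inter (measurableSet_floor_fst n))).comp
      (measurable_controlMeasure_iff.1 measurable_id)
  · refine measurable_controlMeasure_iff.2 (Measure.measurable_of_measurable_coe _ fun C hC => ?_)
    simp only [Measure.sum_apply _ hC, Measure.restrict_apply hC]
    exact Measurable.tsum fun n =>
      (Measure.measurable_coe (hC.inter (measurableSet_floor_fst n))).comp
        (measurable_measureDecode.comp (measurable_pi_apply n))
  · intro L
    refine Subtype.ext ?_
    have : ∀ n : ℕ, IsFiniteMeasure (L.1.restrict {p : ℝ≥0 × 𝒰 | ⌊p.1⌋₊ = n}) := fun n => ⟨by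
      rw [Measure.restrict_apply_univ]
      refine (measure_mono fun p hp => ?_).trans_lt (L.measure_fst_le_lt_top (n + 1 : ℕ))
      rw [mem_ofPred_eq] at hp ⊢
      subst hp
      exact_mod_cast (Nat.lt_floor_add_one p.1).le⟩
    have hd : Pairwise (Function.onFun Disjoint fun n : ℕ => {p : ℝ≥0 × 𝒰 | ⌊p.1⌋₊ = n}) :=
      fun m n hmn => disjoint_left.2 fun b hb hb' => hmn (hb.symm.trans hb')
    have hU : ⋃ n : ℕ, {p : ℝ≥0 × 𝒰 | ⌊p.1⌋₊ = n} = univ :=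
      iUnion_eq_univ_iff.2 fun b => ⟨_, rfl⟩
    show (Measure.sum fun n : ℕ => (measureDecode (measureCode
      (L.1.restrict {p : ℝ≥0 × 𝒰 | ⌊p.1⌋₊ = n}))).restrict {p : ℝ≥0 × 𝒰 | ⌊p.1⌋₊ = n}) = L.1
    simp only [measureDecode_measureCode]
    simp only [Measure.restrict_restrict (measurableSet_floor_fst _), inter_self]
    rw [← Measure.restrict_iUnion hd measurableSet_floor_fst, hU, Measure.restrict_univ]

/-! ### Stopped triples and the generated filtration -/

/-- The space of the triples `(y, l, L)`. -/
abbrev ControlPath (E 𝒰 : Type*) [TopologicalSpace E] [MeasurableSpace 𝒰] : Type _ :=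
  CadlagPath E × IncPath × ControlMeasure 𝒰

/-- The triple stopped at time `θ`. -/
noncomputable def ControlPath.stopped {E 𝒰 : Type*} [TopologicalSpace E] [MeasurableSpace 𝒰]
    (x : ControlPath E 𝒰) (θ : ℝ≥0∞) : ControlPath E 𝒰 :=
  (x.1.stopAt θ, x.2.1.stopAt θ, x.2.2.stopAt θ)

section Measurability

variable {E 𝒰 α : Type*} [TopologicalSpace E] [MeasurableSpace 𝒰] [MeasurableSpace α]

theorem measurable_incPath_iff {f : α → IncPath} : Measurable f ↔ ∀ t, Measurable fun a => f a t :=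
  ⟨fun h t => measurable_eval_inc h t,
    fun h => (measurable_cadlagPath_iff.2 h : Measurable fun a => (f a).1).subtype_mk⟩

theorem CadlagPath.stopAt_apply (y : CadlagPath E) (θ t : ℝ≥0) : y.stopAt θ t = y (min t θ) := by
  show y (minTime t θ) = _
  rw [minTime_coe]

theorem IncPath.stopAt_apply (l : IncPath) (θ t : ℝ≥0) : l.stopAt θ t = l (min t θ) :=
  l.1.stopAt_apply θ t

theorem ControlMeasure.at_apply (L : ControlMeasure 𝒰) (t : ℝ≥0) {C : Set 𝒰}
    (hC : MeasurableSet C) : L.at t C = L.1 (Iic t ×ˢ C) := by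
  rw [ControlMeasure.at, Measure.map_apply measurable_snd hC,
    Measure.restrict_apply (measurable_snd hC)]
  congr 1
  ext p
  simp [and_comm]

theorem ControlMeasure.stopAt_val (L : ControlMeasure 𝒰) (θ : ℝ≥0) :
    (L.stopAt θ).1 = L.1.restrict (Iic θ ×ˢ univ) := by
  show L.1.restrict _ = _
  congr 2
  ext s
  simp

theorem ControlMeasure.measure_Iic_lt_top (L : ControlMeasure 𝒰) (t : ℝ≥0) :
    L.1 (Iic t ×ˢ univ) < ∞ := by
  rw [← Icc_zero_eq_Iic]
  exact L.2 t

/-- The rectangles [0, s] × C form a generating π-system, and the stopped measure of such a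
rectangle is read off from `at (min s t)`. -/
theorem measurable_stopAt_of_measurable_at {f : α → ControlMeasure 𝒰} {t : ℝ≥0}
    (h : ∀ s ≤ t, Measurable fun a => (f a).at s) : Measurable fun a => (f a).stopAt t := by
  refine measurable_controlMeasure_iff.2 ?_
  simp only [ControlMeasure.stopAt_val]
  have : ∀ a, IsFiniteMeasure ((f a).1.restrict (Iic t ×ˢ univ)) := fun a =>
    ⟨by rw [Measure.restrict_apply_univ]; exact (f a).measure_Iic_lt_top t⟩
  have hval : ∀ s ≤ t, ∀ C, MeasurableSet C → Measurable fun a => (f a).1 (Iic s ×ˢ C) := by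
    intro s hs C hC
    have : Measurable fun a => (f a).at s C := (Measure.measurable_coe hC).comp (h s hs)
    simpa only [ControlMeasure.at_apply _ s hC] using this
  refine Measurable.measure_of_isPiSystem (S := image2 (· ×ˢ ·) (range Iic) {C | MeasurableSet C})
    (generateFrom_eq_prod (BorelSpace.measurable_eq.trans (borel_eq_generateFrom_Iic ℝ≥0)).symm
      MeasurableSpace.generateFrom_measurableSet
      ⟨fun n : ℕ => Iic (n : ℝ≥0), fun n => mem_range_self _, iUnion_Iic_nat⟩
      isCountablySpanning_measurableSet).symm
    (isPiSystem_Iic.prod MeasurableSpace.isPiSystem_measurableSet) ?_ ?_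
  · rintro _ ⟨_, ⟨s, rfl⟩, C, hC, rfl⟩
    simp only [Measure.restrict_apply (measurableSet_Iic.prod hC), prod_inter_prod,
      Iic_inter_Iic, inter_univ]
    exact hval _ (min_le_right s t) C hC
  · simp only [Measure.restrict_apply_univ]
    exact hval t le_rfl _ MeasurableSet.univ

variable [MeasurableSpace E]

theorem measurable_stop_of_measurable {Y : α → CadlagPath E} {l : α → IncPath}
    {L : α → ControlMeasure 𝒰} {t : ℝ≥0} (hY : ∀ s ≤ t, Measurable fun a => Y a s)
    (hl : ∀ s ≤ t, Measurable fun a => l a s) (hL : ∀ s ≤ t, Measurable fun a => (L a).at s) :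
    Measurable fun a => ControlPath.stopped (Y a, l a, L a) t := by
  refine (measurable_cadlagPath_iff.2 fun s => ?_).prodMk
    ((measurable_incPath_iff.2 fun s => ?_).prodMk (measurable_stopAt_of_measurable_at hL))
  · simp only [CadlagPath.stopAt_apply]
    exact hY _ (min_le_right s t)
  · simp only [IncPath.stopAt_apply]
    exact hl _ (min_le_right s t)

theorem measurable_stop (t : ℝ≥0) : Measurable fun x : ControlPath E 𝒰 => x.stopped t :=
  measurable_stop_of_measurable (fun s _ => measurable_eval_path measurable_fst s)
    (fun s _ => measurable_eval_inc (measurable_fst.comp measurable_snd) s)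
    fun s _ => measurable_control_at (measurable_snd.comp measurable_snd) s

theorem ControlMeasure.stopAt_at (L : ControlMeasure 𝒰) {s t : ℝ≥0} (h : s ≤ t) :
    (L.stopAt t).at s = L.at s := by
  rw [ControlMeasure.at, ControlMeasure.at, ControlMeasure.stopAt_val,
    Measure.restrict_restrict (measurableSet_Icc.prod MeasurableSet.univ), prod_inter_prod,
    Icc_zero_eq_Iic, Iic_inter_Iic, min_eq_left h, inter_univ]

/-- Events of the filtration thus become events about the stopped triple, which are preimages of
measurable sets of path space. This lets the martingale property be stated for laws. -/
theorem controlFiltration_eq_comap_stop {Y : α → CadlagPath E} {l : α → IncPath}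
    {L : α → ControlMeasure 𝒰} (hY : Measurable Y) (hl : Measurable l) (hL : Measurable L)
    (t : ℝ≥0) : controlFiltration hY hl hL t
      = MeasurableSpace.comap (fun a => ControlPath.stopped (Y a, l a, L a) t) inferInstance := by
  refine le_antisymm (iSup₂_le fun s hs => ?_) ?_
  · have h : (fun a => (Y a s, l a s, (L a).at s)) = (fun x : ControlPath E 𝒰 =>
        (x.1 s, x.2.1 s, x.2.2.at s)) ∘ fun a => ControlPath.stopped (Y a, l a, L a) t := by
      funext a
      show _ = ((Y a).stopAt t s, (l a).stopAt t s, ((L a).stopAt t).at s)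
      rw [CadlagPath.stopAt_apply, IncPath.stopAt_apply, ControlMeasure.stopAt_at _ hs.2,
        min_eq_left hs.2]
    rw [h, ← MeasurableSpace.comap_comp]
    refine MeasurableSpace.comap_mono (Measurable.comap_le ?_)
    exact (measurable_eval_path measurable_fst s).prodMk
      ((measurable_eval_inc (measurable_fst.comp measurable_snd) s).prodMk
        (measurable_control_at (measurable_snd.comp measurable_snd) s))
  · refine Measurable.comap_le ?_
    have hle : ∀ s ≤ t, Measurable[controlFiltration hY hl hL t]
        fun a => (Y a s, l a s, (L a).at s) := fun s hs =>
      Measurable.of_comap_le (le_biSup (fun s => MeasurableSpace.comap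
        (fun a => (Y a s, l a s, (L a).at s)) inferInstance) (⟨zero_le, hs⟩ : s ∈ Icc 0 t))
    exact @measurable_stop_of_measurable E 𝒰 α _ _ (controlFiltration hY hl hL t) _ Y l L t
      (fun s hs => measurable_fst.comp (hle s hs))
      (fun s hs => (measurable_fst.comp measurable_snd).comp (hle s hs))
      (fun s hs => (measurable_snd.comp measurable_snd).comp (hle s hs))

end Measurability

/-! ### Joint measurability of the martingale process -/

theorem measurable_extend_zero {X : Type*} [TopologicalSpace X] [MeasurableSpace X]
    [OpensMeasurableSpace X] {Ξ : Set X} (hΞ : IsClosed Ξ) (h : C(Ξ, ℝ)) :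
    Measurable (Function.extend Subtype.val h (0 : X → ℝ)) :=
  (MeasurableEmbedding.subtype_coe hΞ.measurableSet).measurable_extend h.continuous.measurable
    measurable_const

theorem abs_extend_zero_le {X : Type*} [TopologicalSpace X] {Ξ : Set X} [CompactSpace Ξ]
    (h : C(Ξ, ℝ)) (p : X) : ‖Function.extend Subtype.val h (0 : X → ℝ) p‖ ≤ ‖h‖ := by
  by_cases hp : ∃ a : Ξ, a.1 = p
  · obtain ⟨a, rfl⟩ := hp
    rw [Subtype.val_injective.extend_apply]
    exact h.norm_coe_le_norm a
  · rw [Function.extend_apply' _ _ _ hp]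
    simp

section Kernels

variable {E 𝒰 α : Type*} [MetricSpace E] [MeasurableSpace E] [BorelSpace E]
  [MeasurableSpace 𝒰] [MeasurableSpace α]

theorem exists_kernel_incPath {l : α → IncPath} (hl : Measurable l) :
    ∃ κ : Kernel α ℝ≥0, IsSFiniteKernel κ ∧ ∀ a, κ a = (l a).measure :=
  ⟨⟨fun a => (l a).measure, measurable_incPath_measure.comp hl⟩,
    isSFiniteKernel_of_floor _ measurable_id fun a t => (l a).measure_Iic_lt_top t, fun _ => rfl⟩

theorem exists_kernel_controlMeasure {L : α → ControlMeasure 𝒰} (hL : Measurable L) :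
    ∃ κ : Kernel α (ℝ≥0 × 𝒰), IsSFiniteKernel κ ∧ ∀ a, κ a = (L a).1 :=
  ⟨⟨fun a => (L a).1, measurable_controlMeasure_iff.1 hL⟩,
    isSFiniteKernel_of_floor _ measurable_fst fun a t => (L a).measure_fst_le_lt_top t,
    fun _ => rfl⟩

/-- The process of `controlMart` along a triple. -/
noncomputable def pathMart [TopologicalSpace 𝒰] {Ξ : Set (E × 𝒰)} (f g : C(E, ℝ)) (h : C(Ξ, ℝ))
    (x : ControlPath E 𝒰) (t : ℝ≥0) : ℝ :=
  controlMart f g h x.1 x.2.1 x.2.2 t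

/-- Both integrals are parametric integrals against s-finite kernels. Joint measurability in path
and time is needed because the continuation is evaluated at the random time t - θ. -/
theorem measurable_pathMart [SecondCountableTopology E] [TopologicalSpace 𝒰]
    [OpensMeasurableSpace (E × 𝒰)] {Ξ : Set (E × 𝒰)}
    (hΞ : IsClosed Ξ) (f g : C(E, ℝ)) (h : C(Ξ, ℝ)) :
    Measurable fun p : ControlPath E 𝒰 × ℝ≥0 => pathMart f g h p.1 p.2 := by
  have hY : Measurable fun p : ControlPath E 𝒰 × ℝ≥0 => p.1.1 := measurable_fst.fst
  have hl : Measurable fun p : ControlPath E 𝒰 × ℝ≥0 => p.1.2.1 := measurable_fst.snd.fst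
  have hL : Measurable fun p : ControlPath E 𝒰 × ℝ≥0 => p.1.2.2 := measurable_fst.snd.snd
  refine Measurable.sub (Measurable.sub (Measurable.sub ?_ ?_) ?_) ?_
  · exact f.continuous.measurable.comp (measurable_eval_path_prod.comp (hY.prodMk measurable_snd))
  · exact f.continuous.measurable.comp (measurable_eval_path hY 0)
  · obtain ⟨κ, hκ, hκe⟩ := exists_kernel_incPath hl
    simp only [← hκe, ← integral_indicator measurableSet_Icc]
    refine (StronglyMeasurable.integral_kernel_prod_right' (κ := κ)
      (f := fun q : (ControlPath E 𝒰 × ℝ≥0) × ℝ≥0 =>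
        (Icc 0 q.1.2).indicator (fun s => g (q.1.1.1 s)) q.2) ?_).measurable
    refine Measurable.stronglyMeasurable ?_
    have : Measurable fun q : (ControlPath E 𝒰 × ℝ≥0) × ℝ≥0 => g (q.1.1.1 q.2) :=
      g.continuous.measurable.comp (measurable_eval_path_prod.comp
        ((hY.comp measurable_fst).prodMk measurable_snd))
    refine (this.indicator (s := {q : (ControlPath E 𝒰 × ℝ≥0) × ℝ≥0 | q.2 ∈ Icc 0 q.1.2}) ?_)
    have : {q : (ControlPath E 𝒰 × ℝ≥0) × ℝ≥0 | q.2 ∈ Icc 0 q.1.2} = {q | q.2 ≤ q.1.2} := by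
      ext q
      simp
    rw [this]
    exact measurableSet_le measurable_snd measurable_fst.snd
  · obtain ⟨κ, hκ, hκe⟩ := exists_kernel_controlMeasure hL
    simp only [← hκe, ← integral_indicator (measurableSet_Icc.prod MeasurableSet.univ)]
    refine (StronglyMeasurable.integral_kernel_prod_right' (κ := κ)
      (f := fun q : (ControlPath E 𝒰 × ℝ≥0) × (ℝ≥0 × 𝒰) => (Icc 0 q.1.2 ×ˢ univ).indicator
        (fun p => Function.extend Subtype.val h 0 (q.1.1.1 p.1, p.2)) q.2) ?_).measurable
    refine Measurable.stronglyMeasurable ?_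
    have : Measurable fun q : (ControlPath E 𝒰 × ℝ≥0) × (ℝ≥0 × 𝒰) =>
        Function.extend Subtype.val h (0 : E × 𝒰 → ℝ) (q.1.1.1 q.2.1, q.2.2) :=
      (measurable_extend_zero hΞ h).comp ((measurable_eval_path_prod.comp
        ((hY.comp measurable_fst).prodMk measurable_snd.fst)).prodMk measurable_snd.snd)
    refine (this.indicator
      (s := {q : (ControlPath E 𝒰 × ℝ≥0) × (ℝ≥0 × 𝒰) | q.2 ∈ Icc 0 q.1.2 ×ˢ univ}) ?_)
    have : {q : (ControlPath E 𝒰 × ℝ≥0) × (ℝ≥0 × 𝒰) | q.2 ∈ Icc 0 q.1.2 ×ˢ univ}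
        = {q | q.2.1 ≤ q.1.2} := by
      ext q
      simp
    rw [this]
    exact measurableSet_le measurable_snd.fst measurable_fst.snd

end Kernels

/-! ### Pasting of paths, clocks and control measures -/

theorem IsCadlagPath.shift {E : Type*} [TopologicalSpace E] {y : ℝ≥0 → E} (hy : IsCadlagPath y)
    (θ : ℝ≥0) : IsCadlagPath fun t => y (t - θ) := by
  intro t
  have hc : Continuous fun s : ℝ≥0 => s - θ := continuous_id.sub continuous_const
  refine ⟨ContinuousWithinAt.comp (f := fun s => s - θ) (t := Ici (t - θ)) (hy (t - θ)).1
    hc.continuousWithinAt fun s hs => tsub_le_tsub_right (mem_Ici.1 hs) θ, ?_⟩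
  rcases le_or_gt t θ with h | h
  · refine ⟨y 0, tendsto_const_nhds.congr' ?_⟩
    filter_upwards [self_mem_nhdsWithin] with s hs
    rw [tsub_eq_zero_of_le ((le_of_lt hs).trans h)]
  · obtain ⟨l, hl⟩ := (hy (t - θ)).2
    refine ⟨l, hl.comp (tendsto_nhdsWithin_iff.2 ⟨(hc.tendsto t).mono_left nhdsWithin_le_nhds, ?_⟩)⟩
    filter_upwards [Ioo_mem_nhdsLT h] with s hs
    exact tsub_lt_tsub_right_of_le hs.1.le hs.2

theorem IsCadlagPath.add {y z : ℝ≥0 → ℝ≥0} (hy : IsCadlagPath y) (hz : IsCadlagPath z) :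
    IsCadlagPath fun t => y t + z t := fun t => by
  obtain ⟨a, ha⟩ := (hy t).2
  obtain ⟨b, hb⟩ := (hz t).2
  exact ⟨(hy t).1.add (hz t).1, a + b, ha.add hb⟩

theorem IsCadlagPath.paste {E : Type*} [TopologicalSpace E] {y z : ℝ≥0 → E} (hy : IsCadlagPath y)
    (hz : IsCadlagPath z) (θ : ℝ≥0) : IsCadlagPath fun t => if t < θ then y t else z (t - θ) := by
  intro t
  constructor
  · rcases lt_or_ge t θ with h | h
    · refine (hy t).1.congr_of_eventuallyEq ?_ (if_pos h)
      filter_upwards [mem_nhdsWithin_of_mem_nhds (Iio_mem_nhds h)] with s hs using if_pos hs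
    · refine (hz.shift θ t).1.congr_of_eventuallyEq ?_ (if_neg h.not_gt)
      filter_upwards [self_mem_nhdsWithin] with s hs using if_neg (h.trans hs).not_gt
  · rcases le_or_gt t θ with h | h
    · obtain ⟨l, hl⟩ := (hy t).2
      refine ⟨l, hl.congr' ?_⟩
      filter_upwards [self_mem_nhdsWithin] with s hs using (if_pos (lt_of_lt_of_le hs h)).symm
    · obtain ⟨l, hl⟩ := (hz.shift θ t).2
      refine ⟨l, hl.congr' ?_⟩
      filter_upwards [Ioo_mem_nhdsLT h] with s hs using (if_neg hs.1.not_gt).symm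

section Paste

variable {E 𝒰 : Type*} [TopologicalSpace E] [MeasurableSpace 𝒰]

/-- The path `y` before time `θ`, continued by `z` started at time `θ`. -/
noncomputable def CadlagPath.paste (y : CadlagPath E) (θ : ℝ≥0) (z : CadlagPath E) : CadlagPath E :=
  ⟨fun t => if t < θ then y t else z (t - θ), y.2.paste z.2 θ⟩

/-- The nondecreasing path `l`, to which `m` is added from time `θ` on. -/
noncomputable def IncPath.paste (l : IncPath) (θ : ℝ≥0) (m : IncPath) : IncPath :=
  ⟨⟨fun t => l t + m (t - θ), l.1.2.add (m.1.2.shift θ)⟩,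
    fun _ _ h => add_le_add (l.2 h) (m.2 (tsub_le_tsub_right h θ))⟩

/-- The translation of time by `θ`. -/
def timeShift (𝒰 : Type*) (θ : ℝ≥0) (p : ℝ≥0 × 𝒰) : ℝ≥0 × 𝒰 := (p.1 + θ, p.2)

theorem measurable_timeShift (θ : ℝ≥0) : Measurable (timeShift 𝒰 θ) :=
  (measurable_fst.add_const θ).prodMk measurable_snd

/-- The measure `L`, to which `M` is added from time `θ` on. -/
noncomputable def ControlMeasure.paste (L : ControlMeasure 𝒰) (θ : ℝ≥0) (M : ControlMeasure 𝒰) :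
    ControlMeasure 𝒰 :=
  ⟨L.1 + M.1.map (timeShift 𝒰 θ), fun t => by
    rw [Measure.add_apply, Measure.map_apply (measurable_timeShift θ)
      (measurableSet_Icc.prod MeasurableSet.univ)]
    refine ENNReal.add_lt_top.2 ⟨L.2 t, (measure_mono fun p hp => ?_).trans_lt (M.2 t)⟩
    exact ⟨⟨zero_le, le_self_add.trans hp.1.2⟩, trivial⟩⟩

/-- The triple `x`, continued by `x'` from time `θ` on. -/
noncomputable def ControlPath.paste (x : ControlPath E 𝒰) (θ : ℝ≥0) (x' : ControlPath E 𝒰) :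
    ControlPath E 𝒰 :=
  (x.1.paste θ x'.1, x.2.1.paste θ x'.2.1, x.2.2.paste θ x'.2.2)

theorem CadlagPath.paste_apply (y : CadlagPath E) (θ : ℝ≥0) (z : CadlagPath E) (t : ℝ≥0) :
    y.paste θ z t = if t < θ then y t else z (t - θ) := rfl

theorem IncPath.paste_apply (l : IncPath) (θ : ℝ≥0) (m : IncPath) (t : ℝ≥0) :
    l.paste θ m t = l t + m (t - θ) := rfl

theorem ControlMeasure.paste_val (L : ControlMeasure 𝒰) (θ : ℝ≥0) (M : ControlMeasure 𝒰) :
    (L.paste θ M).1 = L.1 + M.1.map (timeShift 𝒰 θ) := rfl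

theorem CadlagPath.paste_add (y : CadlagPath E) (θ : ℝ≥0) (z : CadlagPath E) (t : ℝ≥0) :
    y.paste θ z (t + θ) = z t := by
  rw [CadlagPath.paste_apply, if_neg (not_lt.2 le_add_self), add_tsub_cancel_right]

theorem CadlagPath.paste_of_le {y z : CadlagPath E} {θ : ℝ≥0} (h : y θ = z 0) {t : ℝ≥0}
    (ht : t ≤ θ) : y.paste θ z t = y t := by
  rw [CadlagPath.paste_apply]
  rcases ht.eq_or_lt with rfl | ht
  · rw [if_neg (lt_irrefl _), tsub_self, h]
  · rw [if_pos ht]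

theorem CadlagPath.ext {y z : CadlagPath E} (h : ∀ t, y t = z t) : y = z :=
  Subtype.ext (funext h)

theorem IncPath.ext {l m : IncPath} (h : ∀ t, l t = m t) : l = m :=
  Subtype.ext (CadlagPath.ext h)

theorem IncPath.measure_paste (l : IncPath) (θ : ℝ≥0) (m : IncPath) :
    (l.paste θ m).measure = l.measure + m.measure.map (· + θ) := by
  refine measure_eq_of_Iic (fun t => (IncPath.measure_Iic_lt_top _ t).ne) fun t => ?_
  rw [Measure.add_apply, Measure.map_apply (measurable_add_const θ) measurableSet_Iic,
    IncPath.measure_Iic, IncPath.measure_Iic, IncPath.paste_apply, IncPath.paste_apply, zero_tsub]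
  have hm : m.measure ((fun s => s + θ) ⁻¹' Iic t) = (m (t - θ) : ℝ≥0∞) - m 0 := by
    rcases le_or_gt θ t with h | h
    · rw [← IncPath.measure_Iic]
      congr 1
      ext s
      exact (le_tsub_iff_right h).symm
    · rw [tsub_eq_zero_of_le h.le, tsub_self]
      convert measure_empty (μ := m.measure)
      ext s
      simp only [mem_preimage, mem_Iic, mem_empty_iff_false, iff_false, not_le]
      exact h.trans_le le_add_self
  rw [hm]
  obtain ⟨a, ha⟩ := exists_add_of_le (l.2 (zero_le (a := t)))
  obtain ⟨b, hb⟩ := exists_add_of_le (m.2 (zero_le (a := t - θ)))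
  rw [ha, hb]
  norm_cast
  rw [add_tsub_cancel_left, add_tsub_cancel_left, add_add_add_comm, add_tsub_cancel_left]

theorem IncPath.measure_restrict_of_stopped {l : IncPath} {θ : ℝ≥0} (h : l = l.stopAt θ) :
    l.measure.restrict (Iic θ) = l.measure := by
  refine measure_eq_of_Iic (fun t => ?_) fun t => ?_
  · exact ((Measure.restrict_apply_le _ _).trans_lt (l.measure_Iic_lt_top t)).ne
  · rw [Measure.restrict_apply measurableSet_Iic, Iic_inter_Iic, IncPath.measure_Iic,
      IncPath.measure_Iic, ← IncPath.stopAt_apply, ← h]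

/-- The pasted triple is adapted: up to time s it uses the continuation only up to its own time s -
θ. -/
theorem ControlPath.stop_paste (x : ControlPath E 𝒰) (θ : ℝ≥0) (x' : ControlPath E 𝒰) (s : ℝ≥0) :
    (x.paste θ x').stopped s = (x.paste θ (x'.stopped (s - θ : ℝ≥0))).stopped s := by
  refine Prod.ext (CadlagPath.ext fun t => ?_)
    (Prod.ext (IncPath.ext fun t => ?_) (Subtype.ext ?_))
  · show (x.1.paste θ x'.1).stopAt s t = (x.1.paste θ (x'.1.stopAt (s - θ : ℝ≥0))).stopAt s t
    rw [CadlagPath.stopAt_apply, CadlagPath.stopAt_apply, CadlagPath.paste_apply,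
      CadlagPath.paste_apply, CadlagPath.stopAt_apply,
      min_eq_left (tsub_le_tsub_right (min_le_right t s) θ)]
  · show (x.2.1.paste θ x'.2.1).stopAt s t
      = (x.2.1.paste θ (x'.2.1.stopAt (s - θ : ℝ≥0))).stopAt s t
    rw [IncPath.stopAt_apply, IncPath.stopAt_apply, IncPath.paste_apply,
      IncPath.paste_apply, IncPath.stopAt_apply,
      min_eq_left (tsub_le_tsub_right (min_le_right t s) θ)]
  · show ((x.2.2.paste θ x'.2.2).stopAt s).1
      = ((x.2.2.paste θ (x'.2.2.stopAt (s - θ : ℝ≥0))).stopAt s).1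
    have hs : MeasurableSet (Iic s ×ˢ (univ : Set 𝒰)) := measurableSet_Iic.prod MeasurableSet.univ
    have hsub : timeShift 𝒰 θ ⁻¹' (Iic s ×ˢ univ) ⊆ Iic (s - θ) ×ˢ univ := fun p hp =>
      ⟨mem_Iic.2 (le_tsub_of_add_le_right (show p.1 + θ ≤ s from hp.1)), trivial⟩
    rw [ControlMeasure.stopAt_val, ControlMeasure.stopAt_val, ControlMeasure.paste_val,
      ControlMeasure.paste_val, Measure.restrict_add, Measure.restrict_add,
      Measure.restrict_map (measurable_timeShift θ) hs,
      Measure.restrict_map (measurable_timeShift θ) hs, ControlMeasure.stopAt_val,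
      Measure.restrict_restrict (measurable_timeShift θ hs), inter_eq_left.2 hsub]

/-- The truncated difference t - θ is 0 before θ, so the constant `x'.2.1 0` is added there; hence
the hypothesis that it vanishes. -/
theorem ControlPath.stop_paste_of_lt {x : ControlPath E 𝒰} {θ : ℝ≥0} {x' : ControlPath E 𝒰}
    (h0 : x'.2.1 0 = 0) {s : ℝ≥0} (hs : s < θ) : (x.paste θ x').stopped s = x.stopped s := by
  refine Prod.ext (CadlagPath.ext fun t => ?_)
    (Prod.ext (IncPath.ext fun t => ?_) (Subtype.ext ?_))
  · show (x.1.paste θ x'.1).stopAt s t = x.1.stopAt s t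
    rw [CadlagPath.stopAt_apply, CadlagPath.stopAt_apply, CadlagPath.paste_apply,
      if_pos ((min_le_right t s).trans_lt hs)]
  · show (x.2.1.paste θ x'.2.1).stopAt s t = x.2.1.stopAt s t
    rw [IncPath.stopAt_apply, IncPath.stopAt_apply, IncPath.paste_apply,
      tsub_eq_zero_of_le ((min_le_right t s).trans hs.le), h0, add_zero]
  · show ((x.2.2.paste θ x'.2.2).stopAt s).1 = (x.2.2.stopAt s).1
    have hm : MeasurableSet (Iic s ×ˢ (univ : Set 𝒰)) := measurableSet_Iic.prod MeasurableSet.univ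
    rw [ControlMeasure.stopAt_val, ControlMeasure.stopAt_val, ControlMeasure.paste_val,
      Measure.restrict_add, Measure.restrict_map (measurable_timeShift θ) hm]
    convert add_zero _
    convert Measure.map_zero _
    rw [Measure.restrict_eq_zero]
    convert measure_empty (μ := x'.2.2.1)
    ext p
    simp only [mem_preimage, mem_prod, mem_Iic, mem_univ, and_true, mem_empty_iff_false, iff_false,
      not_le]
    exact hs.trans_le le_add_self

/-- Stopping keeps the instant θ itself, so the continuation must begin at the right point and carry
no control mass at its time 0. -/
theorem ControlPath.stop_paste_self {x : ControlPath E 𝒰} {θ : ℝ≥0} {x' : ControlPath E 𝒰}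
    (hx : x = x.stopped θ) (hj : x.1 θ = x'.1 0) (h0 : x'.2.1 0 = 0)
    (hL0 : x'.2.2.1 (Icc 0 0 ×ˢ univ) = 0) : (x.paste θ x').stopped θ = x := by
  conv_rhs => rw [hx]
  refine Prod.ext (CadlagPath.ext fun t => ?_)
    (Prod.ext (IncPath.ext fun t => ?_) (Subtype.ext ?_))
  · show (x.1.paste θ x'.1).stopAt θ t = x.1.stopAt θ t
    rw [CadlagPath.stopAt_apply, CadlagPath.stopAt_apply,
      CadlagPath.paste_of_le hj (min_le_right t θ)]
  · show (x.2.1.paste θ x'.2.1).stopAt θ t = x.2.1.stopAt θ t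
    rw [IncPath.stopAt_apply, IncPath.stopAt_apply, IncPath.paste_apply,
      tsub_eq_zero_of_le (min_le_right t θ), h0, add_zero]
  · show ((x.2.2.paste θ x'.2.2).stopAt θ).1 = (x.2.2.stopAt θ).1
    have hm : MeasurableSet (Iic θ ×ˢ (univ : Set 𝒰)) := measurableSet_Iic.prod MeasurableSet.univ
    rw [ControlMeasure.stopAt_val, ControlMeasure.stopAt_val, ControlMeasure.paste_val,
      Measure.restrict_add, Measure.restrict_map (measurable_timeShift θ) hm]
    convert add_zero _
    convert Measure.map_zero _
    rw [Measure.restrict_eq_zero]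
    refine measure_mono_null (fun p hp => ?_) hL0
    have h : p.1 + θ ≤ θ := hp.1
    exact ⟨⟨zero_le, by simpa using h⟩, trivial⟩

theorem exitTime_paste {E : Type*} [MetricSpace E] {U : Set E} (hU : IsOpen U)
    {y z : CadlagPath E} {θ : ℝ≥0} (h : exitTime U y = θ) (hj : y θ = z 0) :
    exitTime U (y.paste θ z) = θ :=
  exitTime_congr hU h fun _ hs => (CadlagPath.paste_of_le hj hs).symm

variable {α : Type*} [MeasurableSpace α]

theorem measurable_paste {E : Type*} [TopologicalSpace E]
    [TopologicalSpace.PseudoMetrizableSpace E] [MeasurableSpace E] [BorelSpace E]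
    {X X' : α → ControlPath E 𝒰} {τ : α → ℝ≥0}
    (hX : Measurable X) (hτ : Measurable τ) (hX' : Measurable X') :
    Measurable fun a => (X a).paste (τ a) (X' a) := by
  refine (measurable_cadlagPath_iff.2 fun t => ?_).prodMk
    ((measurable_incPath_iff.2 fun t => ?_).prodMk (measurable_controlMeasure_iff.2 ?_))
  · simp only [CadlagPath.paste_apply]
    exact Measurable.ite (measurableSet_lt measurable_const hτ) (measurable_eval_path hX.fst t)
      (measurable_eval_path_prod.comp (hX'.fst.prodMk (measurable_const.sub hτ)))
  · simp only [IncPath.paste_apply]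
    exact (measurable_eval_inc hX.snd.fst t).add (measurable_eval_path_prod.comp
      ((measurable_subtype_coe.comp hX'.snd.fst).prodMk (measurable_const.sub hτ)))
  · simp only [ControlMeasure.paste_val]
    refine (measurable_controlMeasure_iff.1 hX.snd.snd).add
      (Measure.measurable_of_measurable_coe _ fun C hC => ?_)
    obtain ⟨κ, hκ, hκe⟩ := exists_kernel_controlMeasure hX'.snd.snd
    simp only [Measure.map_apply (measurable_timeShift _) hC, ← hκe]
    refine Kernel.measurable_kernel_prodMk_left
      (t := {q : α × (ℝ≥0 × 𝒰) | timeShift 𝒰 (τ q.1) q.2 ∈ C}) ?_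
    have : Measurable fun q : α × (ℝ≥0 × 𝒰) => timeShift 𝒰 (τ q.1) q.2 :=
      (measurable_snd.fst.add (hτ.comp measurable_fst)).prodMk measurable_snd.snd
    exact this hC

end Paste

/-! ### Integrals up to time t over a space with a time coordinate -/

section TimeIntegrals

variable {β : Type*} [MeasurableSpace β] {τ : β → ℝ≥0}

theorem integrableOn_of_bounded_measurable {μ : Measure β} {S : Set β} (hS : μ S < ∞) {F : β → ℝ}
    (hF : Measurable F) {C : ℝ} (hC : ∀ b, ‖F b‖ ≤ C) : IntegrableOn F S μ := by
  have : IsFiniteMeasure (μ.restrict S) := ⟨by rwa [Measure.restrict_apply_univ]⟩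
  exact Integrable.of_bound hF.aestronglyMeasurable C (Filter.Eventually.of_forall hC)

/-- The time coordinate τ is the identity for dλ₀ and the first projection for Λ₁, so that both
integrals are covered. -/
theorem tendsto_setIntegral_right {μ : Measure β} (hτ : Measurable τ)
    (hfin : ∀ t, μ {b | τ b ≤ t} < ∞) {F : β → ℝ} (hF : Measurable F) {C : ℝ}
    (hC : ∀ b, ‖F b‖ ≤ C) {t : ℝ≥0} {u : ℕ → ℝ≥0} (hu : ∀ n, t ≤ u n) (hu1 : ∀ n, u n ≤ t + 1)
    (hut : Filter.Tendsto u Filter.atTop (𝓝 t)) :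
    Filter.Tendsto (fun n => ∫ b in {b | τ b ≤ u n}, F b ∂μ) Filter.atTop
      (𝓝 (∫ b in {b | τ b ≤ t}, F b ∂μ)) := by
  have hm : ∀ t, MeasurableSet {b | τ b ≤ t} := fun t => measurableSet_le hτ measurable_const
  simp only [← integral_indicator (hm _)]
  refine tendsto_integral_of_dominated_convergence ({b | τ b ≤ t + 1}.indicator fun b => ‖F b‖)
    (fun n => (hF.indicator (hm _)).aestronglyMeasurable)
    ((integrable_indicator_iff (hm _)).2
      (integrableOn_of_bounded_measurable (hfin _) hF hC).norm) (fun n => ?_) ?_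
  · refine Filter.Eventually.of_forall fun b => ?_
    rw [norm_indicator_eq_indicator_norm]
    exact indicator_le_indicator_of_subset (fun b hb => le_trans hb (hu1 n))
      (fun b => norm_nonneg _) b
  · refine Filter.Eventually.of_forall fun b => ?_
    rcases le_or_gt (τ b) t with h | h
    · refine tendsto_const_nhds.congr fun n => ?_
      rw [indicator_of_mem (show b ∈ {b | τ b ≤ t} from h),
        indicator_of_mem (show b ∈ {b | τ b ≤ u n} from h.trans (hu n))]
    · refine tendsto_const_nhds.congr' ?_
      filter_upwards [hut.eventually (gt_mem_nhds h)] with n hn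
      rw [indicator_of_notMem (show b ∉ {b | τ b ≤ t} from not_le.2 h),
        indicator_of_notMem (show b ∉ {b | τ b ≤ u n} from not_le.2 hn)]

/-- For t < θ the shifted measure contributes nothing, while the truncated t - θ = 0 still leaves
the set of times ≤ 0. The hypothesis `hν` makes that set null. -/
theorem setIntegral_add_map {μ ν : Measure β} {θ : ℝ≥0} {σ : β → β} (hτ : Measurable τ)
    (hσ : Measurable σ) (hτσ : ∀ b, τ (σ b) = τ b + θ) (hμ : μ {b | θ < τ b} = 0)
    (hν : ν {b | τ b ≤ 0} = 0) (hμfin : ∀ t, μ {b | τ b ≤ t} < ∞)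
    (hνfin : ∀ t, ν {b | τ b ≤ t} < ∞) {G F F' : β → ℝ} (hG : Measurable G) {C : ℝ}
    (hC : ∀ b, ‖G b‖ ≤ C) (hF : ∀ b, τ b ≤ θ → G b = F b) (hF' : ∀ b, G (σ b) = F' b) (t : ℝ≥0) :
    ∫ b in {b | τ b ≤ t}, G b ∂(μ + ν.map σ)
      = ∫ b in {b | τ b ≤ t}, F b ∂μ + ∫ b in {b | τ b ≤ t - θ}, F' b ∂ν := by
  have hm : ∀ t, MeasurableSet {b | τ b ≤ t} := fun t => measurableSet_le hτ measurable_const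
  have hpre : σ ⁻¹' {b | τ b ≤ t} = {b | τ b + θ ≤ t} := by
    ext b
    simp [hτσ]
  have hνσ : ν.map σ {b | τ b ≤ t} < ∞ := by
    rw [Measure.map_apply hσ (hm t), hpre]
    refine lt_of_le_of_lt (measure_mono fun b (hb : τ b + θ ≤ t) => ?_) (hνfin t)
    exact le_trans le_self_add hb
  rw [Measure.restrict_add, integral_add_measure
    (integrableOn_of_bounded_measurable (hμfin t) hG hC)
    (integrableOn_of_bounded_measurable hνσ hG hC)]
  congr 1
  · refine integral_congr_ae (ae_restrict_of_ae ?_)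
    have : ∀ᵐ b ∂μ, ¬ θ < τ b := by
      rw [ae_iff]
      simpa using hμ
    filter_upwards [this] with b hb using hF b (not_lt.1 hb)
  · rw [setIntegral_map (hm t) hG.aestronglyMeasurable hσ.aemeasurable, hpre]
    simp only [hF']
    refine setIntegral_congr_set ?_
    have : ∀ᵐ b ∂ν, 0 < τ b := by
      rw [ae_iff]
      simpa using hν
    filter_upwards [this] with b hb
    refine propext ?_
    show τ b + θ ≤ t ↔ τ b ≤ t - θ
    rcases le_or_gt θ t with h | h
    · exact (le_tsub_iff_right h).symm
    · rw [tsub_eq_zero_of_le h.le]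
      exact ⟨fun h' => absurd (le_trans le_add_self h') h.not_ge, fun h' => absurd h' hb.not_ge⟩

/-- Comparing masses on each set of bounded time, where they are finite, turns the integral form of
a support condition into a null set. In that form it is easily transported under pasting. -/
theorem measure_compl_eq_zero_of_forall_le {μ : Measure β} {A : Set β} (hA : MeasurableSet A)
    (hfin : ∀ t, μ {b | τ b ≤ t} < ∞)
    (h : ∀ t, μ {b | τ b ≤ t} ≤ ∫⁻ b in {b | τ b ≤ t}, A.indicator 1 b ∂μ) : μ Aᶜ = 0 := by
  have hU : Aᶜ = ⋃ n : ℕ, {b | τ b ≤ n} \ A := by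
    ext b
    simp only [mem_compl_iff, mem_iUnion, mem_sdiff, mem_ofPred_eq, exists_and_right]
    exact ⟨fun hb => ⟨exists_nat_ge (τ b), hb⟩, fun hb => hb.2⟩
  rw [hU, measure_iUnion_null_iff]
  intro n
  have h' := h n
  rw [lintegral_indicator_one hA, Measure.restrict_apply hA, inter_comm] at h'
  have h2 := measure_inter_add_sdiff (μ := μ) {b | τ b ≤ (n : ℝ≥0)} hA
  have h3 : μ ({b | τ b ≤ (n : ℝ≥0)} ∩ A) ≠ ∞ :=
    ((measure_mono inter_subset_left).trans_lt (hfin n)).ne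
  rw [← h2] at h'
  exact (ENNReal.add_le_add_iff_left h3).1 (by simpa using h') |> le_zero_iff.1

theorem setLIntegral_indicator_one_of_null {μ : Measure β} {A : Set β} (hA : MeasurableSet A)
    (h : μ Aᶜ = 0) (S : Set β) : ∫⁻ b in S, A.indicator 1 b ∂μ = μ S := by
  rw [lintegral_indicator_one hA, Measure.restrict_apply hA, inter_comm]
  exact measure_inter_conull h

end TimeIntegrals

/-! ### The martingale process along a pasted triple -/

section PathMart

variable {E 𝒰 : Type*} [MetricSpace E] [MetricSpace 𝒰] [MeasurableSpace 𝒰] {Ξ : Set (E × 𝒰)}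

theorem Icc_zero_eq (t : ℝ≥0) : Icc 0 t = {s : ℝ≥0 | id s ≤ t} := by
  ext s
  simp

theorem Icc_zero_prod_univ_eq {𝒰 : Type*} (t : ℝ≥0) :
    Icc 0 t ×ˢ (univ : Set 𝒰) = {p : ℝ≥0 × 𝒰 | p.1 ≤ t} := by
  ext p
  simp

theorem pathMart_eq (f g : C(E, ℝ)) (h : C(Ξ, ℝ)) (x : ControlPath E 𝒰) (t : ℝ≥0) :
    pathMart f g h x t = f (x.1 t) - f (x.1 0)
      - (∫ s in {s : ℝ≥0 | id s ≤ t}, g (x.1 s) ∂x.2.1.measure)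
      - ∫ p in {p : ℝ≥0 × 𝒰 | p.1 ≤ t},
        Function.extend Subtype.val h 0 (x.1 p.1, p.2) ∂x.2.2.1 := by
  rw [pathMart, controlMart, Icc_zero_prod_univ_eq, Icc_zero_eq]

theorem CadlagPath.measurable {E : Type*} [MetricSpace E] [MeasurableSpace E] [BorelSpace E]
    (y : CadlagPath E) : Measurable y :=
  measurable_eval_path_prod.comp (measurable_const.prodMk measurable_id)

theorem IncPath.measure_id_le_lt_top (l : IncPath) (t : ℝ≥0) : l.measure {s | id s ≤ t} < ∞ :=
  l.measure_Iic_lt_top t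

theorem IncPath.measure_zero (l : IncPath) : l.measure {s | id s ≤ 0} = 0 := by
  show l.measure (Iic 0) = 0
  rw [l.measure_Iic, tsub_self]

variable [MeasurableSpace E] [BorelSpace E] [BorelSpace 𝒰] [SecondCountableTopology 𝒰]

theorem measurable_extend_path (hΞ : IsClosed Ξ) (h : C(Ξ, ℝ)) (y : CadlagPath E) :
    Measurable fun p : ℝ≥0 × 𝒰 => Function.extend Subtype.val h (0 : E × 𝒰 → ℝ) (y p.1, p.2) :=
  (measurable_extend_zero hΞ h).comp ((y.measurable.comp measurable_fst).prodMk measurable_snd)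

variable [CompactSpace E] [CompactSpace 𝒰]

theorem tendsto_pathMart_right (hΞ : IsClosed Ξ) (f g : C(E, ℝ)) (h : C(Ξ, ℝ))
    (x : ControlPath E 𝒰) (t : ℝ≥0) :
    Filter.Tendsto (fun n => pathMart f g h x (ratAbove n t)) Filter.atTop
      (𝓝 (pathMart f g h x t)) := by
  have := isCompact_iff_compactSpace.1 hΞ.isCompact
  have hu1 : ∀ n, (ratAbove n t : ℝ≥0) ≤ t + 1 := fun n =>
    (ratAbove_le n t).trans (by gcongr; exact div_le_one_of_le₀ (by simp) (by positivity))
  have hut := (tendsto_ratAbove t).mono_right nhdsWithin_le_nhds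
  simp only [pathMart_eq]
  refine ((((f.continuous.tendsto _).comp (x.1.tendsto_ratAbove t)).sub_const _).sub ?_).sub ?_
  · exact tendsto_setIntegral_right measurable_id x.2.1.measure_id_le_lt_top
      (g.continuous.measurable.comp x.1.measurable) (fun s => g.norm_coe_le_norm _)
      (fun n => (lt_ratAbove n t).le) hu1 hut
  · exact tendsto_setIntegral_right measurable_fst x.2.2.measure_fst_le_lt_top
      (measurable_extend_path hΞ h x.1) (fun p => abs_extend_zero_le h _)
      (fun n => (lt_ratAbove n t).le) hu1 hut

/-- The integrals add up over the two time ranges, and the boundary terms telescope because the two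
paths agree at the junction. For t ≤ θ the second summand is taken at time 0. -/
theorem pathMart_paste (hΞ : IsClosed Ξ) (f g : C(E, ℝ)) (h : C(Ξ, ℝ)) {x x' : ControlPath E 𝒰}
    {θ : ℝ≥0} (hx : x = x.stopped θ) (hj : x.1 θ = x'.1 0) (hL0 : x'.2.2.1 (Icc 0 0 ×ˢ univ) = 0)
    (t : ℝ≥0) :
    pathMart f g h (x.paste θ x') t = pathMart f g h x t + pathMart f g h x' (t - θ) := by
  have := isCompact_iff_compactSpace.1 hΞ.isCompact
  have hx1 : x.1 = x.1.stopAt θ := congrArg Prod.fst hx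
  have hx2 : x.2.1 = x.2.1.stopAt θ := congrArg (fun z => z.2.1) hx
  have hx3 : x.2.2 = x.2.2.stopAt θ := congrArg (fun z => z.2.2) hx
  have hf : f ((x.paste θ x').1 t) - f ((x.paste θ x').1 0)
      = (f (x.1 t) - f (x.1 0)) + (f (x'.1 (t - θ)) - f (x'.1 0)) := by
    have h0 : (x.paste θ x').1 0 = x.1 0 := CadlagPath.paste_of_le hj zero_le
    rw [h0]
    rcases le_or_gt t θ with ht | ht
    · have h1 : (x.paste θ x').1 t = x.1 t := CadlagPath.paste_of_le hj ht
      rw [h1, tsub_eq_zero_of_le ht]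
      ring
    · have h1 : (x.paste θ x').1 t = x'.1 (t - θ) := by
        show x.1.paste θ x'.1 t = _
        rw [CadlagPath.paste_apply, if_neg ht.not_gt]
      have h2 : x.1 t = x'.1 0 := by
        rw [hx1, CadlagPath.stopAt_apply, min_eq_right ht.le, hj]
      rw [h1, h2]
      ring
  have hl : ∫ s in {s : ℝ≥0 | id s ≤ t}, g ((x.paste θ x').1 s) ∂(x.paste θ x').2.1.measure
      = (∫ s in {s : ℝ≥0 | id s ≤ t}, g (x.1 s) ∂x.2.1.measure)
        + ∫ s in {s : ℝ≥0 | id s ≤ t - θ}, g (x'.1 s) ∂x'.2.1.measure := by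
    have hm : (x.paste θ x').2.1.measure = x.2.1.measure + x'.2.1.measure.map (· + θ) :=
      IncPath.measure_paste _ _ _
    rw [hm]
    refine setIntegral_add_map measurable_id (measurable_add_const θ) (fun _ => rfl) ?_
      x'.2.1.measure_zero x.2.1.measure_id_le_lt_top x'.2.1.measure_id_le_lt_top
      (g.continuous.measurable.comp (x.paste θ x').1.measurable) (fun s => g.norm_coe_le_norm _)
      (fun s hs => ?_) (fun s => ?_) t
    · rw [← IncPath.measure_restrict_of_stopped hx2, Measure.restrict_apply
        (measurableSet_lt measurable_const measurable_id)]
      convert measure_empty (μ := x.2.1.measure)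
      ext s
      simp
    · exact congrArg g (CadlagPath.paste_of_le hj hs)
    · exact congrArg g (CadlagPath.paste_add _ _ _ _)
  have hL : ∫ p in {p : ℝ≥0 × 𝒰 | p.1 ≤ t}, Function.extend Subtype.val h 0
        ((x.paste θ x').1 p.1, p.2) ∂(x.paste θ x').2.2.1
      = (∫ p in {p : ℝ≥0 × 𝒰 | p.1 ≤ t}, Function.extend Subtype.val h 0
          (x.1 p.1, p.2) ∂x.2.2.1)
        + ∫ p in {p : ℝ≥0 × 𝒰 | p.1 ≤ t - θ}, Function.extend Subtype.val h 0
          (x'.1 p.1, p.2) ∂x'.2.2.1 := by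
    have hm : (x.paste θ x').2.2.1 = x.2.2.1 + x'.2.2.1.map (timeShift 𝒰 θ) := rfl
    rw [hm]
    rw [Icc_zero_prod_univ_eq] at hL0
    refine setIntegral_add_map measurable_fst (measurable_timeShift θ) (fun _ => rfl) ?_
      hL0 x.2.2.measure_fst_le_lt_top x'.2.2.measure_fst_le_lt_top
      (measurable_extend_path hΞ h _) (fun s => abs_extend_zero_le h _)
      (fun p hp => ?_) (fun p => ?_) t
    · rw [hx3, ControlMeasure.stopAt_val, Measure.restrict_apply
        (measurableSet_lt measurable_const measurable_fst)]
      convert measure_empty (μ := x.2.2.1)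
      ext s
      simp
    · have := CadlagPath.paste_of_le hj hp
      exact congrArg (fun e => Function.extend Subtype.val h (0 : E × 𝒰 → ℝ) (e, p.2)) this
    · have := CadlagPath.paste_add x.1 θ x'.1 p.1
      exact congrArg (fun e => Function.extend Subtype.val h (0 : E × 𝒰 → ℝ) (e, p.2)) this
  rw [pathMart_eq, pathMart_eq, pathMart_eq, hf, hl, hL]
  ring

end PathMart

/-! ### Pathwise conditions in terms of null sets -/

/-- The pathwise requirements on a solution with exit time `θ`, apart from being stopped. -/
structure IsRegularPath {E 𝒰 : Type*} [TopologicalSpace E] [MeasurableSpace 𝒰] (E₀ : Set E)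
    (Ξ : Set (E × 𝒰)) (θ : ℝ≥0∞) (x : ControlPath E 𝒰) : Prop where
  clock : ∀ t : ℝ≥0, (x.2.1 t : ℝ≥0∞) + x.2.2.1 (Icc 0 t ×ˢ univ) = min (t : ℝ≥0∞) θ
  inside : x.2.1.measure {s | x.1 s ∈ closure E₀}ᶜ = 0
  control : x.2.2.1 {p | (x.1 p.1, p.2) ∈ Ξ}ᶜ = 0

namespace IsRegularPath

section

variable {E 𝒰 : Type*} [TopologicalSpace E] [MeasurableSpace 𝒰] {E₀ : Set E}
  {Ξ : Set (E × 𝒰)} {θ : ℝ≥0∞} {x : ControlPath E 𝒰}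

theorem clock_zero (hx : IsRegularPath E₀ Ξ θ x) :
    (x.2.1 0 : ℝ≥0∞) + x.2.2.1 (Icc 0 0 ×ˢ univ) = 0 := by
  rw [hx.clock 0, ENNReal.coe_zero, min_eq_left zero_le]

theorem lam_zero (hx : IsRegularPath E₀ Ξ θ x) : x.2.1 0 = 0 :=
  ENNReal.coe_eq_zero.1 (add_eq_zero.1 hx.clock_zero).1

theorem Lam_zero (hx : IsRegularPath E₀ Ξ θ x) : x.2.2.1 (Icc 0 0 ×ˢ univ) = 0 :=
  (add_eq_zero.1 hx.clock_zero).2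

theorem measure_Icc (hx : IsRegularPath E₀ Ξ θ x) (t : ℝ≥0) :
    x.2.1.measure (Icc 0 t) = x.2.1 t := by
  rw [IncPath.measure_Icc_zero, hx.lam_zero, ENNReal.coe_zero, tsub_zero]

theorem measure_Icc_le (hx : IsRegularPath E₀ Ξ θ x) (t : ℝ≥0) :
    x.2.1.measure (Icc 0 t) ≤ t := by
  rw [hx.measure_Icc]
  exact le_self_add.trans ((hx.clock t).le.trans (min_le_left _ _))

theorem control_Icc_le (hx : IsRegularPath E₀ Ξ θ x) (t : ℝ≥0) :
    x.2.2.1 (Icc 0 t ×ˢ univ) ≤ t :=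
  le_add_self.trans ((hx.clock t).le.trans (min_le_left _ _))

end

variable {E 𝒰 : Type*} [MetricSpace E] [MeasurableSpace E] [BorelSpace E] [MeasurableSpace 𝒰]
  {E₀ : Set E} {Ξ : Set (E × 𝒰)} {θ : ℝ≥0∞} {x : ControlPath E 𝒰}

/-- The total clock is nondecreasing in t and can be squeezed between rational times. Thus the clock
condition is a countable one. -/
theorem clock_of_rat {𝒰 : Type*} [MeasurableSpace 𝒰] (l : IncPath) (L : ControlMeasure 𝒰)
    (h : ∀ q : ℚ≥0, (l q : ℝ≥0∞) + L.1 (Icc 0 (q : ℝ≥0) ×ˢ univ) = (q : ℝ≥0)) (t : ℝ≥0) :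
    (l t : ℝ≥0∞) + L.1 (Icc 0 t ×ˢ univ) = t := by
  have hmono : ∀ s t : ℝ≥0, s ≤ t → (l s : ℝ≥0∞) + L.1 (Icc 0 s ×ˢ univ)
      ≤ (l t : ℝ≥0∞) + L.1 (Icc 0 t ×ˢ univ) := fun s t hst =>
    add_le_add (ENNReal.coe_le_coe.2 (l.2 hst))
      (measure_mono (prod_mono (Icc_subset_Icc_right hst) Subset.rfl))
  refine le_antisymm ?_ (ENNReal.le_of_forall_nnreal_lt fun r hr => ?_)
  · have hlim := (ENNReal.continuous_coe.tendsto t).comp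
      ((tendsto_ratAbove t).mono_right nhdsWithin_le_nhds)
    refine ge_of_tendsto' hlim fun n => ?_
    exact (hmono _ _ (lt_ratAbove n t).le).trans (h _).le
  · have hlim := (tendsto_ratAbove r).mono_right nhdsWithin_le_nhds
    obtain ⟨n, hn⟩ := (hlim.eventually (gt_mem_nhds (ENNReal.coe_lt_coe.1 hr))).exists
    exact (ENNReal.coe_le_coe.2 (lt_ratAbove n r).le).trans ((h _).ge.trans (hmono _ _ hn.le))

theorem measurableSet_inside (y : CadlagPath E) : MeasurableSet {s | y s ∈ closure E₀} :=
  y.measurable isClosed_closure.measurableSet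

theorem lam_support (hx : IsRegularPath E₀ Ξ θ x) (t : ℝ≥0) :
    (x.2.1 t : ℝ≥0∞) = ∫⁻ s in Icc 0 t, (closure E₀).indicator 1 (x.1 s) ∂x.2.1.measure := by
  rw [← hx.measure_Icc]
  exact (setLIntegral_indicator_one_of_null (measurableSet_inside x.1) hx.inside _).symm

variable [MetricSpace 𝒰] [BorelSpace 𝒰] [SecondCountableTopology 𝒰]

/-- The clock bounds the mass of each of the two measures on [0, t] by t. The resulting constant is
uniform in the path and in θ, which serves integrability and dominated convergence. -/
theorem exists_abs_pathMart_le {E 𝒰 : Type*} [MetricSpace E] [CompactSpace E] [MetricSpace 𝒰]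
    [CompactSpace 𝒰] [MeasurableSpace 𝒰] {Ξ : Set (E × 𝒰)} (E₀ : Set E) (hΞ : IsClosed Ξ)
    (f g : C(E, ℝ)) (h : C(Ξ, ℝ)) (T : ℝ≥0) :
    ∃ C : ℝ, ∀ (θ : ℝ≥0∞) (x : ControlPath E 𝒰), IsRegularPath E₀ Ξ θ x → ∀ t ≤ T,
      ‖pathMart f g h x t‖ ≤ C := by
  have := isCompact_iff_compactSpace.1 hΞ.isCompact
  refine ⟨‖f‖ + ‖f‖ + ‖g‖ * T + ‖h‖ * T, fun θ x hx t ht => ?_⟩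
  have ht' : (t : ℝ≥0∞) ≤ T := ENNReal.coe_le_coe.2 ht
  rw [pathMart, controlMart]
  refine (norm_sub_le _ _).trans (add_le_add ((norm_sub_le _ _).trans
    (add_le_add ((norm_sub_le _ _).trans (add_le_add (f.norm_coe_le_norm _)
      (f.norm_coe_le_norm _))) ?_)) ?_)
  · refine (norm_setIntegral_le_of_norm_le_const
      ((hx.measure_Icc_le t).trans_lt ENNReal.coe_lt_top)
      fun s _ => g.norm_coe_le_norm _).trans ?_
    exact mul_le_mul_of_nonneg_left
      (ENNReal.toReal_le_coe_of_le_coe ((hx.measure_Icc_le t).trans ht')) (norm_nonneg _)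
  · refine (norm_setIntegral_le_of_norm_le_const
      ((hx.control_Icc_le t).trans_lt ENNReal.coe_lt_top)
      fun p _ => abs_extend_zero_le h _).trans ?_
    exact mul_le_mul_of_nonneg_left
      (ENNReal.toReal_le_coe_of_le_coe ((hx.control_Icc_le t).trans ht')) (norm_nonneg _)

theorem measurableSet_control (hΞ : IsClosed Ξ) (y : CadlagPath E) :
    MeasurableSet {p : ℝ≥0 × 𝒰 | (y p.1, p.2) ∈ Ξ} :=
  ((y.measurable.comp measurable_fst).prodMk measurable_snd) hΞ.measurableSet

theorem Lam_support (hΞ : IsClosed Ξ) (hx : IsRegularPath E₀ Ξ θ x) (t : ℝ≥0) :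
    x.2.2.1 (Icc 0 t ×ˢ univ)
      = ∫⁻ p in Icc 0 t ×ˢ univ, Ξ.indicator 1 (x.1 p.1, p.2) ∂x.2.2.1 :=
  (setLIntegral_indicator_one_of_null (measurableSet_control hΞ x.1) hx.control _).symm

theorem of_support (hΞ : IsClosed Ξ)
    (h1 : ∀ t : ℝ≥0, (x.2.1 t : ℝ≥0∞) + x.2.2.1 (Icc 0 t ×ˢ univ) = min (t : ℝ≥0∞) θ)
    (h2 : ∀ t : ℝ≥0, (x.2.1 t : ℝ≥0∞)
      = ∫⁻ s in Icc 0 t, (closure E₀).indicator 1 (x.1 s) ∂x.2.1.measure)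
    (h3 : ∀ t : ℝ≥0, x.2.2.1 (Icc 0 t ×ˢ univ)
      = ∫⁻ p in Icc 0 t ×ˢ univ, Ξ.indicator 1 (x.1 p.1, p.2) ∂x.2.2.1) :
    IsRegularPath E₀ Ξ θ x := by
  refine ⟨h1, ?_, ?_⟩
  · refine measure_compl_eq_zero_of_forall_le (measurableSet_inside x.1)
      x.2.1.measure_id_le_lt_top fun t => ?_
    have h := h2 t
    rw [Icc_zero_eq] at h
    refine le_of_le_of_eq ?_ h
    rw [← Icc_zero_eq, IncPath.measure_Icc_zero]
    exact tsub_le_self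
  · refine measure_compl_eq_zero_of_forall_le (measurableSet_control hΞ x.1)
      x.2.2.measure_fst_le_lt_top fun t => ?_
    have h := h3 t
    rw [Icc_zero_prod_univ_eq] at h
    exact h.le

theorem measurableSet_setOf (hΞ : IsClosed Ξ) :
    MeasurableSet {x : ControlPath E 𝒰 | IsRegularPath E₀ Ξ ∞ x} := by
  have h : {x : ControlPath E 𝒰 | IsRegularPath E₀ Ξ ∞ x}
      = (⋂ q : ℚ≥0, {x | (x.2.1 q : ℝ≥0∞) + x.2.2.1 (Icc 0 (q : ℝ≥0) ×ˢ univ) = (q : ℝ≥0)})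
        ∩ ({x | x.2.1.measure {s | x.1 s ∈ closure E₀}ᶜ = 0}
        ∩ {x | x.2.2.1 {p | (x.1 p.1, p.2) ∈ Ξ}ᶜ = 0}) := by
    ext x
    simp only [mem_inter_iff, mem_iInter, mem_ofPred_eq]
    refine ⟨fun hx => ⟨fun q => ?_, hx.inside, hx.control⟩,
      fun hx => ⟨fun t => ?_, hx.2.1, hx.2.2⟩⟩
    · rw [hx.clock, min_eq_left le_top]
    · rw [clock_of_rat _ _ hx.1, min_eq_left le_top]
  have hy : Measurable fun x : ControlPath E 𝒰 => x.1 := measurable_fst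
  have hl : Measurable fun x : ControlPath E 𝒰 => x.2.1 := measurable_snd.fst
  have hL : Measurable fun x : ControlPath E 𝒰 => x.2.2 := measurable_snd.snd
  rw [h]
  refine (MeasurableSet.iInter fun q => ?_).inter (MeasurableSet.inter ?_ ?_)
  · exact measurableSet_eq_fun ((measurable_eval_inc hl _).coe_nnreal_ennreal.add
      ((Measure.measurable_coe (measurableSet_Icc.prod MeasurableSet.univ)).comp
        (measurable_controlMeasure_iff.1 hL))) measurable_const
  · obtain ⟨κ, hκ, hκe⟩ := exists_kernel_incPath hl
    refine measurableSet_eq_fun ?_ measurable_const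
    simp only [← hκe]
    refine Kernel.measurable_kernel_prodMk_left
      (t := {q : ControlPath E 𝒰 × ℝ≥0 | q.1.1 q.2 ∈ closure E₀}ᶜ) (MeasurableSet.compl ?_)
    exact (measurable_eval_path_prod.comp ((hy.comp measurable_fst).prodMk measurable_snd))
      isClosed_closure.measurableSet
  · obtain ⟨κ, hκ, hκe⟩ := exists_kernel_controlMeasure hL
    refine measurableSet_eq_fun ?_ measurable_const
    simp only [← hκe]
    refine Kernel.measurable_kernel_prodMk_left
      (t := {q : ControlPath E 𝒰 × (ℝ≥0 × 𝒰) | (q.1.1 q.2.1, q.2.2) ∈ Ξ}ᶜ)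
      (MeasurableSet.compl ?_)
    exact ((measurable_eval_path_prod.comp ((hy.comp measurable_fst).prodMk
      measurable_snd.fst)).prodMk measurable_snd.snd) hΞ.measurableSet

theorem paste {θ : ℝ≥0} {x x' : ControlPath E 𝒰} (hΞ : IsClosed Ξ) (hx : IsRegularPath E₀ Ξ θ x)
    (hs : x = x.stopped θ) (hx' : IsRegularPath E₀ Ξ ∞ x') (hj : x.1 θ = x'.1 0) :
    IsRegularPath E₀ Ξ ∞ (x.paste θ x') := by
  have hx2 : x.2.1 = x.2.1.stopAt θ := congrArg (fun z => z.2.1) hs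
  have hx3 : x.2.2 = x.2.2.stopAt θ := congrArg (fun z => z.2.2) hs
  refine ⟨fun t => ?_, ?_, ?_⟩
  · have hm : MeasurableSet (Icc 0 t ×ˢ (univ : Set 𝒰)) :=
      measurableSet_Icc.prod MeasurableSet.univ
    have h1 : x'.2.2.1.map (timeShift 𝒰 θ) (Icc 0 t ×ˢ univ)
        = x'.2.2.1 (Icc 0 (t - θ) ×ˢ univ) := by
      rw [Measure.map_apply (measurable_timeShift θ) hm, Icc_zero_prod_univ_eq,
        Icc_zero_prod_univ_eq]
      rcases le_or_gt θ t with h | h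
      · congr 1
        ext p
        exact (le_tsub_iff_right h).symm
      · have h0 := hx'.Lam_zero
        rw [Icc_zero_prod_univ_eq] at h0
        rw [tsub_eq_zero_of_le h.le, h0]
        convert measure_empty (μ := x'.2.2.1)
        ext p
        simp only [mem_preimage, mem_ofPred_eq, mem_empty_iff_false, iff_false, not_le]
        exact h.trans_le le_add_self
    show ((x.2.1 t + x'.2.1 (t - θ) : ℝ≥0) : ℝ≥0∞)
      + (x.2.2.1 + x'.2.2.1.map (timeShift 𝒰 θ)) (Icc 0 t ×ˢ univ) = _
    rw [Measure.add_apply, h1, ENNReal.coe_add, add_add_add_comm, hx.clock, hx'.clock,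
      min_eq_left le_top, min_eq_left le_top, ← ENNReal.coe_min, ← ENNReal.coe_add]
    congr 1
    -- Here the clocks add up: (t ∧ θ) + (t - θ) = t with truncated subtraction.
    rcases le_total t θ with h | h
    · rw [min_eq_left h, tsub_eq_zero_of_le h, add_zero]
    · rw [min_eq_right h, add_tsub_cancel_of_le h]
  · have hm : (x.paste θ x').2.1.measure = x.2.1.measure + x'.2.1.measure.map (· + θ) :=
      IncPath.measure_paste _ _ _
    rw [hm, Measure.add_apply, Measure.map_apply (measurable_add_const θ)
      (measurableSet_inside _).compl, add_eq_zero]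
    constructor
    · rw [← IncPath.measure_restrict_of_stopped hx2, Measure.restrict_apply
        (measurableSet_inside _).compl]
      refine measure_mono_null (fun s hs => ?_) hx.inside
      have h1 : (x.paste θ x').1 s = x.1 s := CadlagPath.paste_of_le hj hs.2
      exact fun h => hs.1 (show (x.paste θ x').1 s ∈ closure E₀ from h1 ▸ h)
    · refine measure_mono_null (fun s hs => ?_) hx'.inside
      have h1 : (x.paste θ x').1 (s + θ) = x'.1 s := CadlagPath.paste_add _ _ _ _
      exact fun h => hs (show (x.paste θ x').1 (s + θ) ∈ closure E₀ from h1 ▸ h)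
  · have hm : (x.paste θ x').2.2.1 = x.2.2.1 + x'.2.2.1.map (timeShift 𝒰 θ) := rfl
    rw [hm, Measure.add_apply, Measure.map_apply (measurable_timeShift θ)
      (measurableSet_control hΞ _).compl, add_eq_zero]
    constructor
    · rw [hx3, ControlMeasure.stopAt_val, Measure.restrict_apply (measurableSet_control hΞ _).compl]
      refine measure_mono_null (fun p hp => ?_) hx.control
      have h1 : (x.paste θ x').1 p.1 = x.1 p.1 := CadlagPath.paste_of_le hj hp.2.1
      exact fun h => hp.1 (show ((x.paste θ x').1 p.1, p.2) ∈ Ξ from h1 ▸ h)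
    · refine measure_mono_null (fun p hp => ?_) hx'.control
      have h1 : (x.paste θ x').1 (p.1 + θ) = x'.1 p.1 := CadlagPath.paste_add _ _ _ _
      exact fun h => hp (show ((x.paste θ x').1 (p.1 + θ), p.2) ∈ Ξ from h1 ▸ h)

end IsRegularPath

/-! ### The martingale property of a law, and its disintegration -/

/-- A π-λ argument: countably many half-lines decide all events of σ(T), which allows a single
exceptional null set later. -/
theorem setIntegral_preimage_eq_zero {α : Type*} [MeasurableSpace α] {μ : Measure α}
    {T : α → ℝ} (hT : Measurable T) {F : α → ℝ} (hF : Integrable F μ) (huniv : ∫ a, F a ∂μ = 0)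
    (h : ∀ q : ℚ, ∫ a in T ⁻¹' Iic (q : ℝ), F a ∂μ = 0) {B : Set ℝ} (hB : MeasurableSet B) :
    ∫ a in T ⁻¹' B, F a ∂μ = 0 := by
  induction B, hB using MeasurableSpace.induction_on_inter
    (BorelSpace.measurable_eq.trans Real.borel_eq_generateFrom_Iic_rat)
    Real.isPiSystem_Iic_rat with
  | empty => simp
  | basic B hB =>
    simp only [mem_iUnion, mem_singleton_iff] at hB
    obtain ⟨q, rfl⟩ := hB
    exact h q
  | compl B hB ih => rw [preimage_compl, setIntegral_compl (hT hB) hF, huniv, ih, sub_zero]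
  | iUnion B hd hB ih =>
    rw [preimage_iUnion, integral_iUnion (fun n => hT (hB n))
      (fun m n hmn => (hd hmn).preimage T) hF.integrableOn]
    simp [ih]

section StopStop

variable {E 𝒰 : Type*} [TopologicalSpace E] [MeasurableSpace 𝒰]

theorem ControlPath.stop_stop (x : ControlPath E 𝒰) {s t : ℝ≥0} (h : s ≤ t) :
    (x.stopped t).stopped s = x.stopped s := by
  refine Prod.ext (CadlagPath.ext fun r => ?_)
    (Prod.ext (IncPath.ext fun r => ?_) (Subtype.ext ?_))
  · show (x.1.stopAt t).stopAt s r = x.1.stopAt s r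
    rw [CadlagPath.stopAt_apply, CadlagPath.stopAt_apply, CadlagPath.stopAt_apply,
      min_eq_left ((min_le_right r s).trans h)]
  · show (x.2.1.stopAt t).stopAt s r = x.2.1.stopAt s r
    rw [IncPath.stopAt_apply, IncPath.stopAt_apply, IncPath.stopAt_apply,
      min_eq_left ((min_le_right r s).trans h)]
  · show ((x.2.2.stopAt t).stopAt s).1 = (x.2.2.stopAt s).1
    rw [ControlMeasure.stopAt_val, ControlMeasure.stopAt_val, ControlMeasure.stopAt_val,
      Measure.restrict_restrict (measurableSet_Iic.prod MeasurableSet.univ), prod_inter_prod,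
      Iic_inter_Iic, min_eq_left h, inter_univ]

theorem ControlPath.stop_fst_apply (x : ControlPath E 𝒰) {s t : ℝ≥0} (h : s ≤ t) :
    (x.stopped t).1 s = x.1 s := by
  show x.1.stopAt t s = _
  rw [CadlagPath.stopAt_apply, min_eq_left h]

end StopStop

section KernelMartingale

variable {E 𝒰 : Type*} [MetricSpace E] [CompactSpace E] [MeasurableSpace E] [BorelSpace E]
  [MetricSpace 𝒰] [CompactSpace 𝒰] [MeasurableSpace 𝒰] [BorelSpace 𝒰] {E₀ : Set E}
  {Ξ : Set (E × 𝒰)}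

theorem standardBorelSpace_controlPath : StandardBorelSpace (ControlPath E 𝒰) := by
  have := standardBorelSpace_cadlagPath (E := E)
  have := standardBorelSpace_incPath
  have := standardBorelSpace_controlMeasure (𝒰 := 𝒰)
  infer_instance

/-- Under the law `Q`, the process `pathMart f g h` is a martingale with respect to the filtration
of the stopped paths. -/
def IsPathMartingale (f g : C(E, ℝ)) (h : C(Ξ, ℝ)) (Q : Measure (ControlPath E 𝒰)) : Prop :=
  ∀ a b : ℝ≥0, a ≤ b → ∀ D : Set (ControlPath E 𝒰), MeasurableSet D →
    ∫ x in (fun x => x.stopped a) ⁻¹' D, (pathMart f g h x b - pathMart f g h x a) ∂Q = 0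

theorem measurable_pathMart_at (hΞ : IsClosed Ξ) (f g : C(E, ℝ)) (h : C(Ξ, ℝ)) (t : ℝ≥0) :
    Measurable fun x : ControlPath E 𝒰 => pathMart f g h x t :=
  (measurable_pathMart hΞ f g h).comp (measurable_id.prodMk measurable_const)

theorem integrable_pathMart (hΞ : IsClosed Ξ) (f g : C(E, ℝ)) (h : C(Ξ, ℝ))
    {Q : Measure (ControlPath E 𝒰)} [IsFiniteMeasure Q]
    (hQ : ∀ᵐ x ∂Q, IsRegularPath E₀ Ξ ∞ x) (t : ℝ≥0) :
    Integrable (fun x => pathMart f g h x t) Q := by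
  obtain ⟨C, hC⟩ := IsRegularPath.exists_abs_pathMart_le E₀ hΞ f g h t
  refine Integrable.of_bound (measurable_pathMart_at hΞ f g h t).aestronglyMeasurable C ?_
  filter_upwards [hQ] with x hx using hC _ x hx t le_rfl

/-- Approximate both times from the right by rationals. An event of the path stopped at a is also
one of the path stopped at the later time `ratAbove n a`, and right continuity with a uniform bound
permits passage to the limit. -/
theorem isPathMartingale_of_rat (hΞ : IsClosed Ξ) (f g : C(E, ℝ)) (h : C(Ξ, ℝ))
    {Q : Measure (ControlPath E 𝒰)} [IsFiniteMeasure Q]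
    (hQ : ∀ᵐ x ∂Q, IsRegularPath E₀ Ξ ∞ x)
    (hM : ∀ a b : ℚ≥0, a ≤ b → ∀ D : Set (ControlPath E 𝒰), MeasurableSet D →
      ∫ x in (fun x => x.stopped (a : ℝ≥0)) ⁻¹' D,
        (pathMart f g h x b - pathMart f g h x a) ∂Q = 0) :
    IsPathMartingale f g h Q := by
  intro a b hab D hD
  obtain ⟨C, hC⟩ := IsRegularPath.exists_abs_pathMart_le E₀ hΞ f g h (b + 1)
  have hle1 : ∀ n, (ratAbove n b : ℝ≥0) ≤ b + 1 := fun n =>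
    (ratAbove_le n b).trans (by gcongr; exact div_le_one_of_le₀ (by simp) (by positivity))
  have hz : ∀ n, ∫ x in (fun x => x.stopped a) ⁻¹' D,
      (pathMart f g h x (ratAbove n b) - pathMart f g h x (ratAbove n a)) ∂Q = 0 := by
    intro n
    have h1 := hM (ratAbove n a) (ratAbove n b) (by exact_mod_cast ratAbove_mono n hab)
      ((fun x => x.stopped a) ⁻¹' D) (measurable_stop a hD)
    convert h1 using 3
    ext x
    simp only [mem_preimage, ControlPath.stop_stop x (lt_ratAbove n a).le]
  have hlim := tendsto_integral_of_dominated_convergence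
    (μ := Q.restrict ((fun x => x.stopped a) ⁻¹' D))
    (F := fun n x => pathMart f g h x (ratAbove n b) - pathMart f g h x (ratAbove n a))
    (f := fun x => pathMart f g h x b - pathMart f g h x a) (fun _ => C + C)
    (fun n => ((measurable_pathMart_at hΞ f g h _).sub
      (measurable_pathMart_at hΞ f g h _)).aestronglyMeasurable)
    (integrable_const _) (fun n => ?_)
    (Filter.Eventually.of_forall fun x => (tendsto_pathMart_right hΞ f g h x b).sub
      (tendsto_pathMart_right hΞ f g h x a))
  · simp only [hz] at hlim
    exact tendsto_nhds_unique hlim tendsto_const_nhds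
  · filter_upwards [ae_restrict_of_ae hQ] with x hx
    exact (norm_sub_le _ _).trans (add_le_add (hC _ x hx _ (hle1 n))
      (hC _ x hx _ ((ratAbove_mono n hab).trans (hle1 n))))

theorem ae_isRegularPath_kernel (hΞ : IsClosed Ξ) {Q : Measure (ControlPath E 𝒰)}
    (hQ : ∀ᵐ x ∂Q, IsRegularPath E₀ Ξ ∞ x) {ν : Measure E} [SFinite ν]
    {κ : Kernel E (ControlPath E 𝒰)} [IsSFiniteKernel κ]
    (hκ : ν ⊗ₘ κ = Q.map fun x => (x.1 0, x)) :
    ∀ᵐ e ∂ν, ∀ᵐ x ∂κ e, IsRegularPath E₀ Ξ ∞ x := by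
  have hm : Measurable fun x : ControlPath E 𝒰 => (x.1 0, x) :=
    (measurable_eval_path measurable_fst 0).prodMk measurable_id
  have h : ∀ᵐ p ∂(ν ⊗ₘ κ), IsRegularPath E₀ Ξ ∞ p.2 := by
    rw [hκ]
    exact (ae_map_iff hm.aemeasurable (p := fun p : E × ControlPath E 𝒰 => IsRegularPath E₀ Ξ ∞ p.2)
      (measurable_snd (IsRegularPath.measurableSet_setOf hΞ))).2 hQ
  exact Measure.ae_ae_of_ae_compProd h

/-- For fixed a, b, D the conditional integral vanishes almost everywhere because its integral over
every set C of starting points does. Rational times and the preimages of rational half-lines under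
`embeddingReal` are countably many, and they suffice for all times and events. -/
theorem ae_isPathMartingale_kernel (hΞ : IsClosed Ξ) (f g : C(E, ℝ)) (h : C(Ξ, ℝ))
    {Q : Measure (ControlPath E 𝒰)} [IsFiniteMeasure Q] (hQ : ∀ᵐ x ∂Q, IsRegularPath E₀ Ξ ∞ x)
    (hM : IsPathMartingale f g h Q) {ν : Measure E} [IsFiniteMeasure ν]
    {κ : Kernel E (ControlPath E 𝒰)} [IsMarkovKernel κ]
    (hκ : ν ⊗ₘ κ = Q.map fun x => (x.1 0, x)) :
    ∀ᵐ e ∂ν, IsPathMartingale f g h (κ e) := by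
  have hX : StandardBorelSpace (ControlPath E 𝒰) := standardBorelSpace_controlPath
  have hm : Measurable fun x : ControlPath E 𝒰 => (x.1 0, x) :=
    (measurable_eval_path measurable_fst 0).prodMk measurable_id
  have hfix : ∀ a b : ℝ≥0, a ≤ b → ∀ D : Set (ControlPath E 𝒰), MeasurableSet D →
      ∀ᵐ e ∂ν, ∫ x in (fun x => x.stopped a) ⁻¹' D,
        (pathMart f g h x b - pathMart f g h x a) ∂(κ e) = 0 := by
    intro a b hab D hD
    have hF : Measurable fun x : ControlPath E 𝒰 => pathMart f g h x b - pathMart f g h x a :=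
      (measurable_pathMart_at hΞ f g h b).sub (measurable_pathMart_at hΞ f g h a)
    have hint : Integrable (fun p : E × ControlPath E 𝒰 =>
        pathMart f g h p.2 b - pathMart f g h p.2 a) (ν ⊗ₘ κ) := by
      rw [hκ]
      refine (integrable_map_measure (g := fun p : E × ControlPath E 𝒰 =>
        pathMart f g h p.2 b - pathMart f g h p.2 a)
        (hF.comp measurable_snd).aestronglyMeasurable hm.aemeasurable).2 ?_
      exact (integrable_pathMart hΞ f g h hQ b).sub (integrable_pathMart hΞ f g h hQ a)
    have hDm := measurable_stop (E := E) (𝒰 := 𝒰) a hD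
    have hint' : Integrable (fun e => ∫ x in (fun x => x.stopped a) ⁻¹' D,
        (pathMart f g h x b - pathMart f g h x a) ∂(κ e)) ν := by
      have h0 : Integrable ((Prod.snd ⁻¹' ((fun x => x.stopped a) ⁻¹' D)).indicator
          fun p : E × ControlPath E 𝒰 => pathMart f g h p.2 b - pathMart f g h p.2 a) (ν ⊗ₘ κ) :=
        hint.indicator (measurable_snd hDm)
      have h1 := Integrable.integral_compProd (κ := Kernel.const Unit ν)
        (η := Kernel.prodMkLeft Unit κ) (a := ()) h0
      simp only [Kernel.prodMkLeft_apply, Kernel.const_apply] at h1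
      refine h1.congr (Filter.Eventually.of_forall fun e => ?_)
      simp only []
      rw [← integral_indicator hDm]
      rfl
    refine hint'.ae_eq_zero_of_forall_setIntegral_eq_zero fun C hC _ => ?_
    rw [← Measure.setIntegral_compProd (f := fun p : E × ControlPath E 𝒰 =>
        pathMart f g h p.2 b - pathMart f g h p.2 a) hC hDm hint.integrableOn, hκ]
    refine (setIntegral_map (f := fun p : E × ControlPath E 𝒰 =>
        pathMart f g h p.2 b - pathMart f g h p.2 a) (hC.prod hDm)
      (hF.comp measurable_snd).aestronglyMeasurable hm.aemeasurable).trans ?_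
    -- The starting point is unaffected by stopping at a, so conditioning on it stays within the
    -- events known at time a.
    have h1 := hM a b hab (D ∩ {x | x.1 0 ∈ C})
      (hD.inter (measurable_eval_path measurable_fst 0 hC))
    convert h1 using 3
    ext x
    simp only [mem_preimage, mem_prod, mem_inter_iff, mem_ofPred_eq,
      ControlPath.stop_fst_apply x (zero_le (a := a)), and_comm]
  have hall : ∀ᵐ e ∂ν, ∀ a b : ℚ≥0, a ≤ b →
      (∫ x in (fun x => x.stopped (a : ℝ≥0)) ⁻¹' univ,
        (pathMart f g h x b - pathMart f g h x a) ∂(κ e) = 0) ∧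
      ∀ q : ℚ, ∫ x in (fun x => x.stopped (a : ℝ≥0)) ⁻¹'
        (embeddingReal (ControlPath E 𝒰) ⁻¹' Iic (q : ℝ)),
        (pathMart f g h x b - pathMart f g h x a) ∂(κ e) = 0 := by
    refine ae_all_iff.2 fun a => ae_all_iff.2 fun b => ?_
    by_cases hab : a ≤ b
    · have hab' : (a : ℝ≥0) ≤ b := by exact_mod_cast hab
      filter_upwards [hfix a b hab' univ MeasurableSet.univ, ae_all_iff.2 fun q : ℚ =>
        hfix a b hab' _ (measurable_embeddingReal (ControlPath E 𝒰)
          (measurableSet_Iic (a := (q : ℝ))))] with e h1 h2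
      exact fun _ => ⟨h1, h2⟩
    · exact Filter.Eventually.of_forall fun e h' => absurd h' hab
  filter_upwards [hall, ae_isRegularPath_kernel hΞ hQ hκ] with e he hreg
  refine isPathMartingale_of_rat hΞ f g h hreg fun a b hab D hD => ?_
  have hemb := measurableEmbedding_embeddingReal (ControlPath E 𝒰)
  have h1 := setIntegral_preimage_eq_zero (μ := κ e)
    (T := embeddingReal (ControlPath E 𝒰) ∘ fun x => x.stopped (a : ℝ≥0))
    (hemb.measurable.comp (measurable_stop a))
    ((integrable_pathMart hΞ f g h hreg b).sub (integrable_pathMart hΞ f g h hreg a))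
    (by simpa using (he a b hab).1) (he a b hab).2 (hemb.measurableSet_image.2 hD)
  rwa [preimage_comp, hemb.injective.preimage_image] at h1

end KernelMartingale

/-! ### From laws on path space to martingales and back -/

section PathMartStop

variable {E 𝒰 : Type*} [MetricSpace E] [TopologicalSpace 𝒰] [MeasurableSpace 𝒰]
  {Ξ : Set (E × 𝒰)}

theorem IncPath.measure_stopAt (l : IncPath) (θ : ℝ≥0) :
    (l.stopAt θ).measure = l.measure.restrict (Iic θ) := by
  refine measure_eq_of_Iic (fun t => (IncPath.measure_Iic_lt_top _ t).ne) fun t => ?_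
  rw [Measure.restrict_apply measurableSet_Iic, Iic_inter_Iic, IncPath.measure_Iic,
    IncPath.measure_Iic, IncPath.stopAt_apply, IncPath.stopAt_apply, zero_min]

/-- With t = θ this says that the process at time t is a function of the path stopped at t, hence
adapted. -/
theorem pathMart_stop (f g : C(E, ℝ)) (h : C(Ξ, ℝ)) (x : ControlPath E 𝒰) (θ t : ℝ≥0) :
    pathMart f g h (x.stopped θ) t = pathMart f g h x (min t θ) := by
  have h1 : (x.stopped θ).2.1.measure.restrict (Iic t)
      = x.2.1.measure.restrict (Iic (min t θ)) := by
    show (x.2.1.stopAt θ).measure.restrict (Iic t) = _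
    rw [IncPath.measure_stopAt, Measure.restrict_restrict measurableSet_Iic, Iic_inter_Iic]
  have h2 : (x.stopped θ).2.2.1.restrict (Iic t ×ˢ univ)
      = x.2.2.1.restrict (Iic (min t θ) ×ˢ univ) := by
    show (x.2.2.stopAt θ).1.restrict (Iic t ×ˢ univ) = _
    rw [ControlMeasure.stopAt_val, Measure.restrict_restrict
      (measurableSet_Iic.prod MeasurableSet.univ), prod_inter_prod, Iic_inter_Iic, inter_univ]
  have hx : ∀ s, (x.stopped θ).1 s = x.1 (min s θ) := fun s => CadlagPath.stopAt_apply _ _ _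
  rw [pathMart, pathMart, controlMart, controlMart, Icc_zero_eq_Iic, Icc_zero_eq_Iic, h1, h2,
    hx t, hx 0, min_eq_left (zero_le (a := θ))]
  congr 1
  · congr 1
    refine setIntegral_congr_fun measurableSet_Iic fun s hs => ?_
    have : (x.stopped θ).1 s = x.1 s := by rw [hx, min_eq_left (le_min_iff.1 hs).2]
    exact congrArg g this
  · refine setIntegral_congr_fun (measurableSet_Iic.prod MeasurableSet.univ) fun p hp => ?_
    have : (x.stopped θ).1 p.1 = x.1 p.1 := by rw [hx, min_eq_left (le_min_iff.1 hp.1).2]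
    exact congrArg (fun e => Function.extend Subtype.val h (0 : E × 𝒰 → ℝ) (e, p.2)) this

end PathMartStop

section Martingale

variable {E 𝒰 Ω : Type*} [MetricSpace E] [CompactSpace E] [MeasurableSpace E] [BorelSpace E]
  [MetricSpace 𝒰] [CompactSpace 𝒰] [MeasurableSpace 𝒰] [BorelSpace 𝒰] {E₀ : Set E}
  {Ξ : Set (E × 𝒰)} [MeasurableSpace Ω] {P : Measure Ω}

theorem isPathMartingale_map_iff (hΞ : IsClosed Ξ) {f g : C(E, ℝ)} {h : C(Ξ, ℝ)}
    {X : Ω → ControlPath E 𝒰} (hX : Measurable X) :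
    IsPathMartingale f g h (P.map X) ↔ ∀ a b : ℝ≥0, a ≤ b → ∀ D : Set (ControlPath E 𝒰),
      MeasurableSet D → ∫ ω in {ω | (X ω).stopped a ∈ D},
        (pathMart f g h (X ω) b - pathMart f g h (X ω) a) ∂P = 0 := by
  refine forall_congr' fun a => forall_congr' fun b => forall_congr' fun _ =>
    forall_congr' fun D => forall_congr' fun hD => ?_
  rw [setIntegral_map (f := fun x : ControlPath E 𝒰 => pathMart f g h x b - pathMart f g h x a)
    (measurable_stop a hD) ((measurable_pathMart_at hΞ f g h b).sub
      (measurable_pathMart_at hΞ f g h a)).aestronglyMeasurable hX.aemeasurable]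
  rfl

/-- Every event of the filtration at time a has the form that the stopped triple lies in a
measurable D, so vanishing integrals over these events characterise the conditional expectation. -/
theorem isPathMartingale_map_iff_martingale [IsFiniteMeasure P] (hΞ : IsClosed Ξ) {f g : C(E, ℝ)}
    {h : C(Ξ, ℝ)} {Y : Ω → CadlagPath E} {l : Ω → IncPath} {L : Ω → ControlMeasure 𝒰}
    (hY : Measurable Y) (hl : Measurable l) (hL : Measurable L)
    (hint : ∀ t, Integrable (fun ω => pathMart f g h (Y ω, l ω, L ω) t) P) :
    IsPathMartingale f g h (P.map fun ω => (Y ω, l ω, L ω)) ↔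
      Martingale (fun t ω => controlMart f g h (Y ω) (l ω) (L ω) t)
        (controlFiltration hY hl hL) P := by
  rw [isPathMartingale_map_iff hΞ (hY.prodMk (hl.prodMk hL))]
  have hset : ∀ (a : ℝ≥0) (D : Set (ControlPath E 𝒰)), MeasurableSet D →
      MeasurableSet[controlFiltration hY hl hL a]
        {ω | ControlPath.stopped (Y ω, l ω, L ω) a ∈ D} := fun a D hD => by
    rw [controlFiltration_eq_comap_stop]
    exact ⟨D, hD, rfl⟩
  have hadapt : ∀ t, Measurable[controlFiltration hY hl hL t]
      fun ω => controlMart f g h (Y ω) (l ω) (L ω) t := fun t => by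
    have h1 : (fun ω => controlMart f g h (Y ω) (l ω) (L ω) t)
        = (fun x : ControlPath E 𝒰 => pathMart f g h x t) ∘
          fun ω => ControlPath.stopped (Y ω, l ω, L ω) t := by
      funext ω
      exact ((pathMart_stop f g h (Y ω, l ω, L ω) t t).trans (by rw [min_self]; rfl)).symm
    rw [h1, controlFiltration_eq_comap_stop]
    exact (measurable_pathMart_at hΞ f g h t).comp (comap_measurable _)
  constructor
  · intro H
    refine ⟨fun t => (hadapt t).stronglyMeasurable, fun a b hab => ?_⟩
    refine (ae_eq_condExp_of_forall_setIntegral_eq ((controlFiltration hY hl hL).le a) (hint b)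
      (fun s _ _ => (hint a).integrableOn) (fun s hs _ => ?_)
      (hadapt a).stronglyMeasurable.aestronglyMeasurable).symm
    rw [controlFiltration_eq_comap_stop] at hs
    obtain ⟨D, hD, rfl⟩ := hs
    have h1 := H a b hab D hD
    rw [integral_sub (hint b).integrableOn (hint a).integrableOn, sub_eq_zero] at h1
    exact h1.symm
  · intro H a b hab D hD
    rw [integral_sub (hint b).integrableOn (hint a).integrableOn, sub_eq_zero]
    exact (H.setIntegral_eq hab (hset a D hD)).symm

end Martingale

/-! ### Pasting at a possibly infinite time -/

section PasteAt

variable {E 𝒰 : Type*} [TopologicalSpace E] [MeasurableSpace 𝒰]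

/-- The triple `x` up to time `θ`, continued by `x'` if `θ` is finite. -/
noncomputable def ControlPath.pasteAt (x : ControlPath E 𝒰) (θ : ℝ≥0∞) (x' : ControlPath E 𝒰) :
    ControlPath E 𝒰 :=
  if θ = ∞ then x else x.paste θ.toNNReal x'

theorem ControlPath.pasteAt_top (x x' : ControlPath E 𝒰) : x.pasteAt ∞ x' = x := if_pos rfl

theorem ControlPath.pasteAt_coe (x : ControlPath E 𝒰) (θ : ℝ≥0) (x' : ControlPath E 𝒰) :
    x.pasteAt θ x' = x.paste θ x' := if_neg ENNReal.coe_ne_top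

/-- The path `x'` starts where `x` is at time `θ`, if `θ` is finite. -/
def ControlPath.Joins (x : ControlPath E 𝒰) (θ : ℝ≥0∞) (x' : ControlPath E 𝒰) : Prop :=
  ∀ τ : ℝ≥0, θ = τ → x.1 τ = x'.1 0

theorem ControlPath.stop_top (x : ControlPath E 𝒰) : x.stopped ∞ = x := by
  refine Prod.ext (CadlagPath.ext fun t => ?_)
    (Prod.ext (IncPath.ext fun t => ?_) (Subtype.ext ?_))
  · show x.1 (minTime t ∞) = _
    rw [minTime_top]
  · show x.2.1 (minTime t ∞) = _
    rw [minTime_top]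
  · show x.2.2.1.restrict _ = _
    simp

theorem measurable_pasteAt [TopologicalSpace.PseudoMetrizableSpace E] [MeasurableSpace E]
    [BorelSpace E] {α : Type*} [MeasurableSpace α] {X X' : α → ControlPath E 𝒰}
    {θ : α → ℝ≥0∞} (hX : Measurable X) (hθ : Measurable θ) (hX' : Measurable X') :
    Measurable fun a => (X a).pasteAt (θ a) (X' a) :=
  Measurable.ite (hθ (measurableSet_singleton ∞)) hX
    (measurable_paste hX hθ.ennreal_toNNReal hX')

end PasteAt

section PasteAtRegular

variable {E 𝒰 : Type*} [MetricSpace E] [MeasurableSpace 𝒰] {E₀ : Set E}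
  {Ξ : Set (E × 𝒰)} {x x' : ControlPath E 𝒰} {θ : ℝ≥0∞}

theorem stop_pasteAt_of_lt (hx' : IsRegularPath E₀ Ξ ∞ x') {a : ℝ≥0} (ha : (a : ℝ≥0∞) < θ) :
    (x.pasteAt θ x').stopped a = x.stopped a := by
  induction θ using ENNReal.recTopCoe with
  | top => rw [ControlPath.pasteAt_top]
  | coe τ =>
    rw [ControlPath.pasteAt_coe]
    exact ControlPath.stop_paste_of_lt hx'.lam_zero (ENNReal.coe_lt_coe.1 ha)

theorem stop_pasteAt_self (hs : x = x.stopped θ) (hx' : IsRegularPath E₀ Ξ ∞ x')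
    (hj : x.Joins θ x') : (x.pasteAt θ x').stopped θ = x := by
  induction θ using ENNReal.recTopCoe with
  | top => rw [ControlPath.pasteAt_top, ControlPath.stop_top]
  | coe τ =>
    rw [ControlPath.pasteAt_coe]
    exact ControlPath.stop_paste_self hs (hj τ rfl) hx'.lam_zero hx'.Lam_zero

theorem exitTime_pasteAt {U : Set E} (hU : IsOpen U) (hj : x.Joins (exitTime U x.1) x') :
    exitTime U (x.pasteAt (exitTime U x.1) x').1 = exitTime U x.1 := by
  generalize hθ : exitTime U x.1 = θ at hj
  induction θ using ENNReal.recTopCoe with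
  | top => rw [ControlPath.pasteAt_top, hθ]
  | coe τ =>
    rw [ControlPath.pasteAt_coe]
    exact exitTime_paste hU hθ (hj τ rfl)

/-- A stopped triple contributes no increment after its stopping time. -/
theorem pathMart_eq_of_stopped [TopologicalSpace 𝒰] (f g : C(E, ℝ)) (h : C(Ξ, ℝ))
    (hs : x = x.stopped θ) {a b : ℝ≥0} (hab : a ≤ b) (hθ : θ ≤ a) :
    pathMart f g h x b = pathMart f g h x a := by
  lift θ to ℝ≥0 using ne_top_of_le_ne_top ENNReal.coe_ne_top hθ
  have hθa := ENNReal.coe_le_coe.1 hθ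
  rw [hs, pathMart_stop, pathMart_stop, min_eq_right hθa, min_eq_right (hθa.trans hab)]

theorem IsRegularPath.pasteAt [MeasurableSpace E] [BorelSpace E] [MetricSpace 𝒰] [BorelSpace 𝒰]
    [SecondCountableTopology 𝒰] (hΞ : IsClosed Ξ) (hx : IsRegularPath E₀ Ξ θ x)
    (hs : x = x.stopped θ) (hx' : IsRegularPath E₀ Ξ ∞ x') (hj : x.Joins θ x') :
    IsRegularPath E₀ Ξ ∞ (x.pasteAt θ x') := by
  induction θ using ENNReal.recTopCoe with
  | top => rwa [ControlPath.pasteAt_top]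
  | coe τ =>
    rw [ControlPath.pasteAt_coe]
    exact hx.paste hΞ hs hx' (hj τ rfl)

end PasteAtRegular

section PathMartPasteAt

variable {E 𝒰 : Type*} [MetricSpace E] [CompactSpace E] [MeasurableSpace E] [BorelSpace E]
  [MetricSpace 𝒰] [CompactSpace 𝒰] [MeasurableSpace 𝒰] [BorelSpace 𝒰]
  {E₀ : Set E} {Ξ : Set (E × 𝒰)} {x x' : ControlPath E 𝒰} {θ : ℝ≥0∞}

/-- The part of `pathMart` along a pasted path that comes from the continuation `x'`. -/
noncomputable def pathMartAfter (f g : C(E, ℝ)) (h : C(Ξ, ℝ)) (θ : ℝ≥0∞) (x' : ControlPath E 𝒰)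
    (t : ℝ≥0) : ℝ :=
  if θ = ∞ then 0 else pathMart f g h x' (t - θ.toNNReal)

theorem pathMart_pasteAt (hΞ : IsClosed Ξ) (f g : C(E, ℝ)) (h : C(Ξ, ℝ)) (hs : x = x.stopped θ)
    (hx' : IsRegularPath E₀ Ξ ∞ x') (hj : x.Joins θ x') (t : ℝ≥0) :
    pathMart f g h (x.pasteAt θ x') t = pathMart f g h x t + pathMartAfter f g h θ x' t := by
  induction θ using ENNReal.recTopCoe with
  | top => rw [ControlPath.pasteAt_top, pathMartAfter, if_pos rfl, add_zero]
  | coe τ =>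
    rw [ControlPath.pasteAt_coe, pathMartAfter, if_neg ENNReal.coe_ne_top, ENNReal.toNNReal_coe]
    exact pathMart_paste hΞ f g h hs (hj τ rfl) hx'.Lam_zero t

theorem measurable_pathMartAfter {α : Type*} [MeasurableSpace α] (hΞ : IsClosed Ξ) (f g : C(E, ℝ))
    (h : C(Ξ, ℝ)) {θ : α → ℝ≥0∞} {X' : α → ControlPath E 𝒰} (hθ : Measurable θ)
    (hX' : Measurable X') (t : ℝ≥0) :
    Measurable fun a => pathMartAfter f g h (θ a) (X' a) t := by
  refine Measurable.ite (hθ (measurableSet_singleton ∞)) measurable_const ?_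
  exact (measurable_pathMart hΞ f g h).comp (hX'.prodMk (measurable_const.sub hθ.ennreal_toNNReal))

end PathMartPasteAt

theorem indicator_eq_indicator_of_iff {α β : Type*} {s : Set α} {t : Set β} {F : α → ℝ} {G : β → ℝ}
    {a : α} {b : β} (h : a ∈ s ↔ b ∈ t) (hFG : F a = G b) : s.indicator F a = t.indicator G b := by
  by_cases ha : a ∈ s
  · rw [indicator_of_mem ha, indicator_of_mem (h.1 ha), hFG]
  · rw [indicator_of_notMem ha, indicator_of_notMem (mt h.2 ha)]

/-! ### The martingale property of the pasted process -/

section PastedMartingale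

variable {E 𝒰 Ω Ω' : Type*} [MetricSpace E] [CompactSpace E] [MeasurableSpace E] [BorelSpace E]
  [MetricSpace 𝒰] [CompactSpace 𝒰] [MeasurableSpace 𝒰] [BorelSpace 𝒰] {E₀ : Set E}
  {Ξ : Set (E × 𝒰)} [MeasurableSpace Ω] [MeasurableSpace Ω'] {P : Measure Ω}
  {K : Kernel Ω Ω'}

theorem integrable_pathMart_comp [IsFiniteMeasure P] (hΞ : IsClosed Ξ) (f g : C(E, ℝ))
    (h : C(Ξ, ℝ)) {X : Ω → ControlPath E 𝒰} (hX : Measurable X) {θ : Ω → ℝ≥0∞}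
    (hreg : ∀ᵐ ω ∂P, IsRegularPath E₀ Ξ (θ ω) (X ω)) (t : ℝ≥0) :
    Integrable (fun ω => pathMart f g h (X ω) t) P := by
  obtain ⟨C, hC⟩ := IsRegularPath.exists_abs_pathMart_le E₀ hΞ f g h t
  refine Integrable.of_bound
    ((measurable_pathMart_at hΞ f g h t).comp hX).aestronglyMeasurable C ?_
  filter_upwards [hreg] with ω hω using hC _ _ hω t le_rfl

theorem integrable_pathMartAfter [IsFiniteMeasure P] (hΞ : IsClosed Ξ) (f g : C(E, ℝ))
    (h : C(Ξ, ℝ)) {X' : Ω → ControlPath E 𝒰} (hX' : Measurable X') {θ : Ω → ℝ≥0∞}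
    (hθ : Measurable θ) (hreg : ∀ᵐ ω ∂P, IsRegularPath E₀ Ξ ∞ (X' ω)) (t : ℝ≥0) :
    Integrable (fun ω => pathMartAfter f g h (θ ω) (X' ω) t) P := by
  obtain ⟨C, hC⟩ := IsRegularPath.exists_abs_pathMart_le E₀ hΞ f g h t
  refine Integrable.of_bound
    (measurable_pathMartAfter hΞ f g h hθ hX' t).aestronglyMeasurable C ?_
  filter_upwards [hreg] with ω hω
  rw [pathMartAfter]
  split_ifs
  · rw [norm_zero]
    exact (norm_nonneg _).trans (hC _ _ hω t le_rfl)
  · exact hC _ _ hω _ tsub_le_self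

/-- Continuing the martingale problem after time `θ` by a kernel that solves it. -/
theorem isPathMartingale_pasteAt [IsProbabilityMeasure P] [IsMarkovKernel K] (hΞ : IsClosed Ξ)
    {f g : C(E, ℝ)} {h : C(Ξ, ℝ)} {X : Ω → ControlPath E 𝒰} (hX : Measurable X)
    {θ : Ω → ℝ≥0∞} (hθ : Measurable θ) {X' : Ω' → ControlPath E 𝒰} (hX' : Measurable X')
    (hreg : ∀ᵐ ω ∂P, IsRegularPath E₀ Ξ (θ ω) (X ω)) (hs : ∀ᵐ ω ∂P, X ω = (X ω).stopped (θ ω))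
    (hreg' : ∀ᵐ p ∂(P ⊗ₘ K), IsRegularPath E₀ Ξ ∞ (X' p.2))
    (hj : ∀ᵐ p ∂(P ⊗ₘ K), (X p.1).Joins (θ p.1) (X' p.2))
    (hM : IsPathMartingale f g h (P.map X))
    (hM' : ∀ᵐ ω ∂P, IsPathMartingale f g h ((K ω).map X')) :
    IsPathMartingale f g h
      ((P ⊗ₘ K).map fun p => (X p.1).pasteAt (θ p.1) (X' p.2)) := by
  have hX1 : Measurable fun p : Ω × Ω' => X p.1 := hX.comp measurable_fst
  have hθ1 : Measurable fun p : Ω × Ω' => θ p.1 := hθ.comp measurable_fst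
  have hX2 : Measurable fun p : Ω × Ω' => X' p.2 := hX'.comp measurable_snd
  have hZ := measurable_pasteAt hX1 hθ1 hX2
  have hfst : (P ⊗ₘ K).map Prod.fst = P := Measure.fst_compProd P K
  have hae : ∀ {p : Ω → Prop}, (∀ᵐ ω ∂P, p ω) → ∀ᵐ q ∂(P ⊗ₘ K), p q.1 := fun {p} hp => by
    rw [← hfst] at hp
    exact ae_of_ae_map measurable_fst.aemeasurable hp
  rw [isPathMartingale_map_iff hΞ hZ]
  rw [isPathMartingale_map_iff hΞ hX] at hM
  intro a b hab D hD
  have hA : MeasurableSet {p : Ω × Ω' | ((X p.1).pasteAt (θ p.1) (X' p.2)).stopped a ∈ D} :=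
    hZ (measurable_stop a hD)
  have hi1 : ∀ t, Integrable (fun p : Ω × Ω' => pathMart f g h (X p.1) t) (P ⊗ₘ K) :=
    integrable_pathMart_comp hΞ f g h hX1 (hae hreg)
  have hi2 : ∀ t, Integrable (fun p : Ω × Ω' => pathMartAfter f g h (θ p.1) (X' p.2) t)
      (P ⊗ₘ K) := integrable_pathMartAfter hΞ f g h hX2 hθ1 hreg'
  have hsplit : ∫ p in {p : Ω × Ω' | ((X p.1).pasteAt (θ p.1) (X' p.2)).stopped a ∈ D},
        (pathMart f g h ((X p.1).pasteAt (θ p.1) (X' p.2)) b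
          - pathMart f g h ((X p.1).pasteAt (θ p.1) (X' p.2)) a) ∂(P ⊗ₘ K)
      = ∫ p in {p : Ω × Ω' | ((X p.1).pasteAt (θ p.1) (X' p.2)).stopped a ∈ D},
        ((pathMart f g h (X p.1) b - pathMart f g h (X p.1) a)
          + (pathMartAfter f g h (θ p.1) (X' p.2) b
            - pathMartAfter f g h (θ p.1) (X' p.2) a)) ∂(P ⊗ₘ K) := by
    refine integral_congr_ae (ae_restrict_of_ae ?_)
    filter_upwards [hae hs, hreg', hj] with p h1 h2 h3
    rw [pathMart_pasteAt hΞ f g h h1 h2 h3, pathMart_pasteAt hΞ f g h h1 h2 h3]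
    ring
  -- The event may be replaced by the one about X alone: where θ ≤ a the integrand is zero, and
  -- where a < θ pasting does not change the path up to a.
  have hbefore : ∫ p in {p : Ω × Ω' | ((X p.1).pasteAt (θ p.1) (X' p.2)).stopped a ∈ D},
      (pathMart f g h (X p.1) b - pathMart f g h (X p.1) a) ∂(P ⊗ₘ K) = 0 := by
    have hC : MeasurableSet {ω | (X ω).stopped a ∈ D} := hX (measurable_stop a hD)
    have hF : Measurable fun ω => pathMart f g h (X ω) b - pathMart f g h (X ω) a :=
      ((measurable_pathMart_at hΞ f g h b).comp hX).sub
        ((measurable_pathMart_at hΞ f g h a).comp hX)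
    rw [← hM a b hab D hD]
    conv_rhs => rw [← hfst]
    rw [setIntegral_map hC hF.aestronglyMeasurable measurable_fst.aemeasurable,
      ← integral_indicator hA, ← integral_indicator (measurable_fst hC)]
    refine integral_congr_ae ?_
    filter_upwards [hae hs, hreg'] with p h1 h2
    rcases le_or_gt (θ p.1) a with hle | hlt
    · have h0 : pathMart f g h (X p.1) b - pathMart f g h (X p.1) a = 0 :=
        sub_eq_zero.2 (pathMart_eq_of_stopped f g h h1 hab hle)
      simp only [indicator, h0, ite_self]
    · have h0 := stop_pasteAt_of_lt (x := X p.1) h2 hlt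
      exact indicator_eq_indicator_of_iff (by rw [mem_ofPred_eq, h0]; rfl) rfl
  -- Integrate over the continuation first. With ω fixed, the prefix and θ are deterministic and the
  -- martingale property under K ω applies.
  have hafter : ∫ p in {p : Ω × Ω' | ((X p.1).pasteAt (θ p.1) (X' p.2)).stopped a ∈ D},
      (pathMartAfter f g h (θ p.1) (X' p.2) b
        - pathMartAfter f g h (θ p.1) (X' p.2) a) ∂(P ⊗ₘ K) = 0 := by
    have hi3 : Integrable ({p : Ω × Ω' | ((X p.1).pasteAt (θ p.1) (X' p.2)).stopped a ∈ D}.indicator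
        fun p => pathMartAfter f g h (θ p.1) (X' p.2) b
          - pathMartAfter f g h (θ p.1) (X' p.2) a) (P ⊗ₘ K) :=
      ((hi2 b).sub (hi2 a)).indicator hA
    rw [← integral_indicator hA, Measure.integral_compProd hi3]
    refine integral_eq_zero_of_ae ?_
    filter_upwards [hM'] with ω hω
    rw [isPathMartingale_map_iff hΞ hX'] at hω
    generalize hθω : θ ω = θ'
    induction θ' using ENNReal.recTopCoe with
    | top => simp [pathMartAfter, indicator, hθω]
    | coe τ =>
      have hD' : MeasurableSet {x' : ControlPath E 𝒰 | ((X ω).paste τ x').stopped a ∈ D} :=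
        (measurable_paste measurable_const measurable_const measurable_id) (measurable_stop a hD)
      -- If a < τ, the truncated difference a - τ is 0 and the increment of the continuation is
      -- taken from its start.
      have h1 := hω (a - τ) (b - τ) (tsub_le_tsub_right hab τ) _ hD'
      have hm : MeasurableSet {ω' | (X' ω').stopped (a - τ : ℝ≥0) ∈
          {x' : ControlPath E 𝒰 | ((X ω).paste τ x').stopped a ∈ D}} :=
        hX' (measurable_stop _ hD')
      rw [← integral_indicator hm] at h1
      refine Eq.trans (integral_congr_ae (Filter.Eventually.of_forall fun ω' => ?_)) h1
      have h2 : ((X ω).pasteAt (θ ω) (X' ω')).stopped a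
          = ((X ω).paste τ ((X' ω').stopped (a - τ : ℝ≥0))).stopped a := by
        rw [hθω, ControlPath.pasteAt_coe]
        exact ControlPath.stop_paste _ _ _ _
      exact indicator_eq_indicator_of_iff (by rw [mem_ofPred_eq, h2]; rfl)
        (by simp [pathMartAfter, hθω])
  refine hsplit.trans ((integral_add
    (f := fun p : Ω × Ω' => pathMart f g h (X p.1) b - pathMart f g h (X p.1) a)
    ((hi1 b).sub (hi1 a)).integrableOn ((hi2 b).sub (hi2 a)).integrableOn).trans ?_)
  exact (congrArg₂ (· + ·) hbefore hafter).trans (add_zero 0)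

end PastedMartingale

/-! ### Solutions as laws on path space, and the conclusion -/

section Solutions

variable {E 𝒰 Ω : Type*} [MetricSpace E] [CompactSpace E] [MeasurableSpace E] [BorelSpace E]
  [MetricSpace 𝒰] [CompactSpace 𝒰] [MeasurableSpace 𝒰] [BorelSpace 𝒰] {E₀ : Set E}
  {Ξ : Set (E × 𝒰)} {A : Set (C(E, ℝ) × C(E, ℝ))} {B : Set (C(E, ℝ) × C(Ξ, ℝ))} {U : Set E}
  [MeasurableSpace Ω] {P : Measure Ω} {Y : Ω → CadlagPath E} {lam : Ω → IncPath}
  {Lam : Ω → ControlMeasure 𝒰}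

namespace IsStoppedControlledSolution

theorem measurable_path (hsol : IsStoppedControlledSolution A E₀ B U P Y lam Lam) :
    Measurable fun ω => (Y ω, lam ω, Lam ω) :=
  hsol.measurable_Y.prodMk (hsol.measurable_lam.prodMk hsol.measurable_Lam)

theorem ae_isRegularPath (hΞ : IsClosed Ξ)
    (hsol : IsStoppedControlledSolution A E₀ B U P Y lam Lam) :
    ∀ᵐ ω ∂P, IsRegularPath E₀ Ξ (exitTime U (Y ω)) (Y ω, lam ω, Lam ω) := by
  filter_upwards [hsol.sum_eq, hsol.lam_support, hsol.Lam_support] with ω h1 h2 h3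
    using IsRegularPath.of_support hΞ h1 h2 h3

theorem ae_eq_stop (hsol : IsStoppedControlledSolution A E₀ B U P Y lam Lam) :
    ∀ᵐ ω ∂P, (Y ω, lam ω, Lam ω)
      = ControlPath.stopped (Y ω, lam ω, Lam ω) (exitTime U (Y ω)) := by
  filter_upwards [hsol.stopped] with ω h using Prod.ext h.1 (Prod.ext h.2.1 h.2.2)

theorem isPathMartingale [IsFiniteMeasure P] (hΞ : IsClosed Ξ)
    (hsol : IsStoppedControlledSolution A E₀ B U P Y lam Lam) {f g : C(E, ℝ)} {h : C(Ξ, ℝ)}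
    (hfg : (f, g) ∈ A) (hfh : (f, h) ∈ B) :
    IsPathMartingale f g h (P.map fun ω => (Y ω, lam ω, Lam ω)) :=
  (isPathMartingale_map_iff_martingale hΞ hsol.measurable_Y hsol.measurable_lam hsol.measurable_Lam
    (integrable_pathMart_comp hΞ f g h hsol.measurable_path (hsol.ae_isRegularPath hΞ))).2
    (hsol.martingale f g h hfg hfh)

end IsStoppedControlledSolution

theorem isControlledSolution_of_isRegularPath [IsFiniteMeasure P] (hΞ : IsClosed Ξ)
    {X : Ω → ControlPath E 𝒰} (hX : Measurable X) (hreg : ∀ᵐ ω ∂P, IsRegularPath E₀ Ξ ∞ (X ω))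
    (hM : ∀ (f g : C(E, ℝ)) (h : C(Ξ, ℝ)), (f, g) ∈ A → (f, h) ∈ B →
      IsPathMartingale f g h (P.map X)) :
    IsControlledSolution A E₀ B P (fun ω => (X ω).1) (fun ω => (X ω).2.1)
      fun ω => (X ω).2.2 where
  measurable_Y := hX.fst
  measurable_lam := hX.snd.fst
  measurable_Lam := hX.snd.snd
  lam_support := by filter_upwards [hreg] with ω h using h.lam_support
  Lam_support := by filter_upwards [hreg] with ω h using h.Lam_support hΞ
  stopped := Filter.Eventually.of_forall fun ω => by
    simp only [exitTime_univ]
    have h := (X ω).stop_top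
    exact ⟨(congrArg (fun x => x.1) h).symm, (congrArg (fun x => x.2.1) h).symm,
      (congrArg (fun x => x.2.2) h).symm⟩
  sum_eq := by
    filter_upwards [hreg] with ω h
    simp only [exitTime_univ]
    exact h.clock
  martingale f g h hfg hfh :=
    (isPathMartingale_map_iff_martingale hΞ hX.fst hX.snd.fst hX.snd.snd
      (integrable_pathMart_comp hΞ f g h hX hreg)).1 (hM f g h hfg hfh)

/-- A kernel on the path space that solves the controlled martingale problem, disintegrating a
solution with respect to its initial value. -/
theorem exists_solution_kernel [IsProbabilityMeasure P] (hΞ : IsClosed Ξ)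
    (hsol : IsControlledSolution A E₀ B P Y lam Lam) {ν : Measure E} [IsProbabilityMeasure ν]
    (hν : P.map (fun ω => Y ω 0) = ν) :
    ∃ κ : Kernel E (ControlPath E 𝒰), IsMarkovKernel κ ∧
      (∀ᵐ p ∂(ν ⊗ₘ κ), IsRegularPath E₀ Ξ ∞ p.2 ∧ p.2.1 0 = p.1) ∧
      ∀ (f g : C(E, ℝ)) (h : C(Ξ, ℝ)), (f, g) ∈ A → (f, h) ∈ B →
        ∀ᵐ e ∂ν, IsPathMartingale f g h (κ e) := by
  have hXm := IsStoppedControlledSolution.measurable_path hsol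
  let Q := P.map fun ω => (Y ω, lam ω, Lam ω)
  have hQp : IsProbabilityMeasure Q := Measure.isProbabilityMeasure_map hXm.aemeasurable
  have hStd : StandardBorelSpace (ControlPath E 𝒰) := standardBorelSpace_controlPath
  have hne : Nonempty (ControlPath E 𝒰) := nonempty_of_isProbabilityMeasure Q
  have h0 : Measurable fun x : ControlPath E 𝒰 => x.1 0 := measurable_eval_path measurable_fst 0
  have hQ : ∀ᵐ x ∂Q, IsRegularPath E₀ Ξ ∞ x := by
    refine (ae_map_iff hXm.aemeasurable (IsRegularPath.measurableSet_setOf hΞ)).2 ?_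
    filter_upwards [IsStoppedControlledSolution.ae_isRegularPath hΞ hsol] with ω hω
    rwa [exitTime_univ] at hω
  have hQ0 : Q.map (fun x => x.1 0) = ν := by
    rw [← hν]
    exact Measure.map_map h0 hXm
  -- The conditional law of the whole path given its starting point.
  have hκ : ν ⊗ₘ condDistrib id (fun x : ControlPath E 𝒰 => x.1 0) Q
      = Q.map fun x => (x.1 0, x) := by
    rw [← hQ0]
    exact compProd_map_condDistrib aemeasurable_id
  refine ⟨condDistrib id (fun x => x.1 0) Q, inferInstance, ?_, fun f g h hfg hfh =>
    ae_isPathMartingale_kernel hΞ f g h hQ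
      (IsStoppedControlledSolution.isPathMartingale hΞ hsol hfg hfh) hκ⟩
  have hm : MeasurableSet {p : E × ControlPath E 𝒰 | IsRegularPath E₀ Ξ ∞ p.2 ∧ p.2.1 0 = p.1} :=
    (measurable_snd (IsRegularPath.measurableSet_setOf hΞ)).inter
      (measurableSet_eq_fun (h0.comp measurable_snd) measurable_fst)
  rw [hκ]
  refine (ae_map_iff (h0.prodMk measurable_id).aemeasurable hm).2 ?_
  filter_upwards [hQ] with x hx using ⟨hx, rfl⟩

end Solutions

/-- Every Markov kernel to a standard Borel space is realised on the real line. -/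
theorem exists_kernel_real_map_eq {α β : Type*} [MeasurableSpace α] [MeasurableSpace β]
    [StandardBorelSpace β] [Nonempty β] (κ : Kernel α β) [IsMarkovKernel κ] :
    ∃ (K : Kernel α ℝ) (φ : ℝ → β), IsMarkovKernel K ∧ Measurable φ ∧ K.map φ = κ := by
  have he := measurableEmbedding_embeddingReal β
  refine ⟨κ.map (embeddingReal β), he.invFun, Kernel.IsMarkovKernel.map κ he.measurable,
    he.measurable_invFun, ?_⟩
  rw [← Kernel.map_comp_right κ he.measurable he.measurable_invFun,
    he.leftInverse_invFun.comp_eq_id, Kernel.map_id]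

theorem theorem2p3 {E : Type uE} {𝒰 : Type uU}
    [MetricSpace E] [CompactSpace E] [MeasurableSpace E] [BorelSpace E]
    [MetricSpace 𝒰] [CompactSpace 𝒰] [MeasurableSpace 𝒰] [BorelSpace 𝒰]
    (E₀ : Set E) (hE₀ : IsOpen E₀)
    (A : Set (C(E, ℝ) × C(E, ℝ))) (hA : ((1 : C(E, ℝ)), (0 : C(E, ℝ))) ∈ A)
    (Ξ : Set (E × 𝒰)) (hΞ : IsClosed Ξ) (hΞ_sub : Ξ ⊆ E₀ᶜ ×ˢ univ)
    (hΞ_ex : ∀ x ∉ E₀, ∃ u : 𝒰, (x, u) ∈ Ξ)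
    (B : Set (C(E, ℝ) × C(Ξ, ℝ))) (hB : ((1 : C(E, ℝ)), (0 : C(Ξ, ℝ))) ∈ B)
    (hdense : Dense {f : C(E, ℝ) | (∃ g, (f, g) ∈ A) ∧ ∃ h, (f, h) ∈ B})
    (hex : ∀ ν : Measure E, IsProbabilityMeasure ν →
      ∃ (Ω : Type u₁) (_ : MeasurableSpace Ω) (P : Measure Ω) (_ : IsProbabilityMeasure P)
        (Y : Ω → CadlagPath E) (lam : Ω → IncPath) (Lam : Ω → ControlMeasure 𝒰),
        IsControlledSolution A E₀ B P Y lam Lam ∧ P.map (fun ω => Y ω 0) = ν)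
    (U : Set E) (hU : IsOpen U)
    {ΩU : Type u₂} [MeasurableSpace ΩU] (PU : Measure ΩU) [IsProbabilityMeasure PU]
    (YU : ΩU → CadlagPath E) (lamU : ΩU → IncPath) (LamU : ΩU → ControlMeasure 𝒰)
    (hsol : IsStoppedControlledSolution A E₀ B U PU YU lamU LamU) :
    ∃ (Ω : Type u₂) (_ : MeasurableSpace Ω) (P : Measure Ω) (_ : IsProbabilityMeasure P)
      (Y : Ω → CadlagPath E) (lam : Ω → IncPath) (Lam : Ω → ControlMeasure 𝒰),
      IsControlledSolution A E₀ B P Y lam Lam ∧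
      IdentDistrib
        (fun ω => (YU ω, lamU ω, LamU ω, exitTime U (YU ω)))
        (fun ω => ((Y ω).stopAt (exitTime U (Y ω)), (lam ω).stopAt (exitTime U (Y ω)),
          (Lam ω).stopAt (exitTime U (Y ω)), exitTime U (Y ω))) PU P := by
  have hX := hsol.measurable_path
  have hθ : Measurable fun ω => exitTime U (YU ω) := (measurable_exitTime hU).comp hsol.measurable_Y
  -- Where the exit time is infinite, `toNNReal` gives 0 and z is the initial value; nothing is
  -- pasted there, so this choice has no effect.
  let z : ΩU → E := fun ω => YU ω (exitTime U (YU ω)).toNNReal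
  have hz : Measurable z :=
    measurable_eval_path_prod.comp (hsol.measurable_Y.prodMk hθ.ennreal_toNNReal)
  have hν : IsProbabilityMeasure (PU.map z) := Measure.isProbabilityMeasure_map hz.aemeasurable
  obtain ⟨Ω', _, P', _, Y', lam', Lam', hsol', hY'⟩ := hex (PU.map z) hν
  obtain ⟨κ, hκ, hκreg, hκM⟩ := exists_solution_kernel hΞ hsol' hY'
  have hStd : StandardBorelSpace (ControlPath E 𝒰) := standardBorelSpace_controlPath
  have hne : Nonempty (ControlPath E 𝒰) :=
    (nonempty_of_isProbabilityMeasure PU).map fun ω => (YU ω, lamU ω, LamU ω)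
  -- The continuation is drawn from ℝ rather than from path space, which keeps the product space in
  -- the universe of ΩU.
  obtain ⟨K, φ, hK, hφ, hKφ⟩ := exists_kernel_real_map_eq (κ.comap z hz)
  have hKapply : ∀ ω, (K ω).map φ = κ (z ω) := fun ω => by
    rw [← Kernel.map_apply K hφ, hKφ, Kernel.comap_apply]
  have hpair : ∀ᵐ p ∂(PU ⊗ₘ K), IsRegularPath E₀ Ξ ∞ (φ p.2) ∧ (φ p.2).1 0 = z p.1 := by
    refine Measure.ae_compProd_of_ae_ae (((hφ.comp measurable_snd)
      (IsRegularPath.measurableSet_setOf hΞ)).inter (measurableSet_eq_fun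
        (measurable_eval_path (hφ.comp measurable_snd).fst 0) (hz.comp measurable_fst))) ?_
    filter_upwards [ae_of_ae_map hz.aemeasurable (Measure.ae_ae_of_ae_compProd hκreg)] with ω hω
    rw [← hKapply] at hω
    exact ae_of_ae_map hφ.aemeasurable hω
  have hreg' := hpair.mono fun p hp => hp.1
  have hj : ∀ᵐ p ∂(PU ⊗ₘ K), ControlPath.Joins (YU p.1, lamU p.1, LamU p.1)
      (exitTime U (YU p.1)) (φ p.2) := hpair.mono fun p hp τ hτ => by
    rw [hp.2]
    show YU p.1 τ = YU p.1 (exitTime U (YU p.1)).toNNReal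
    rw [hτ, ENNReal.toNNReal_coe]
  have hfst : (PU ⊗ₘ K).map Prod.fst = PU := Measure.fst_compProd PU K
  have hae : ∀ {p : ΩU → Prop}, (∀ᵐ ω ∂PU, p ω) → ∀ᵐ q ∂(PU ⊗ₘ K), p q.1 := fun {p} hp => by
    rw [← hfst] at hp
    exact ae_of_ae_map measurable_fst.aemeasurable hp
  let X : ΩU × ℝ → ControlPath E 𝒰 := fun p =>
    ControlPath.pasteAt (YU p.1, lamU p.1, LamU p.1) (exitTime U (YU p.1)) (φ p.2)
  have hXm : Measurable X := measurable_pasteAt (hX.comp measurable_fst) (hθ.comp measurable_fst)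
    (hφ.comp measurable_snd)
  refine ⟨ΩU × ℝ, inferInstance, PU ⊗ₘ K, inferInstance, fun p => (X p).1, fun p => (X p).2.1,
    fun p => (X p).2.2, isControlledSolution_of_isRegularPath hΞ hXm ?_ fun f g h hfg hfh => ?_, ?_⟩
  · filter_upwards [hae (hsol.ae_isRegularPath hΞ), hae hsol.ae_eq_stop, hreg', hj]
      with p h1 h2 h3 h4 using h1.pasteAt hΞ h2 h3 h4
  · refine isPathMartingale_pasteAt hΞ hX hθ hφ (hsol.ae_isRegularPath hΞ) hsol.ae_eq_stop
      hreg' hj (hsol.isPathMartingale hΞ hfg hfh) ?_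
    filter_upwards [ae_of_ae_map hz.aemeasurable (hκM f g h hfg hfh)] with ω hω
    rwa [hKapply]
  · have hV : Measurable fun ω => (YU ω, lamU ω, LamU ω, exitTime U (YU ω)) :=
      hsol.measurable_Y.prodMk (hsol.measurable_lam.prodMk (hsol.measurable_Lam.prodMk hθ))
    -- On the product space the two quadruples agree almost surely; the first depends on the ΩU
    -- coordinate only, whose law is PU.
    have heq : (fun p : ΩU × ℝ => (YU p.1, lamU p.1, LamU p.1, exitTime U (YU p.1)))
        =ᵐ[PU ⊗ₘ K] fun p => ((X p).1.stopAt (exitTime U (X p).1),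
          (X p).2.1.stopAt (exitTime U (X p).1), (X p).2.2.stopAt (exitTime U (X p).1),
          exitTime U (X p).1) := by
      filter_upwards [hae hsol.ae_eq_stop, hreg', hj] with p h2 h3 h4
      have h5 : exitTime U (X p).1 = exitTime U (YU p.1) := exitTime_pasteAt hU h4
      have h6 : (X p).stopped (exitTime U (YU p.1)) = (YU p.1, lamU p.1, LamU p.1) :=
        stop_pasteAt_self h2 h3 h4
      rw [h5]
      exact Prod.ext (congrArg (fun x => x.1) h6).symm (Prod.ext
        (congrArg (fun x => x.2.1) h6).symm (Prod.ext (congrArg (fun x => x.2.2) h6).symm rfl))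
    refine ⟨hV.aemeasurable, (hV.comp measurable_fst).aemeasurable.congr heq, ?_⟩
    rw [← Measure.map_congr heq]
    conv_lhs => rw [← hfst]
    exact Measure.map_map hV measurable_fst
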